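/- Let $Y_1,Y_2,Z$ be complex manifolds (Hausdorff, second countable) and let $p_1\colon Z\to Y_1$, $p_2\colon Z\to Y_2$ be holomorphic submersions such that $p_2$ is proper and $(p_1,p_2)\colon Z\to Y_1\times Y_2$ is a closed embedding. Let $\mathcal L_1$ be a holomorphic line bundle on $Y_1$, let $\mathcal L_2,\mathcal L_2'$ be holomorphic line bundles on $Y_2$, and fix an isomorphism of holomorphic line bundles $$p_1^*\mathcal L_1\;\simeq\;p_2^*\mathcal L_2\otimes K_{Z/Y_2},$$ where $K_{Z/Y_2}$ is the relative canonical bundle. For a holomorphic line bundle $\mathcal L$ put $|\mathcal L|^2=\mathcal L\otimes\overline{\mathcal L}$, a $C^\infty$ line bundle; in particular $|K_{Z/Y_2}|^2$ is the bundle of relative densities. *Analytic transform.* Let $$H_Z\in \mathcal Hom\bigl(p_{2*}p_1^{-1}(\mathcal C^\infty_{Y_1,|\mathcal L_1|^2}),\,\mathcal C^\infty_{Y_2,|\mathcal L_2|^2}\bigr)$$ be the map which pulls a smooth section of $|\mathcal L_1|^2$ back to $Z$, regards it as a section of $|p_2^*\mathcal L_2|^2\otimes|K_{Z/Y_2}|^2$,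 and integrates it over the fibres of $p_2$. *$D$-module transform.* Let $\mathcal D$ denote sheaves of holomorphic differential operators. Let $\mathcal D_{Z\to Y_i}=\mathcal D_Z/(\mathcal D_Z\cdot\Theta_{Z/Y_i})$, where $\Theta_{Z/Y_i}$ is the sheaf of holomorphic vector fields tangent to the fibres of $p_i$, and let $\mathcal D_{Y_2\leftarrow Z}=K_Z\otimes\mathcal D_{Z\to Y_2}\otimes p_2^{-1}K_{Y_2}^{-1}$, a $(p_2^{-1}\mathcal D_{Y_2},\mathcal D_Z)$-bimodule. Let $$\mathcal H_Z=\mathcal L_2\otimes_{\mathcal O_{Y_2}}\mathbf H^0_Z(\mathcal D_{Y_1}\otimes\mathcal L_1^{-1}),\qquad \mathbf H^0_Z(\mathcal G)=H^0Rp_{2*}\bigl(\mathcal D_{Y_2\leftarrow Z}\overset{L}{\otimes}_{\mathcal D_Z}p_1^*\mathcal G\bigr).$$ Since $Z\to Y_1\times Y_2$ is a closed embedding, $\mathbf H^0_Z(\mathcal D_{Y_1}\otimes\mathcal L_1^{-1})=p_{2*}\bigl(\mathcal D_{Y_2\leftarrow Z}\otimes_{\mathcal D_Z}p_1^*(\mathcal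 D_{Y_1}\otimes\mathcal L_1^{-1})\bigr)$. Let $\psi_Z\in\Gamma(Y_2,\mathcal H_Z)$ be the canonical section determined by $1\in\mathcal D_{Y_1}$ and the fixed isomorphism: if $e_1,e_2$ are local frames of $\mathcal L_1,\mathcal L_2$, $y$ are local coordinates on $Y_2$, $(x,y)$ are local coordinates on $Z$ with $p_2(x,y)=y$, and the fixed isomorphism sends $p_1^*e_1$ to $c\,p_2^*e_2\otimes dx$, then locally on $Z$ $$\psi_Z=e_2\otimes\bigl(dx\,dy\otimes[c]\otimes dy^{-1}\bigr)\otimes\bigl([1]\otimes e_1^{-1}\bigr).$$ *Claim.* Let $P\in\Gamma(Y_2,\mathcal L_2'\otimes\mathcal D_{Y_2}\otimes\mathcal L_2^{-1})$ be a holomorphic differential operator from $\mathcal L_2$ to $\mathcal L_2'$, acting on smooth sections of $|\mathcal L_2|^2=\mathcal L_2\otimes\overline{\mathcal L_2}$ with values in $\mathcal L_2'\otimes\overline{\mathcal L_2}$, and let $\overline P$ be the complex conjugate operator, $\overline P s=\overline{P\bar s}$. If $P\cdot\psi_Z=0$, then $$P\cdot H_Z=0\qquad\text{and}\qquad\overline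 P\cdot H_Z=0 .$$ That is, for every open $V\subset Y_2$ and every section $g$ of $p_1^{-1}(\mathcal C^\infty_{Y_1,|\mathcal L_1|^2})$ over $p_2^{-1}(V)$, the section $H_Z(g)$ of $|\mathcal L_2|^2$ over $V$ is smooth and $P(H_Z(g))=0$, $\overline P(H_Z(g))=0$ on $V$. (For $\mathcal L_2'=\mathcal L_2$ this is the case $P\in\Gamma(Y_2,\mathcal D_{Y_2,\mathcal L_2})$.) -/

import Mathlib

open Filter Topology Bundle MeasureTheory
open scoped Manifold ContDiff TensorProduct

noncomputable section

namespace IntegralTransform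

/-! ### Germs of functions and holomorphic differential operators

Complex manifolds are charted spaces over a complex vector space `E`; the same charts make them
real manifolds.  Stalks of the sheaf of holomorphic differential operators are realised in their
(faithful) action on germs of complex valued `C^∞` functions. -/

section Germs

variable {X : Type*} [TopologicalSpace X]
  (E : Type*) [NormedAddCommGroup E] [NormedSpace ℂ E] [ChartedSpace E X]

/-- `f` is `C^∞` (in the real sense) on a neighbourhood of `x`. -/
def SmoothNear (f : X → ℂ) (x : X) : Prop :=
  ∀ᶠ x' in 𝓝 x, ContMDiffAt 𝓘(ℝ, E) 𝓘(ℝ, ℂ) ∞ f x'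

/-- `f` is holomorphic on a neighbourhood of `x`. -/
def HolNear (f : X → ℂ) (x : X) : Prop :=
  ∀ᶠ x' in 𝓝 x, MDifferentiableAt 𝓘(ℂ, E) 𝓘(ℂ, ℂ) f x'

/-- The space of germs at `x` of `C^∞` functions, as a subspace of the space of all germs. -/
def smoothGerms (x : X) : Submodule ℂ (Germ (𝓝 x) ℂ) where
  carrier := {φ | ∃ f : X → ℂ, φ = (f : Germ (𝓝 x) ℂ) ∧ SmoothNear E f x}
  add_mem' := by
    rintro _ _ ⟨f, rfl, hf⟩ ⟨g, rfl, hg⟩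
    refine ⟨f + g, rfl, ?_⟩
    filter_upwards [hf, hg] with x' h h' using h.add h'
  zero_mem' := ⟨0, rfl, Eventually.of_forall fun _ => contMDiffAt_const⟩
  smul_mem' := by
    rintro c _ ⟨f, rfl, hf⟩
    refine ⟨c • f, rfl, ?_⟩
    filter_upwards [hf] with x' h
    exact ((c • ContinuousLinearMap.id ℝ ℂ).contMDiff).contMDiffAt.comp x' h

/-- The stalk at `x` of the sheaf of `C^∞` functions. -/
def SmoothGerm (x : X) : Type _ := smoothGerms E x

instance (x : X) : AddCommGroup (SmoothGerm E x) := inferInstanceAs (AddCommGroup (smoothGerms E x))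

instance (x : X) : Module ℂ (SmoothGerm E x) := inferInstanceAs (Module ℂ (smoothGerms E x))

variable {E} in
/-- A germ of a `C^∞` function, as a germ of a function. -/
def SmoothGerm.germ {x : X} (u : SmoothGerm E x) : Germ (𝓝 x) ℂ := Subtype.val u

/-- `ℂ`-linear operators on the stalk of `C^∞` functions. -/
abbrev GermOp (x : X) := Module.End ℂ (SmoothGerm E x)

/-- `M` is multiplication by the function `f`. -/
def IsMulBy {x : X} (f : X → ℂ) (M : GermOp E x) : Prop :=
  ∀ u : SmoothGerm E x, (M u).germ = (f : Germ (𝓝 x) ℂ) * u.germ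

/-- Multiplications by germs of holomorphic functions. -/
def mulOps (x : X) : Set (GermOp E x) := {M | ∃ f : X → ℂ, HolNear E f x ∧ IsMulBy E f M}

variable {F : Type*} [NormedAddCommGroup F] [NormedSpace ℂ F]

/-- The derivative of type `(1,0)` in the constant direction `v`, in the coordinate system `κ`:
`∂_v f = (df(v) - i df(iv)) / 2`.  If `v` is the `j`-th coordinate vector of `ℂⁿ`, this is the
Wirtinger derivative `∂f/∂z_j`. -/
def wirt (κ : OpenPartialHomeomorph X F) (v : F) (f : X → ℂ) : X → ℂ := fun x =>
  (1 / 2 : ℂ) * (fderiv ℝ (f ∘ κ.symm) (κ x) v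
    - Complex.I * fderiv ℝ (f ∘ κ.symm) (κ x) (Complex.I • v))

/-- The constant coefficient vector fields `∂_v` of the coordinate system `κ`. -/
def derivOps (κ : OpenPartialHomeomorph X F) (x : X) : Set (GermOp E x) :=
  {δ | ∃ v : F, ∀ (f : X → ℂ) (u : SmoothGerm E x), u.germ = f →
    (δ u).germ = (wirt κ v f : X → ℂ)}

/-- The stalk at `x` of the sheaf of rings of holomorphic differential operators: it is generated
by the holomorphic functions and the coordinate vector fields.  Here `κ` is a holomorphic
coordinate system at `x`; the ring does not depend on it. -/
def DStalk (κ : OpenPartialHomeomorph X F) (x : X) : Subalgebra ℂ (GermOp E x) :=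
  Algebra.adjoin ℂ (mulOps E x ∪ derivOps E κ x)

/-- The graph of the formal transposition `Q ↦ Qᵗ` in the coordinates `κ`, the anti-automorphism
of the ring of differential operators with `fᵗ = f` for functions `f` and `∂_vᵗ = -∂_v`.  It
expresses the right action of differential operators on top degree forms:
`(u dκ) · Q = (Qᵗ u) dκ`. -/
def transposePairs (κ : OpenPartialHomeomorph X F) (x : X) :
    Subalgebra ℂ (GermOp E x × (GermOp E x)ᵐᵒᵖ) :=
  Algebra.adjoin ℂ
    ({q | ∃ M ∈ mulOps E x, q = (M, MulOpposite.op M)} ∪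
      {q | ∃ δ ∈ derivOps E κ x, q = (δ, MulOpposite.op (-δ))})

/-- The stalk of the tangent sheaf: combinations of the `∂_v` with holomorphic coefficients. -/
def ThetaStalk (κ : OpenPartialHomeomorph X F) (x : X) : Submodule ℂ (GermOp E x) :=
  Submodule.span ℂ {θ | ∃ M ∈ mulOps E x, ∃ δ ∈ derivOps E κ x, θ = M * δ}

variable {Y : Type*} [TopologicalSpace Y]
  (E' : Type*) [NormedAddCommGroup E'] [NormedSpace ℂ E'] [ChartedSpace E' Y]

/-- The stalk at `x` of the relative tangent sheaf `Θ_{X/Y}` of `p : X → Y`: vector fields which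
annihilate all functions pulled back from `Y`. -/
def relTheta (κ : OpenPartialHomeomorph X F) (p : X → Y) (x : X) : Set (GermOp E x) :=
  {θ | θ ∈ ThetaStalk E κ x ∧ ∀ u : Y → ℂ, SmoothNear E' u (p x) →
    ∀ w : SmoothGerm E x, w.germ = (u ∘ p : X → ℂ) → θ w = 0}

/-- The left ideal `D_X · Θ_{X/Y}` at `x`. -/
def relIdeal (κ : OpenPartialHomeomorph X F) (p : X → Y) (x : X) :
    Submodule (DStalk E κ x) (DStalk E κ x) :=
  Submodule.span (DStalk E κ x) {R | (R : GermOp E x) ∈ relTheta E E' κ p x}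

/-- The stalk at `x` of the transfer module `D_{X → Y} = D_X / (D_X · Θ_{X/Y})` of a submersion
`p : X → Y`. -/
abbrev TransferStalk (κ : OpenPartialHomeomorph X F) (p : X → Y) (x : X) :=
  DStalk E κ x ⧸ relIdeal E E' κ p x

/-- `T`, a differential operator on `X` at `x`, lifts `S`, a differential operator on `Y` at
`p x`: `T ∘ p^* = p^* ∘ S`.  The right action of `S` on `D_{X → Y} = D_X / (D_X · Θ_{X/Y})` is
`[R] · S = [R * T]`. -/
def IsLift (p : X → Y) (x : X) (S : GermOp E' (p x)) (T : GermOp E x) : Prop :=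
  ∀ (u v : Y → ℂ) (U : SmoothGerm E' (p x)) (W : SmoothGerm E x),
    U.germ = u → (S U).germ = v →
    W.germ = (u ∘ p : X → ℂ) → (T W).germ = (v ∘ p : X → ℂ)

end Germs

/-! ### The tensor product `D_{Y₂ ← Z} ⊗ D_{Z → Y₁}` over `D_Z` -/

section Tensor

variable {Z Y₁ Y₂ : Type*} [TopologicalSpace Z] [TopologicalSpace Y₁] [TopologicalSpace Y₂]
  (EZ : Type*) [NormedAddCommGroup EZ] [NormedSpace ℂ EZ] [ChartedSpace EZ Z]
  (E₁ : Type*) [NormedAddCommGroup E₁] [NormedSpace ℂ E₁] [ChartedSpace E₁ Y₁]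
  (E₂ : Type*) [NormedAddCommGroup E₂] [NormedSpace ℂ E₂] [ChartedSpace E₂ Y₂]
  {F : Type*} [NormedAddCommGroup F] [NormedSpace ℂ F]

/-- The relations `a · Q ⊗ n = a ⊗ Q · n`, for `Q` in `D_Z`.  In the frame given by the
coordinates `κ` of `Z` (and any coordinates of `Y₂`), the right `D_Z`-module
`D_{Y₂ ← Z} = K_Z ⊗ D_{Z → Y₂} ⊗ K_{Y₂}⁻¹` is `D_{Z → Y₂}` with right action
`[R] · Q = [Qᵗ * R]`. -/
def balanced (κ : OpenPartialHomeomorph Z F) (p₁ : Z → Y₁) (p₂ : Z → Y₂) (z : Z) :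
    Submodule ℂ (TransferStalk EZ E₂ κ p₂ z ⊗[ℂ] TransferStalk EZ E₁ κ p₁ z) :=
  Submodule.span ℂ {t | ∃ Q Qt R T : DStalk EZ κ z,
    ((Q : GermOp EZ z), MulOpposite.op (Qt : GermOp EZ z)) ∈ transposePairs EZ κ z ∧
    t = (Submodule.Quotient.mk (Qt * R) : TransferStalk EZ E₂ κ p₂ z) ⊗ₜ[ℂ]
          (Submodule.Quotient.mk T : TransferStalk EZ E₁ κ p₁ z)
      - (Submodule.Quotient.mk R : TransferStalk EZ E₂ κ p₂ z) ⊗ₜ[ℂ]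
          (Submodule.Quotient.mk (Q * T) : TransferStalk EZ E₁ κ p₁ z)}

/-- The stalk at `z` of the sheaf `D_{Y₂ ← Z} ⊗_{D_Z} D_{Z → Y₁}`, in the frame given by the
coordinates `κ`. -/
abbrev KernelStalk (κ : OpenPartialHomeomorph Z F) (p₁ : Z → Y₁) (p₂ : Z → Y₂) (z : Z) :=
  (TransferStalk EZ E₂ κ p₂ z ⊗[ℂ] TransferStalk EZ E₁ κ p₁ z) ⧸ balanced EZ E₁ E₂ κ p₁ p₂ z

/-- The class of `[R] ⊗ [T]`. -/
def kernelMk (κ : OpenPartialHomeomorph Z F) (p₁ : Z → Y₁) (p₂ : Z → Y₂) (z : Z)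
    (R T : DStalk EZ κ z) : KernelStalk EZ E₁ E₂ κ p₁ p₂ z :=
  Submodule.Quotient.mk
    ((Submodule.Quotient.mk R : TransferStalk EZ E₂ κ p₂ z) ⊗ₜ[ℂ]
      (Submodule.Quotient.mk T : TransferStalk EZ E₁ κ p₁ z))

end Tensor

/-! ### Smooth sections of `L' ⊗ \bar L` and of `|L|² = L ⊗ \bar L` -/

section Sections

/-- For complex lines `A` and `B`, the line `A ⊗ \bar B`: sesquilinear forms on the duals. -/
abbrev Sesq (A B : Type*) [AddCommGroup A] [Module ℂ A] [AddCommGroup B] [Module ℂ B] :=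
  Module.Dual ℂ A →ₗ[ℂ] Module.Dual ℂ B →ₛₗ[starRingEnd ℂ] ℂ

/-- Complex conjugation `A ⊗ \bar B → B ⊗ \bar A`. -/
def Sesq.conj {A B : Type*} [AddCommGroup A] [Module ℂ A] [AddCommGroup B] [Module ℂ B]
    (s : Sesq A B) : Sesq B A :=
  LinearMap.mk₂'ₛₗ (RingHom.id ℂ) (starRingEnd ℂ) (fun l m => starRingEnd ℂ (s m l))
    (by intros; simp) (by intros; simp) (by intros; simp) (by intros; simp)

/-- The element `c · a ⊗ \bar b` of `A ⊗ \bar B`. -/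
def Sesq.ofVec {A B : Type*} [AddCommGroup A] [Module ℂ A] [AddCommGroup B] [Module ℂ B]
    (c : ℂ) (a : A) (b : B) : Sesq A B :=
  LinearMap.mk₂'ₛₗ (RingHom.id ℂ) (starRingEnd ℂ) (fun l m => c * l a * starRingEnd ℂ (m b))
    (by intros; simp; ring) (by intros; simp; ring) (by intros; simp; ring)
    (by intros; simp; ring)

variable {Y : Type*} [TopologicalSpace Y]
  (E : Type*) [NormedAddCommGroup E] [NormedSpace ℂ E] [ChartedSpace E Y]
  (L : Y → Type*) [TopologicalSpace (TotalSpace ℂ L)] [∀ y, AddCommGroup (L y)]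
  [∀ y, Module ℂ (L y)] [∀ y, TopologicalSpace (L y)] [FiberBundle ℂ L] [VectorBundle ℂ ℂ L]
  (L' : Y → Type*) [TopologicalSpace (TotalSpace ℂ L')] [∀ y, AddCommGroup (L' y)]
  [∀ y, Module ℂ (L' y)] [∀ y, TopologicalSpace (L' y)] [FiberBundle ℂ L'] [VectorBundle ℂ ℂ L']

/-- The fibre coordinate at `y` of the local trivialisation of `L` chosen at `y₀`. -/
def fibreCoord (y₀ y : Y) : Module.Dual ℂ (L y) := (trivializationAt ℂ L y₀).linearMapAt ℂ y

/-- The value at `y` of the local holomorphic frame of `L` chosen at `y₀`. -/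
def frame (y₀ y : Y) : L y := (trivializationAt ℂ L y₀).symm y 1

variable {L L'} in
/-- The coefficient of a section of `L' ⊗ \bar L` in the local frames chosen at `y₀`. -/
def coeff (y₀ : Y) (s : ∀ y, Sesq (L' y) (L y)) : Y → ℂ :=
  fun y => s y (fibreCoord L' y₀ y) (fibreCoord L y₀ y)

variable {L} in
/-- The section `s` of `|L|²` is `C^∞` near `y`. -/
def SmoothSection (s : ∀ y, Sesq (L y) (L y)) (y : Y) : Prop := SmoothNear E (coeff y s) y

/-- A holomorphic differential operator from `L` to `L'` (a global section of
`L' ⊗ D_Y ⊗ L⁻¹`), given by its action on smooth sections of `|L|² = L ⊗ \bar L`, with values in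
`L' ⊗ \bar L`.  In local holomorphic coordinates and local holomorphic frames it has the form
`∑ₖ aₖ ∂^{wₖ}`, a finite sum, with holomorphic coefficients `aₖ`; the value on a section that is
not smooth is arbitrary. -/
structure HolDiffOp where
  /-- the action on sections of `|L|²` -/
  toFun : (∀ y, Sesq (L y) (L y)) → ∀ y, Sesq (L' y) (L y)
  local_expr : ∀ y₀ : Y, ∃ (n : ℕ) (a : Fin n → Y → ℂ) (w : Fin n → List E),
    (∀ k, HolNear E (a k) y₀) ∧
    ∀ᶠ y in 𝓝 y₀, ∀ s : (∀ y, Sesq (L y) (L y)), SmoothSection E s y →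
      coeff y₀ (toFun s) y
        = ∑ k, a k y * (w k).foldr (fun v f => wirt (chartAt E y₀) v f) (coeff y₀ s) y

variable {L L'}

/-- The complex conjugate operator `\bar P s = \overline{P \bar s}`. -/
def HolDiffOp.barFun {E : Type*} [NormedAddCommGroup E] [NormedSpace ℂ E] [ChartedSpace E Y]
    (P : HolDiffOp E L L') (s : ∀ y, Sesq (L y) (L y)) : ∀ y, Sesq (L y) (L' y) :=
  fun y => (P.toFun (fun y' => (s y').conj) y).conj

/-- `G` is the germ of `P` at `y`, in the local frames of `L` and `L'` chosen at `y`. -/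
def HolDiffOp.IsGermAt {E : Type*} [NormedAddCommGroup E] [NormedSpace ℂ E] [ChartedSpace E Y]
    (P : HolDiffOp E L L') (y : Y) (G : GermOp E y) : Prop :=
  ∀ (s : ∀ y, Sesq (L y) (L y)) (u : SmoothGerm E y), u.germ = (coeff y s : Y → ℂ) →
    (G u).germ = (coeff y (P.toFun s) : Y → ℂ)

end Sections

/-! ### Correspondences -/

section Correspondence

variable {Z Y₁ Y₂ : Type*} [TopologicalSpace Z] [TopologicalSpace Y₁] [TopologicalSpace Y₂]
  (EZ : Type*) [NormedAddCommGroup EZ] [NormedSpace ℂ EZ] [ChartedSpace EZ Z]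
  (E₂ : Type*) [NormedAddCommGroup E₂] [NormedSpace ℂ E₂] [ChartedSpace E₂ Y₂]

/-- A holomorphic submersion chart of `p₂ : Z → Y₂`: a biholomorphic map from an open subset of
`Z` onto an open subset of `ℂᵈ × Y₂` which carries `p₂` to the second projection. -/
structure SubmersionChart (p₂ : Z → Y₂) (d : ℕ) extends
    OpenPartialHomeomorph Z ((Fin d → ℂ) × Y₂) where
  hol : MDifferentiableOn 𝓘(ℂ, EZ) (𝓘(ℂ, Fin d → ℂ).prod 𝓘(ℂ, E₂)) toFun source
  hol_symm : MDifferentiableOn (𝓘(ℂ, Fin d → ℂ).prod 𝓘(ℂ, E₂)) 𝓘(ℂ, EZ) invFun target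
  snd_eq : ∀ z ∈ source, (toFun z).2 = p₂ z

variable {EZ E₂}

/-- The coordinates `(x, y)` of `Z` with values in `ℂᵈ × E₂` defined by a submersion chart and the
chart of `Y₂` chosen at `y`. -/
def SubmersionChart.coords {p₂ : Z → Y₂} {d : ℕ} (Φ : SubmersionChart EZ E₂ p₂ d) (y : Y₂) :
    OpenPartialHomeomorph Z ((Fin d → ℂ) × E₂) :=
  Φ.toOpenPartialHomeomorph.trans
    ((OpenPartialHomeomorph.refl (Fin d → ℂ)).prod (chartAt E₂ y))

variable (EZ E₂)

/-- The relative tangent space `T_{Z/Y₂}` at `z`. -/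
abbrev VertSpace (p₂ : Z → Y₂) (z : Z) : Submodule ℂ (TangentSpace 𝓘(ℂ, EZ) z) :=
  LinearMap.ker (mfderiv 𝓘(ℂ, EZ) 𝓘(ℂ, E₂) p₂ z).toLinearMap

variable {EZ E₂}

/-- The frame `∂/∂x₁, …, ∂/∂x_d` of the relative tangent bundle over the domain of a submersion
chart `Φ = (x, p₂)`: the vertical tangent vectors with `dx (∂/∂xᵢ) = eᵢ`.  (On the domain of the
chart there is exactly one such vector for each `i`.) -/
def SubmersionChart.vertFrame {p₂ : Z → Y₂} {d : ℕ} (Φ : SubmersionChart EZ E₂ p₂ d) (z : Z) :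
    Fin d → VertSpace EZ E₂ p₂ z := fun i =>
  Classical.epsilon fun v : VertSpace EZ E₂ p₂ z =>
    mfderiv 𝓘(ℂ, EZ) 𝓘(ℂ, Fin d → ℂ) (fun z' => (Φ.toFun z').1) z
      (v : TangentSpace 𝓘(ℂ, EZ) z) = (Pi.single i 1 : Fin d → ℂ)

variable (EZ E₂)
  (L₁ : Y₁ → Type*) [TopologicalSpace (TotalSpace ℂ L₁)] [∀ y, AddCommGroup (L₁ y)]
  [∀ y, Module ℂ (L₁ y)] [∀ y, TopologicalSpace (L₁ y)] [FiberBundle ℂ L₁] [VectorBundle ℂ ℂ L₁]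
  (L₂ : Y₂ → Type*) [TopologicalSpace (TotalSpace ℂ L₂)] [∀ y, AddCommGroup (L₂ y)]
  [∀ y, Module ℂ (L₂ y)] [∀ y, TopologicalSpace (L₂ y)] [FiberBundle ℂ L₂] [VectorBundle ℂ ℂ L₂]

/-- A holomorphic isomorphism `p₁^* L₁ ≃ p₂^* L₂ ⊗ K_{Z/Y₂}`, where `d` is the relative dimension
of `p₂`.  The fibre of `p₂^* L₂ ⊗ K_{Z/Y₂}` at `z` is the space of alternating `d`-forms on the
relative tangent space with values in `L₂ (p₂ z)`. -/
structure TwistIso (p₁ : Z → Y₁) (p₂ : Z → Y₂) (d : ℕ) where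
  /-- the isomorphism on fibres -/
  iso : ∀ z, L₁ (p₁ z) ≃ₗ[ℂ] (VertSpace EZ E₂ p₂ z) [⋀^Fin d]→ₗ[ℂ] L₂ (p₂ z)
  hol : ∀ (Φ : SubmersionChart EZ E₂ p₂ d) (y₁ : Y₁) (y₂ : Y₂),
    MDifferentiableOn 𝓘(ℂ, EZ) 𝓘(ℂ, ℂ)
      (fun z => fibreCoord L₂ y₂ (p₂ z) (iso z (frame L₁ y₁ (p₁ z)) (Φ.vertFrame z)))
      (Φ.source ∩ p₁ ⁻¹' (trivializationAt ℂ L₁ y₁).baseSet ∩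
        p₂ ⁻¹' (trivializationAt ℂ L₂ y₂).baseSet)

variable {EZ E₂ L₁ L₂} {p₁ : Z → Y₁} {p₂ : Z → Y₂} {d : ℕ}

/-- Contraction with the vertical frame `∂/∂x₁, …, ∂/∂x_d` of a submersion chart, composed with a
fibre coordinate of `L₂`: the functional `l ↦ ⟨a(l)(∂/∂x₁, …, ∂/∂x_d), e₂⟩` on `L₁ (p₁ z)`. -/
def TwistIso.contract (a : TwistIso EZ E₂ L₁ L₂ p₁ p₂ d) (Φ : SubmersionChart EZ E₂ p₂ d)
    (y₂ : Y₂) (z : Z) : Module.Dual ℂ (L₁ (p₁ z)) where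
  toFun l := fibreCoord L₂ y₂ (p₂ z) (a.iso z l (Φ.vertFrame z))
  map_add' := by intros; simp
  map_smul' := by intros; simp

/-! #### The analytic integral transform -/

/-- `I` is the coefficient, in the frame of `|L₂|²` chosen at `y`, of the integral over the fibre
`p₂⁻¹(y)` of the section `g` of `|p₁^* L₁|² ≃ |p₂^* L₂|² ⊗ |K_{Z/Y₂}|²`.  A partition of unity
subordinate to submersion charts is used, and `|dx₁ ∧ … ∧ dx_d|²` is Lebesgue measure on `ℂᵈ`. -/
def TwistIso.IsFibreIntegral (a : TwistIso EZ E₂ L₁ L₂ p₁ p₂ d)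
    (g : ∀ z, Sesq (L₁ (p₁ z)) (L₁ (p₁ z))) (y : Y₂) (I : ℂ) : Prop :=
  ∃ (n : ℕ) (Φ : Fin n → SubmersionChart EZ E₂ p₂ d) (ρ : Fin n → Z → ℝ),
    (∀ i, Continuous (ρ i) ∧ tsupport (ρ i) ⊆ (Φ i).source) ∧
    (∀ z, p₂ z = y → ∑ i, ρ i z = 1) ∧
    I = ∑ i, ∫ x in {x : Fin d → ℂ | (x, y) ∈ (Φ i).target},
      (ρ i ((Φ i).invFun (x, y)) : ℂ) *
        g ((Φ i).invFun (x, y)) (a.contract (Φ i) y ((Φ i).invFun (x, y)))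
          (a.contract (Φ i) y ((Φ i).invFun (x, y)))

/-- The integral transform `H_Z = p₂! ∘ p₁⁻¹`, on sections of `p₁⁻¹(C^∞_{|L₁|²})`, which are
regarded as sections of `|p₁^* L₁|²`. -/
def TwistIso.transform (a : TwistIso EZ E₂ L₁ L₂ p₁ p₂ d)
    (g : ∀ z, Sesq (L₁ (p₁ z)) (L₁ (p₁ z))) : ∀ y, Sesq (L₂ y) (L₂ y) := fun y =>
  Sesq.ofVec (Classical.epsilon (a.IsFibreIntegral g y)) (frame L₂ y y) (frame L₂ y y)

/-- `g` is a section over `p₂⁻¹(V)` of the sheaf-theoretic inverse image `p₁⁻¹(C^∞_{|L₁|²})`,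
that is, a section over `V` of `p₂_* p₁⁻¹(C^∞_{|L₁|²})`. -/
def IsPullbackSection (E₁ : Type*) [NormedAddCommGroup E₁] [NormedSpace ℂ E₁]
    [ChartedSpace E₁ Y₁] (p₁ : Z → Y₁) (p₂ : Z → Y₂) (V : Set Y₂)
    (g : ∀ z, Sesq (L₁ (p₁ z)) (L₁ (p₁ z))) : Prop :=
  ∀ z ∈ p₂ ⁻¹' V, ∃ s : ∀ y, Sesq (L₁ y) (L₁ y),
    SmoothSection E₁ s (p₁ z) ∧ ∀ᶠ z' in 𝓝 z, g z' = s (p₁ z')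

/-! #### The canonical section of the `D`-module integral transform -/

variable {L₂' : Y₂ → Type*} [TopologicalSpace (TotalSpace ℂ L₂')] [∀ y, AddCommGroup (L₂' y)]
  [∀ y, Module ℂ (L₂' y)] [∀ y, TopologicalSpace (L₂' y)] [FiberBundle ℂ L₂']
  [VectorBundle ℂ ℂ L₂']

/-- The germ at `z` of `P · ψ_Z` vanishes.

The sheaf in question is `p₂⁻¹L₂ ⊗ (D_{Y₂ ← Z} ⊗_{D_Z} p₁^*(D_{Y₁} ⊗ L₁⁻¹))`, with `L₂'` in place
of `L₂` after the action of `P`.  Near `z` take coordinates `(x, y)` of `Z` adapted to `p₂`, where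
`y` are coordinates of `Y₂`, and frames `e₁`, `e₂`, `e₂'` of the line bundles.  They identify the
stalk of the sheaf with `KernelStalk`, the element `[R] ⊗ [T]` of the latter corresponding to
`e₂ ⊗ (dx dy ⊗ [R] ⊗ dy⁻¹) ⊗ [T] ⊗ e₁⁻¹`.  If the isomorphism
`p₁^* L₁ ≃ p₂^* L₂ ⊗ K_{Z/Y₂}` sends `e₁` to `c · e₂ ⊗ dx`, then the canonical section is
`ψ_Z = [c] ⊗ [1]`.  If `P` is the operator `G` in these coordinates and frames, it acts on
`D_{Y₂ ← Z}` through the right action of the transposed operator `S = Gᵗ` on `D_{Z → Y₂}`, so that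
`P · ψ_Z = [c T] ⊗ [1]` for a lift `T` of `S` to `Z`. -/
def TwistIso.KillsPsiAt (E₁ : Type*) [NormedAddCommGroup E₁] [NormedSpace ℂ E₁]
    [ChartedSpace E₁ Y₁] (a : TwistIso EZ E₂ L₁ L₂ p₁ p₂ d) (P : HolDiffOp E₂ L₂ L₂')
    (z : Z) : Prop :=
  ∃ Φ : SubmersionChart EZ E₂ p₂ d, z ∈ Φ.source ∧
  ∃ (G S : DStalk E₂ (chartAt E₂ (p₂ z)) (p₂ z)) (c T : DStalk EZ (Φ.coords (p₂ z)) z),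
    P.IsGermAt (p₂ z) (G : GermOp E₂ (p₂ z)) ∧
    ((G : GermOp E₂ (p₂ z)), MulOpposite.op (S : GermOp E₂ (p₂ z))) ∈
      transposePairs E₂ (chartAt E₂ (p₂ z)) (p₂ z) ∧
    IsLift EZ E₂ p₂ z (S : GermOp E₂ (p₂ z)) (T : GermOp EZ z) ∧
    IsMulBy EZ (fun z' => a.contract Φ (p₂ z) z' (frame L₁ (p₁ z) (p₁ z'))) (c : GermOp EZ z) ∧
    kernelMk EZ E₁ E₂ (Φ.coords (p₂ z)) p₁ p₂ z (c * T) 1 = 0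

/-- `P · ψ_Z = 0`, where `ψ_Z` is the canonical section, induced by `1 ∈ D_{Y₁}`, of the
`D`-module integral transform
`L₂ ⊗ p₂_*(D_{Y₂ ← Z} ⊗_{D_Z} p₁^*(D_{Y₁} ⊗ L₁⁻¹))`.  A section of a direct image sheaf vanishes
if and only if all its germs on `Z` vanish.

The `D`-module transform is the cohomology in degree `0` of the derived direct image
`R p₂_*(D_{Y₂ ← Z} ⊗ᴸ_{D_Z} p₁^*(D_{Y₁} ⊗ L₁⁻¹))`.  The derived tensor product has no cohomology in
positive degrees, so this `H⁰` always maps canonically to the direct image of the tensor product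
sheaf used here, `ψ_Z` being sent to `ψ_Z`; when `Z → Y₁ × Y₂` is a closed embedding the map is an
isomorphism.  In particular, the vanishing of `P · ψ_Z` in the derived version always implies the
condition stated here. -/
def TwistIso.KillsPsi (E₁ : Type*) [NormedAddCommGroup E₁] [NormedSpace ℂ E₁]
    [ChartedSpace E₁ Y₁] (a : TwistIso EZ E₂ L₁ L₂ p₁ p₂ d) (P : HolDiffOp E₂ L₂ L₂') : Prop :=
  ∀ z, a.KillsPsiAt E₁ P z

end Correspondence

end IntegralTransform

end

set_option linter.unusedSectionVars false

noncomputable section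

namespace IntegralTransform

/-! ### Holomorphic functions of several variables are smooth -/

section Holomorphic

variable {E G : Type*} [NormedAddCommGroup E] [NormedSpace ℂ E] [FiniteDimensional ℂ E]
  [NormedAddCommGroup G] [NormedSpace ℂ G] [FiniteDimensional ℂ G]

/-! The reason is a duality in which ψ_Z plays the role of a distribution kernel. Near a point of Z
take adapted coordinates (x, y), frames e₁, e₂, and the holomorphic function c for which e₁ goes to
c e₂ ⊗ dx. For functions v on Y₂ and u on Y₁ such that (v ∘ p₂)(u ∘ p₁) has compact support in the
coordinate patch, put

⟨[R] ⊗ [T]; v, u⟩ = ∫ c̄ · R(v ∘ p₂) · T(u ∘ p₁) dx dy.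

This is well defined on D_{Y₂ ← Z} ⊗ D_{Z → Y₁}. An R in D·Θ_{Z/Y₂} kills v ∘ p₂, and a T in
D·Θ_{Z/Y₁} kills u ∘ p₁. The tensor relation over D_Z is integration by parts, undisturbed by the
weight c̄ because derivatives of type (1,0) kill antiholomorphic functions
(`testIntegral_eq_zero_of_kernelMk`). Now P·ψ_Z = [cT] ⊗ [1] with T a lift of the transpose S of P,
and its pairing is ∫ (Sv) J dy, where J is the fibre integral of |c|² u ∘ p₁. If it vanishes for all
v, then P J = 0 weakly, hence pointwise, as J is smooth (`eventually_apply_integral_eq_zero`,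
`TwistIso.exists_local_annihilation`).

Two points need care. First, an identity between operators on germs holds, for each function, on a
neighbourhood that may depend on the function, whereas integrals need one neighbourhood for all
functions. A differential operator is determined by its polynomial symbol, and this can be tested on
finitely many exponentials (`IsDOAlong.eventually_eq_zero`). Accordingly the pairing takes values in
germs along a filter of test data with shrinking open sets.

Second, a global section must be cut into pieces that are still pulled back from Y₁, since an
arbitrary cut-off function on Z is not killed by Θ_{Z/Y₁}. As Z is embedded in Y₁ × Y₂, the sets
p₁⁻¹(A) ∩ p₂⁻¹(C) form a basis of neighbourhoods, so a partition of unity on Y₁ suffices; finitely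
many pieces are enough because fibres of p₂ are compact (`TwistIso.exists_transform_eq_sum`). The
pieces are compared with H_Z through the independence of fibre integrals of charts and partitions
(`TwistIso.IsFibreIntegral.unique`).

The statement on P̄ follows from that on P: the conjugate of H_Z(g) is H_Z(ḡ), so P̄(H_Z(g)) is the
conjugate of P(H_Z(ḡ)) = 0. -/

/-- Directional derivatives of holomorphic functions of several variables are holomorphic. -/
theorem differentiableOn_fderiv_apply {f : E → G} {U : Set E} (hU : IsOpen U)
    (hf : DifferentiableOn ℂ f U) (v : E) :
    DifferentiableOn ℂ (fun x => fderiv ℂ f x v) U := by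
  intro x₀ hx₀
  apply DifferentiableAt.differentiableWithinAt
  have hcG : CompleteSpace G := FiniteDimensional.complete ℂ G
  have hpE : ProperSpace E := FiniteDimensional.proper ℂ E
  have hpL : ProperSpace (E →L[ℂ] G) := FiniteDimensional.proper ℂ _
  borelize E
  borelize (E →L[ℂ] G)
  obtain ⟨R, hR, hball⟩ : ∃ R > 0, ∀ x ∈ Metric.ball x₀ R, x ∈ U ∧ dist (f x) (f x₀) < 1 := by
    have h1 : ∀ᶠ x in 𝓝 x₀, x ∈ U ∧ dist (f x) (f x₀) < 1 :=
      (hU.eventually_mem hx₀).and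
        ((hf.differentiableAt (hU.mem_nhds hx₀)).continuousAt.eventually
          (Metric.ball_mem_nhds (f x₀) one_pos))
    exact Metric.eventually_nhds_iff_ball.1 h1
  -- Three steps of length at most `r` must fit into the ball of radius `R`: from `x₀` to `x`, from
  -- `x` to the circle `x + ζ • v`, and the radius of the Cauchy estimate. The `+ 1` in `ε` covers
  -- `v = 0`.
  set r := R / 4 with hr
  have hr0 : 0 < r := by positivity
  set ε := r / (‖v‖ + 1) with hε
  have hε0 : 0 < ε := by positivity
  have hεv : ε * ‖v‖ < r := by
    rw [hε, div_mul_eq_mul_div, div_lt_iff₀ (by positivity)]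
    nlinarith [norm_nonneg v]
  have hmem : ∀ x ∈ Metric.ball x₀ r, ∀ ζ : ℂ, ‖ζ‖ ≤ ε → x + ζ • v ∈ Metric.ball x₀ (2 * r) := by
    intro x hx ζ hζ
    rw [Metric.mem_ball, dist_eq_norm] at hx ⊢
    calc ‖x + ζ • v - x₀‖ = ‖(x - x₀) + ζ • v‖ := by congr 1; abel
      _ ≤ ‖x - x₀‖ + ‖ζ‖ * ‖v‖ := (norm_add_le _ _).trans (by rw [norm_smul])
      _ ≤ ‖x - x₀‖ + ε * ‖v‖ := by gcongr
      _ < 2 * r := by linarith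
  have hsub : Metric.ball x₀ (2 * r) ⊆ Metric.ball x₀ R := Metric.ball_subset_ball (by linarith)
  have hdiff : ∀ x ∈ Metric.ball x₀ (2 * r), DifferentiableAt ℂ f x := fun x hx =>
    hf.differentiableAt (hU.mem_nhds (hball x (hsub hx)).1)
  -- Cauchy estimate: on `ball x r` the values of `f` stay within `2` of `f x`.
  have hbound : ∀ x ∈ Metric.ball x₀ (2 * r), ‖fderiv ℂ f x‖ ≤ 2 / r := by
    intro x hx
    have hs : Metric.ball x r ⊆ Metric.ball x₀ R := by
      intro w hw
      rw [Metric.mem_ball] at *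
      linarith [dist_triangle w x x₀]
    refine Complex.norm_fderiv_le_div_of_mapsTo_ball
      (hf.mono fun w hw => (hball w (hs hw)).1) (fun w hw => ?_) hr0
    have h1 := (hball w (hs hw)).2
    have h2 := (hball x (hsub hx)).2
    rw [Metric.mem_closedBall]
    linarith [dist_triangle_right (f w) (f x) (f x₀)]
  -- Cauchy's formula for the derivative along the complex line through `x` in the direction `v`. On
  -- the right `x` enters only through the values of `f`, so one can differentiate under the
  -- integral.
  have hcauchy : ∀ x ∈ Metric.ball x₀ r, fderiv ℂ f x v
      = (2 * Real.pi * Complex.I : ℂ)⁻¹ • ∫ θ in (0 : ℝ)..2 * Real.pi,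
          (deriv (circleMap 0 ε) θ * (1 / (circleMap 0 ε θ) ^ 2)) • f (x + circleMap 0 ε θ • v) := by
    intro x hx
    have hd : DifferentiableOn ℂ (fun ζ : ℂ => f (x + ζ • v)) (Metric.closedBall 0 ε) := by
      intro ζ hζ
      apply DifferentiableAt.differentiableWithinAt
      have := hdiff _ (hmem x hx ζ (by simpa using hζ))
      exact this.comp ζ (by fun_prop)
    have h1 := hd.deriv_eq_smul_circleIntegral hε0
    have h2 : deriv (fun ζ : ℂ => f (x + ζ • v)) 0 = fderiv ℂ f x v := by
      have h3 : HasDerivAt (fun ζ : ℂ => x + ζ • v) v 0 := by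
        simpa using ((hasDerivAt_id (0 : ℂ)).smul_const v).const_add x
      have h4 : HasFDerivAt f (fderiv ℂ f x) (x + (0 : ℂ) • v) := by
        have := (hdiff x (Metric.ball_subset_ball (by linarith) hx)).hasFDerivAt
        simpa using this
      exact (h4.comp_hasDerivAt (0 : ℂ) h3).deriv
    rw [h2] at h1
    rw [eq_inv_smul_iff₀ Complex.two_pi_I_ne_zero, ← h1]
    simp only [circleIntegral, sub_zero, smul_smul]
  have hcirc : ∀ θ : ℝ, ‖circleMap 0 ε θ‖ ≤ ε := fun θ => by
    simp [abs_of_pos hε0]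
  have hcont : ∀ x ∈ Metric.ball x₀ r, Continuous fun θ : ℝ =>
      (deriv (circleMap 0 ε) θ * (1 / (circleMap 0 ε θ) ^ 2)) •
        f (x + circleMap 0 ε θ • v) := by
    intro x hx
    have h1 : Continuous fun θ : ℝ => f (x + circleMap 0 ε θ • v) := by
      rw [continuous_iff_continuousAt]
      intro θ
      refine ContinuousAt.comp (g := f)
        (hdiff _ (hmem x hx _ (hcirc θ))).continuousAt ?_
      have := (continuous_circleMap 0 ε).continuousAt (x := θ)
      fun_prop
    refine Continuous.smul ?_ h1
    simp only [deriv_circleMap]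
    refine Continuous.mul (by fun_prop) (Continuous.div (by fun_prop) (by fun_prop) fun θ => ?_)
    exact pow_ne_zero _ (circleMap_ne_center hε0.ne')
  have hker : Continuous fun θ : ℝ => (deriv (circleMap 0 ε) θ * (1 / (circleMap 0 ε θ) ^ 2)) := by
    simp only [deriv_circleMap]
    refine Continuous.mul (by fun_prop) (Continuous.div (by fun_prop) (by fun_prop) fun θ => ?_)
    exact pow_ne_zero _ (circleMap_ne_center hε0.ne')
  have key := intervalIntegral.hasFDerivAt_integral_of_dominated_of_fderiv_le
    (𝕜 := ℂ) (μ := volume) (a := 0) (b := 2 * Real.pi)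
    (F := fun x θ => (deriv (circleMap 0 ε) θ * (1 / (circleMap 0 ε θ) ^ 2)) •
        f (x + circleMap 0 ε θ • v))
    (F' := fun x θ => (deriv (circleMap 0 ε) θ * (1 / (circleMap 0 ε θ) ^ 2)) •
        fderiv ℂ f (x + circleMap 0 ε θ • v)) (x₀ := x₀)
    (bound := fun θ => ‖deriv (circleMap 0 ε) θ * (1 / (circleMap 0 ε θ) ^ 2)‖ * (2 / r))
    (Metric.ball_mem_nhds x₀ hr0)
    (Filter.eventually_of_mem (Metric.ball_mem_nhds x₀ hr0) fun x hx =>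
      (hcont x hx).aestronglyMeasurable)
    ((hcont x₀ (Metric.mem_ball_self hr0)).intervalIntegrable _ _)
    -- Continuity of `fderiv ℂ f` is not yet available at this stage; measurability is enough.
    (hker.aestronglyMeasurable.smul
      (((measurable_fderiv ℂ f).comp
        (Continuous.measurable (by fun_prop))).aestronglyMeasurable))
    (Eventually.of_forall fun θ _ x hx => by
      rw [norm_smul]
      exact mul_le_mul_of_nonneg_left (hbound _ (hmem x hx _ (hcirc θ))) (norm_nonneg _))
    (Continuous.intervalIntegrable (by fun_prop) _ _)
    (Eventually.of_forall fun θ _ x hx => by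
      have h1 := (hdiff _ (hmem x hx _ (hcirc θ))).hasFDerivAt
      have h2 : HasFDerivAt (fun x : E => x + circleMap 0 ε θ • v)
          (ContinuousLinearMap.id ℂ E) x := (hasFDerivAt_id x).add_const _
      exact (h1.comp x h2).const_smul _)
  refine DifferentiableAt.congr_of_eventuallyEq
    (key.differentiableAt.const_smul (2 * Real.pi * Complex.I : ℂ)⁻¹) ?_
  filter_upwards [Metric.ball_mem_nhds x₀ hr0] with x hx using hcauchy x hx

/-- A holomorphic function on an open subset of a finite dimensional space is smooth. -/
theorem contDiffOn_of_differentiableOn {f : E → G} {U : Set E} (hU : IsOpen U)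
    (hf : DifferentiableOn ℂ f U) : ContDiffOn ℂ ∞ f U := by
  rw [contDiffOn_infty]
  intro n
  induction n generalizing f with
  | zero => exact contDiffOn_zero.2 hf.continuousOn
  | succ n ih =>
    push_cast
    rw [contDiffOn_succ_iff_fderiv_of_isOpen hU]
    refine ⟨hf, by simp, ?_⟩
    rw [contDiffOn_clm_apply]
    exact fun v => ih (differentiableOn_fderiv_apply hU hf v)

end Holomorphic

/-! ### Wirtinger derivatives on vector spaces -/

section Wirtinger

variable {F F' : Type*} [NormedAddCommGroup F] [NormedSpace ℂ F]
  [NormedAddCommGroup F'] [NormedSpace ℂ F']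

/-- `f` is `C^∞` (in the real sense) on a neighbourhood of `x`. -/
def Sm (f : F → ℂ) (x : F) : Prop := ∀ᶠ x' in 𝓝 x, ContDiffAt ℝ ∞ f x'

/-- `f` is holomorphic on a neighbourhood of `x`. -/
def Hol (f : F → ℂ) (x : F) : Prop := ∀ᶠ x' in 𝓝 x, DifferentiableAt ℂ f x'

/-- The derivative of type `(1,0)` in the direction `v`. -/
def dz (v : F) (f : F → ℂ) : F → ℂ := fun x =>
  (1 / 2 : ℂ) * (fderiv ℝ f x v - Complex.I * fderiv ℝ f x (Complex.I • v))

/-- Iterated derivatives of type `(1,0)`. -/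
def dzs (w : List F) (f : F → ℂ) : F → ℂ := w.foldr dz f

@[simp] theorem dzs_nil (f : F → ℂ) : dzs [] f = f := rfl

@[simp] theorem dzs_cons (v : F) (w : List F) (f : F → ℂ) :
    dzs (v :: w) f = dz v (dzs w f) := rfl

theorem Sm.self {f : F → ℂ} {x : F} (h : Sm f x) : ContDiffAt ℝ ∞ f x := h.self_of_nhds

theorem Sm.eventually {f : F → ℂ} {x : F} (h : Sm f x) : ∀ᶠ x' in 𝓝 x, Sm f x' :=
  eventually_eventually_nhds.2 h

theorem Hol.eventually {f : F → ℂ} {x : F} (h : Hol f x) : ∀ᶠ x' in 𝓝 x, Hol f x' :=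
  eventually_eventually_nhds.2 h

theorem Sm.differentiableAt {f : F → ℂ} {x : F} (h : Sm f x) : DifferentiableAt ℝ f x :=
  h.self.differentiableAt (by simp)

theorem ContDiff.sm {f : F → ℂ} (h : ContDiff ℝ ∞ f) (x : F) : Sm f x :=
  Eventually.of_forall fun _ => h.contDiffAt

theorem Sm.congr {f g : F → ℂ} {x : F} (h : Sm f x) (hfg : f =ᶠ[𝓝 x] g) : Sm g x := by
  filter_upwards [h, hfg.eventuallyEq_nhds] with x' h1 h2
  exact h1.congr_of_eventuallyEq h2.symm

theorem sm_const (c : ℂ) (x : F) : Sm (fun _ => c) x :=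
  Eventually.of_forall fun _ => contDiffAt_const

theorem Sm.add {f g : F → ℂ} {x : F} (hf : Sm f x) (hg : Sm g x) : Sm (fun y => f y + g y) x := by
  filter_upwards [hf, hg] with x' h1 h2 using h1.add h2

theorem Sm.mul {f g : F → ℂ} {x : F} (hf : Sm f x) (hg : Sm g x) : Sm (fun y => f y * g y) x := by
  filter_upwards [hf, hg] with x' h1 h2 using h1.mul h2

theorem Sm.sum {ι : Type*} {s : Finset ι} {f : ι → F → ℂ} {x : F} (hf : ∀ i ∈ s, Sm (f i) x) :
    Sm (fun y => ∑ i ∈ s, f i y) x := by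
  classical
  induction s using Finset.induction_on with
  | empty => simpa using sm_const 0 x
  | insert a s ha ih =>
    simp only [Finset.sum_insert ha]
    exact (hf a (by simp)).add (ih fun i hi => hf i (by simp [hi]))

theorem Sm.conj {f : F → ℂ} {x : F} (hf : Sm f x) : Sm (fun y => starRingEnd ℂ (f y)) x := by
  filter_upwards [hf] with x' h1
  exact Complex.conjCLE.contDiff.contDiffAt.comp x' h1

theorem Sm.dz {f : F → ℂ} {x : F} (hf : Sm f x) (v : F) : Sm (dz v f) x := by
  filter_upwards [hf.eventually] with x' h1
  have h2 : ContDiffAt ℝ ∞ (fderiv ℝ f) x' := h1.self.fderiv_right (by simp)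
  unfold IntegralTransform.dz
  exact contDiffAt_const.mul ((h2.clm_apply contDiffAt_const).sub
    (contDiffAt_const.mul (h2.clm_apply contDiffAt_const)))

theorem Sm.dzs {f : F → ℂ} {x : F} (hf : Sm f x) (w : List F) : Sm (dzs w f) x := by
  induction w with
  | nil => exact hf
  | cons v w ih => exact ih.dz v

theorem hol_const (c : ℂ) (x : F) : Hol (fun _ => c) x :=
  Eventually.of_forall fun _ => differentiableAt_const c

theorem Hol.mul {f g : F → ℂ} {x : F} (hf : Hol f x) (hg : Hol g x) :
    Hol (fun y => f y * g y) x := by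
  filter_upwards [hf, hg] with x' h1 h2 using h1.mul h2

theorem contDiffAt_of_eventually_differentiableAt [FiniteDimensional ℂ F] [FiniteDimensional ℂ F']
    {f : F → F'} {x : F} (h : ∀ᶠ x' in 𝓝 x, DifferentiableAt ℂ f x') : ContDiffAt ℂ ∞ f x := by
  obtain ⟨U, hU, hUo, hxU⟩ := eventually_nhds_iff.1 h
  exact (contDiffOn_of_differentiableOn hUo fun y hy =>
    (hU y hy).differentiableWithinAt).contDiffAt (hUo.mem_nhds hxU)

theorem Hol.sm [FiniteDimensional ℂ F] {f : F → ℂ} {x : F} (h : Hol f x) : Sm f x := by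
  filter_upwards [h.eventually] with x' h1
  exact (contDiffAt_of_eventually_differentiableAt h1).restrict_scalars ℝ

theorem dz_congr {f g : F → ℂ} {x : F} (h : f =ᶠ[𝓝 x] g) (v : F) : dz v f =ᶠ[𝓝 x] dz v g := by
  filter_upwards [h.eventuallyEq_nhds] with x' hx'
  simp only [dz, hx'.fderiv_eq]

theorem dzs_congr {f g : F → ℂ} {x : F} (h : f =ᶠ[𝓝 x] g) (w : List F) :
    dzs w f =ᶠ[𝓝 x] dzs w g := by
  induction w with
  | nil => exact h
  | cons v w ih => exact dz_congr ih v

theorem dz_of_hasFDerivAt {f : F → ℂ} {x : F} {f' : F →L[ℂ] ℂ} (h : HasFDerivAt f f' x) (v : F) :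
    dz v f x = f' v := by
  rw [dz, (h.restrictScalars ℝ).fderiv]
  simp only [ContinuousLinearMap.coe_restrictScalars', map_smul, smul_eq_mul]
  linear_combination (-1 / 2 : ℂ) * f' v * Complex.I_mul_I

theorem dz_hol {f : F → ℂ} {x : F} (h : DifferentiableAt ℂ f x) (v : F) :
    dz v f x = fderiv ℂ f x v := dz_of_hasFDerivAt h.hasFDerivAt v

/-- The derivative of an antiholomorphic function has no part of type (1,0). Hence the weights `c̄`
behave as constants in all integrations by parts below. -/
theorem dz_conj_hol {f : F → ℂ} {x : F} (h : DifferentiableAt ℂ f x) (v : F) :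
    dz v (fun y => starRingEnd ℂ (f y)) x = 0 := by
  have h1 : HasFDerivAt (fun y => starRingEnd ℂ (f y))
      ((Complex.conjCLE : ℂ →L[ℝ] ℂ).comp ((fderiv ℂ f x).restrictScalars ℝ)) x :=
    (Complex.conjCLE : ℂ →L[ℝ] ℂ).hasFDerivAt.comp x (h.hasFDerivAt.restrictScalars ℝ)
  rw [dz, h1.fderiv]
  simp only [ContinuousLinearMap.coe_comp, Function.comp_apply,
    ContinuousLinearMap.coe_restrictScalars', map_smul, smul_eq_mul,
    ContinuousLinearEquiv.coe_coe, Complex.conjCLE_apply, map_mul, Complex.conj_I]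
  linear_combination (1 / 2 : ℂ) * starRingEnd ℂ (fderiv ℂ f x v) * Complex.I_mul_I

theorem Hol.dz [FiniteDimensional ℂ F] {f : F → ℂ} {x : F} (hf : Hol f x) (v : F) :
    Hol (dz v f) x := by
  obtain ⟨U, hU, hUo, hxU⟩ := eventually_nhds_iff.1 hf
  have h1 := differentiableOn_fderiv_apply hUo
    (fun y hy => (hU y hy).differentiableWithinAt) v
  filter_upwards [hUo.mem_nhds hxU] with x' hx'
  refine (h1.differentiableAt (hUo.mem_nhds hx')).congr_of_eventuallyEq ?_
  filter_upwards [hUo.mem_nhds hx'] with y hy using dz_hol (hU y hy) v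

theorem dz_add {f g : F → ℂ} {x : F} (hf : DifferentiableAt ℝ f x) (hg : DifferentiableAt ℝ g x)
    (v : F) : dz v (fun y => f y + g y) x = dz v f x + dz v g x := by
  have h : fderiv ℝ (fun y => f y + g y) x = fderiv ℝ f x + fderiv ℝ g x := fderiv_add hf hg
  simp only [dz, h, add_apply]
  ring

theorem dz_mul {f g : F → ℂ} {x : F} (hf : DifferentiableAt ℝ f x) (hg : DifferentiableAt ℝ g x)
    (v : F) : dz v (fun y => f y * g y) x = dz v f x * g x + f x * dz v g x := by
  have h : fderiv ℝ (fun y => f y * g y) x = f x • fderiv ℝ g x + g x • fderiv ℝ f x :=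
    fderiv_fun_mul hf hg
  simp only [dz, h, add_apply, smul_apply, smul_eq_mul]
  ring

theorem dz_const (c : ℂ) (v : F) (x : F) : dz v (fun _ => c) x = 0 := by
  simp [dz]

theorem dz_sum {ι : Type*} {s : Finset ι} {f : ι → F → ℂ} {x : F}
    (hf : ∀ i ∈ s, DifferentiableAt ℝ (f i) x) (v : F) :
    dz v (fun y => ∑ i ∈ s, f i y) x = ∑ i ∈ s, dz v (f i) x := by
  have h : fderiv ℝ (fun y => ∑ i ∈ s, f i y) x = ∑ i ∈ s, fderiv ℝ (f i) x := fderiv_fun_sum hf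
  simp only [dz, h, sum_apply, Finset.mul_sum, ← Finset.sum_sub_distrib]

theorem dzs_zero (w : List F) (x : F) : dzs w (fun _ => 0) x = 0 := by
  have : dzs w (fun _ : F => (0 : ℂ)) = fun _ => 0 := by
    induction w with
    | nil => rfl
    | cons v w ih =>
      rw [dzs_cons, ih]
      funext y
      exact dz_const 0 v y
  rw [this]

/-- The derivative of a holomorphic `q` commutes with the multiplication by `i` in the definition of
`dz`; for a merely smooth `q` a term of type (0,1) would appear. -/
theorem dz_comp {q : F → F'} {f : F' → ℂ} {x : F} (hq : DifferentiableAt ℂ q x)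
    (hf : DifferentiableAt ℝ f (q x)) (v : F) :
    dz v (fun y => f (q y)) x = dz (fderiv ℂ q x v) f (q x) := by
  have h : HasFDerivAt (fun y => f (q y))
      ((fderiv ℝ f (q x)).comp ((fderiv ℂ q x).restrictScalars ℝ)) x :=
    hf.hasFDerivAt.comp x (hq.hasFDerivAt.restrictScalars ℝ)
  simp [dz, h.fderiv]

theorem Sm.comp [FiniteDimensional ℂ F] [FiniteDimensional ℂ F'] {q : F → F'} {f : F' → ℂ} {x : F}
    (hf : Sm f (q x)) (hq : ∀ᶠ x' in 𝓝 x, DifferentiableAt ℂ q x') : Sm (fun y => f (q y)) x := by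
  filter_upwards [hq.self_of_nhds.continuousAt.eventually hf,
    eventually_eventually_nhds.2 hq] with x' h1 h2
  exact h1.comp x' ((contDiffAt_of_eventually_differentiableAt h2).restrict_scalars ℝ)

theorem dz_comm {f : F → ℂ} {x : F} (hf : Sm f x) (v w : F) :
    dz v (dz w f) x = dz w (dz v f) x := by
  have h2 : DifferentiableAt ℝ (fderiv ℝ f) x :=
    (hf.self.fderiv_right (m := ∞) (by simp)).differentiableAt (by simp)
  have key : ∀ a b : F, fderiv ℝ (dz b f) x a
      = (1 / 2 : ℂ) * (fderiv ℝ (fderiv ℝ f) x a b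
        - Complex.I * fderiv ℝ (fderiv ℝ f) x a (Complex.I • b)) := by
    intro a b
    have h3 : ∀ c : F, HasFDerivAt (fun y => fderiv ℝ f y c)
        ((fderiv ℝ (fderiv ℝ f) x).flip c) x := fun c => by
      simpa using h2.hasFDerivAt.clm_apply (hasFDerivAt_const c x)
    have h4 : HasFDerivAt (dz b f) ((1 / 2 : ℂ) • ((fderiv ℝ (fderiv ℝ f) x).flip b
        - Complex.I • (fderiv ℝ (fderiv ℝ f) x).flip (Complex.I • b))) x :=
      ((h3 b).sub ((h3 (Complex.I • b)).const_mul Complex.I)).const_mul (1 / 2 : ℂ)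
    rw [h4.fderiv]
    simp
  have hsymm : ∀ a b : F, fderiv ℝ (fderiv ℝ f) x a b = fderiv ℝ (fderiv ℝ f) x b a :=
    fun a b => (hf.self.isSymmSndFDerivAt
      (by simpa using (WithTop.coe_le_coe.2 le_top : ((2 : ℕ∞) : WithTop ℕ∞) ≤ ∞))).eq a b
  rw [dz, dz, key, key, key, key, hsymm w v, hsymm (Complex.I • w) v,
    hsymm w (Complex.I • v), hsymm (Complex.I • w) (Complex.I • v)]
  ring

theorem dz_add_dir (v w : F) (f : F → ℂ) (x : F) : dz (v + w) f x = dz v f x + dz w f x := by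
  simp only [dz, smul_add, map_add]
  ring

/-- `fderiv ℝ f x` is only real linear, but its (1,0) part is complex linear in the direction. So
`a(x) ∂_v` is the derivative in the direction `a(x) v`, and a section of the tangent sheaf can be
treated as a vector field. -/
theorem dz_smul_dir (c : ℂ) (v : F) (f : F → ℂ) (x : F) : dz (c • v) f x = c * dz v f x := by
  have h1 : c • v = c.re • v + c.im • (Complex.I • v) := by
    conv_lhs => rw [← Complex.re_add_im c]
    rw [add_smul, mul_smul, Complex.coe_smul, Complex.coe_smul]
  have h2 : Complex.I • c • v = c.re • (Complex.I • v) - c.im • v := by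
    rw [h1, smul_add, smul_comm, smul_comm _ c.im, smul_smul, Complex.I_mul_I, neg_one_smul,
      smul_neg, sub_eq_add_neg]
  have hL : ∀ (r : ℝ) (u : F), fderiv ℝ f x (r • u) = r * fderiv ℝ f x u := fun r u => by
    rw [map_smul, Complex.real_smul]
  rw [dz, h2, h1, map_add, map_sub, hL, hL, hL, hL, dz]
  nth_rewrite 5 [← Complex.re_add_im c]
  linear_combination (1 / 2 : ℂ) * c.im * fderiv ℝ f x (Complex.I • v) * Complex.I_mul_I

theorem dz_sum_dir {ι : Type*} (s : Finset ι) (v : ι → F) (f : F → ℂ) (x : F) :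
    dz (∑ i ∈ s, v i) f x = ∑ i ∈ s, dz (v i) f x := by
  classical
  induction s using Finset.induction_on with
  | empty => simp [dz]
  | insert a s ha ih => rw [Finset.sum_insert ha, Finset.sum_insert ha, dz_add_dir, ih]

/-- A germ of a smooth function is the germ of a globally defined smooth function. -/
theorem Sm.exists_contDiff [FiniteDimensional ℂ F] {f : F → ℂ} {x : F} (hf : Sm f x) :
    ∃ g : F → ℂ, ContDiff ℝ ∞ g ∧ g =ᶠ[𝓝 x] f := by
  obtain ⟨r, hr, hball⟩ := Metric.eventually_nhds_iff_ball.1 hf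
  let φ : ContDiffBump x := ⟨r / 4, r / 2, by positivity, by linarith⟩
  refine ⟨fun y => (φ y : ℂ) * f y, ?_, ?_⟩
  · rw [contDiff_iff_contDiffAt]
    intro y
    by_cases hy : y ∈ Metric.ball x r
    · exact (Complex.ofRealCLM.contDiff.contDiffAt.comp y φ.contDiff.contDiffAt).mul (hball y hy)
    · have hsupp : y ∉ tsupport φ := by
        rw [φ.tsupport_eq]
        intro h
        rw [Metric.mem_closedBall] at h
        rw [Metric.mem_ball] at hy
        change dist y x ≤ r / 2 at h
        linarith
      have : (fun y => (φ y : ℂ) * f y) =ᶠ[𝓝 y] fun _ => 0 := by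
        filter_upwards [(notMem_tsupport_iff_eventuallyEq.1 hsupp)] with y' hy'
        simp [hy']
      exact contDiffAt_const.congr_of_eventuallyEq this
  · filter_upwards [φ.eventuallyEq_one] with y hy
    simp [hy]

end Wirtinger

/-! ### Differential operators in coordinates -/

section DiffOps

variable {F F' : Type*} [NormedAddCommGroup F] [NormedSpace ℂ F]
  [NormedAddCommGroup F'] [NormedSpace ℂ F']

/-- Near `x₀`, the operator `B` is of the form `f ↦ ∑ aₖ · (∂^{wₖ} f) ∘ q` with holomorphic
coefficients `aₖ`. -/
def IsDOAlong (q : F → F') (x₀ : F) (B : (F' → ℂ) → F → ℂ) : Prop :=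
  ∃ (ι : Type) (_ : Fintype ι) (a : ι → F → ℂ) (w : ι → List F'), (∀ k, Hol (a k) x₀) ∧
    ∀ᶠ x in 𝓝 x₀, ∀ f, Sm f (q x) → B f x = ∑ k, a k x * dzs (w k) f (q x)

/-- Near `x₀`, the operator `A` is a holomorphic differential operator. -/
def IsDO (x₀ : F) (A : (F → ℂ) → F → ℂ) : Prop :=
  ∃ (ι : Type) (_ : Fintype ι) (a : ι → F → ℂ) (w : ι → List F), (∀ k, Hol (a k) x₀) ∧
    ∀ᶠ x in 𝓝 x₀, ∀ f, Sm f x → A f x = ∑ k, a k x * dzs (w k) f x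

theorem IsDO.along_id {x₀ : F} {A : (F → ℂ) → F → ℂ} (h : IsDO x₀ A) : IsDOAlong id x₀ A := h

theorem IsDOAlong.add {q : F → F'} {x₀ : F} {A B : (F' → ℂ) → F → ℂ} (hA : IsDOAlong q x₀ A)
    (hB : IsDOAlong q x₀ B) : IsDOAlong q x₀ (fun f x => A f x + B f x) := by
  obtain ⟨ι, _, a, w, ha, hA⟩ := hA
  obtain ⟨κ, _, b, u, hb, hB⟩ := hB
  refine ⟨ι ⊕ κ, inferInstance, Sum.elim a b, Sum.elim w u, ?_, ?_⟩
  · rintro (k | k)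
    exacts [ha k, hb k]
  · filter_upwards [hA, hB] with x h1 h2 f hf
    simp [h1 f hf, h2 f hf]

theorem IsDOAlong.mul_left {q : F → F'} {x₀ : F} {B : (F' → ℂ) → F → ℂ} (hB : IsDOAlong q x₀ B)
    {c : F → ℂ} (hc : Hol c x₀) : IsDOAlong q x₀ (fun f x => c x * B f x) := by
  obtain ⟨κ, _, b, u, hb, hB⟩ := hB
  refine ⟨κ, inferInstance, fun k x => c x * b k x, u, fun k => hc.mul (hb k), ?_⟩
  filter_upwards [hB] with x h2 f hf
  rw [h2 f hf, Finset.mul_sum]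
  exact Finset.sum_congr rfl fun k _ => (mul_assoc _ _ _).symm

theorem IsDOAlong.sub {q : F → F'} {x₀ : F} {A B : (F' → ℂ) → F → ℂ} (hA : IsDOAlong q x₀ A)
    (hB : IsDOAlong q x₀ B) : IsDOAlong q x₀ (fun f x => A f x - B f x) := by
  have := hA.add (hB.mul_left (hol_const (-1) x₀))
  simpa [sub_eq_add_neg] using this

theorem IsDO.add {x₀ : F} {A B : (F → ℂ) → F → ℂ} (hA : IsDO x₀ A) (hB : IsDO x₀ B) :
    IsDO x₀ (fun f x => A f x + B f x) := hA.along_id.add hB.along_id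

theorem IsDO.mul_left {x₀ : F} {B : (F → ℂ) → F → ℂ} (hB : IsDO x₀ B) {c : F → ℂ}
    (hc : Hol c x₀) : IsDO x₀ (fun f x => c x * B f x) := hB.along_id.mul_left hc

theorem isDO_zero (x₀ : F) : IsDO x₀ (fun _ _ => 0) :=
  ⟨Empty, inferInstance, fun k => k.elim, fun k => k.elim, fun k => k.elim,
    Eventually.of_forall fun x f _ => by simp⟩

theorem IsDO.sum {ι : Type*} {s : Finset ι} {x₀ : F} {A : ι → (F → ℂ) → F → ℂ}
    (hA : ∀ i ∈ s, IsDO x₀ (A i)) : IsDO x₀ (fun f x => ∑ i ∈ s, A i f x) := by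
  classical
  induction s using Finset.induction_on with
  | empty => simpa using isDO_zero x₀
  | insert a s ha ih =>
    simp only [Finset.sum_insert ha]
    exact (hA a (by simp)).add (ih fun i hi => hA i (by simp [hi]))

theorem isDO_id (x₀ : F) : IsDO x₀ (fun f => f) :=
  ⟨Unit, inferInstance, fun _ _ => 1, fun _ => [], fun _ => hol_const 1 x₀,
    Eventually.of_forall fun x f _ => by simp⟩

theorem isDO_dzs (x₀ : F) (u : List F) : IsDO x₀ (dzs u) :=
  ⟨Unit, inferInstance, fun _ _ => 1, fun _ => u, fun _ => hol_const 1 x₀,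
    Eventually.of_forall fun x f _ => by simp⟩

theorem IsDO.congr {x₀ : F} {A B : (F → ℂ) → F → ℂ} (hA : IsDO x₀ A)
    (h : ∀ᶠ x in 𝓝 x₀, ∀ f, Sm f x → A f x = B f x) : IsDO x₀ B := by
  obtain ⟨ι, _, a, w, ha, hA⟩ := hA
  refine ⟨ι, inferInstance, a, w, ha, ?_⟩
  filter_upwards [hA, h] with x h1 h2 f hf
  rw [← h2 f hf, h1 f hf]

/-- A differential operator is local and preserves smoothness at all points near `x₀`. -/
theorem IsDO.eventually_local [FiniteDimensional ℂ F] {x₀ : F} {A : (F → ℂ) → F → ℂ}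
    (hA : IsDO x₀ A) :
    ∀ᶠ x in 𝓝 x₀, ∀ f, Sm f x → Sm (A f) x ∧ ∀ g, f =ᶠ[𝓝 x] g → A f =ᶠ[𝓝 x] A g := by
  obtain ⟨ι, _, a, w, ha, hA⟩ := hA
  filter_upwards [eventually_eventually_nhds.2 hA,
    eventually_all.2 fun k => (ha k).eventually] with x h1 h2 f hf
  have key : ∀ f, Sm f x → A f =ᶠ[𝓝 x] fun y => ∑ k, a k y * dzs (w k) f y := by
    intro f hf
    filter_upwards [h1, hf.eventually] with y hy hfy using hy f hfy
  refine ⟨(Sm.sum fun k _ => (h2 k).sm.mul (hf.dzs (w k))).congr (key f hf).symm, ?_⟩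
  intro g hg
  refine (key f hf).trans (EventuallyEq.trans ?_ (key g (hf.congr hg)).symm)
  have h3 : ∀ᶠ y in 𝓝 x, ∀ k, dzs (w k) f y = dzs (w k) g y :=
    eventually_all.2 fun k => dzs_congr hg (w k)
  filter_upwards [h3] with y hy
  simp [hy]

theorem IsDO.eventually_map_zero {x₀ : F} {A : (F → ℂ) → F → ℂ} (hA : IsDO x₀ A) :
    ∀ᶠ x in 𝓝 x₀, A (fun _ => 0) x = 0 := by
  obtain ⟨ι, _, a, w, ha, hA⟩ := hA
  filter_upwards [hA] with x h
  rw [h _ (sm_const 0 x)]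
  simp [dzs_zero]

/-- Leibniz rule: each term contributes the coefficient `∂_v aₖ`, again holomorphic, with the same
word, and `aₖ` with the word extended by `v`. -/
theorem IsDO.dz_comp [FiniteDimensional ℂ F] {x₀ : F} {A : (F → ℂ) → F → ℂ} (hA : IsDO x₀ A)
    (v : F) : IsDO x₀ (fun f => dz v (A f)) := by
  obtain ⟨ι, _, a, w, ha, hA⟩ := hA
  have h0 : IsDO x₀ (fun f x => ∑ k, (dz v (a k) x * dzs (w k) f x
      + a k x * dzs (v :: w k) f x)) :=
    IsDO.sum fun k _ => ((isDO_dzs x₀ (w k)).mul_left ((ha k).dz v)).add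
      ((isDO_dzs x₀ (v :: w k)).mul_left (ha k))
  refine h0.congr ?_
  filter_upwards [eventually_eventually_nhds.2 hA,
    eventually_all.2 fun k => (ha k).eventually] with x h1 h2 f hf
  have key : A f =ᶠ[𝓝 x] fun y => ∑ k, a k y * dzs (w k) f y := by
    filter_upwards [h1, hf.eventually] with y hy hfy using hy f hfy
  rw [(dz_congr key v).self_of_nhds, dz_sum fun k _ =>
    ((h2 k).sm.mul (hf.dzs (w k))).differentiableAt]
  exact Finset.sum_congr rfl fun k _ =>
    (dz_mul (h2 k).sm.differentiableAt (hf.dzs (w k)).differentiableAt v).symm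

theorem IsDO.comp [FiniteDimensional ℂ F] {x₀ : F} {A B : (F → ℂ) → F → ℂ} (hA : IsDO x₀ A)
    (hB : IsDO x₀ B) : IsDO x₀ (fun f => A (B f)) := by
  have hw : ∀ w : List F, IsDO x₀ (fun f => dzs w (B f)) := by
    intro w
    induction w with
    | nil => exact hB
    | cons v w ih => exact ih.dz_comp v
  obtain ⟨ι, _, a, w, ha, hA⟩ := hA
  refine (IsDO.sum (s := Finset.univ) fun k _ => (hw (w k)).mul_left (ha k)).congr ?_
  filter_upwards [hA, hB.eventually_local] with x h1 h2 f hf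
  exact (h1 _ (h2 f hf).1).symm

/-! #### An operator is determined by its germ -/

/-- The space of `C^∞` functions on `F`. -/
def smoothFun (F : Type*) [NormedAddCommGroup F] [NormedSpace ℂ F] : Submodule ℂ (F → ℂ) where
  carrier := {f | ContDiff ℝ ∞ f}
  add_mem' := fun {f g} (hf : ContDiff ℝ ∞ f) (hg : ContDiff ℝ ∞ g) => hf.add hg
  zero_mem' := (contDiff_const : ContDiff ℝ ∞ fun _ : F => (0 : ℂ))
  smul_mem' := fun c f (hf : ContDiff ℝ ∞ f) =>
    ((contDiff_const.mul hf : ContDiff ℝ ∞ fun x => c * f x))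

/-- The operator `∂_v` on smooth functions. -/
def dzEnd (v : F) : Module.End ℂ (smoothFun F) where
  toFun f := ⟨dz v f.1, contDiff_iff_contDiffAt.2 fun x => ((ContDiff.sm f.2 x).dz v).self⟩
  map_add' f g := Subtype.ext <| funext fun x =>
    dz_add (ContDiff.sm f.2 x).differentiableAt (ContDiff.sm g.2 x).differentiableAt v
  map_smul' c f := Subtype.ext <| funext fun x => by
    have := dz_mul (differentiableAt_const c) (ContDiff.sm f.2 x).differentiableAt v
    rw [dz_const, zero_mul, zero_add] at this
    exact this

theorem dzEnd_prod_apply (w : List F) (f : smoothFun F) :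
    (((w.map dzEnd).prod f : smoothFun F) : F → ℂ) = dzs w f := by
  induction w with
  | nil => rfl
  | cons v w ih =>
    rw [List.map_cons, List.prod_cons, Module.End.mul_apply, dzs_cons, ← ih]
    rfl

/-- The linear form `∑ᵢ vᵢ Xᵢ` with the coordinates of `v` as coefficients. -/
def linPoly {n : ℕ} (b : Module.Basis (Fin n) ℂ F) (v : F) : MvPolynomial (Fin n) ℂ :=
  ∑ i, MvPolynomial.C (b.repr v i) * MvPolynomial.X i

/-- `MvPolynomial.aeval` needs a commutative target, so the map is built into the subalgebra
generated by the commuting elements. -/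
theorem exists_algHom_of_commute {A : Type*} [Ring A] [Algebra ℂ A] {n : ℕ} (x : Fin n → A)
    (h : ∀ i j, x i * x j = x j * x i) :
    ∃ Φ : MvPolynomial (Fin n) ℂ →ₐ[ℂ] A, ∀ i, Φ (MvPolynomial.X i) = x i := by
  have hmul := Algebra.isMulCommutative_adjoin ℂ (s := Set.range x)
    (by rintro _ ⟨i, rfl⟩ _ ⟨j, rfl⟩; exact h i j)
  let R := Algebra.adjoin ℂ (Set.range x)
  let _ : CommRing R := { R.toRing with mul_comm := hmul.is_comm.comm }
  let φ : MvPolynomial (Fin n) ℂ →ₐ[ℂ] R :=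
    MvPolynomial.aeval fun i => (⟨x i, Algebra.subset_adjoin ⟨i, rfl⟩⟩ : R)
  exact ⟨R.val.comp φ, fun i => by simp [φ, R]⟩

/-- The polynomial ring acts on smooth functions by constant coefficient operators. -/
theorem exists_algHom_dzEnd {n : ℕ} (b : Module.Basis (Fin n) ℂ F) :
    ∃ Φ : MvPolynomial (Fin n) ℂ →ₐ[ℂ] Module.End ℂ (smoothFun F),
      ∀ v, Φ (linPoly b v) = dzEnd v := by
  obtain ⟨Φ, hΦ⟩ := exists_algHom_of_commute (fun i => dzEnd (b i)) fun i j =>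
    LinearMap.ext fun f => Subtype.ext <| funext fun x => dz_comm (ContDiff.sm f.2 x) _ _
  refine ⟨Φ, fun v => ?_⟩
  have h1 : Φ (linPoly b v) = ∑ i, (b.repr v i) • dzEnd (b i) := by
    simp only [linPoly, map_sum, map_mul, hΦ]
    refine Finset.sum_congr rfl fun i _ => ?_
    rw [← MvPolynomial.algebraMap_eq, AlgHom.commutes, Algebra.smul_def]
  rw [h1]
  refine LinearMap.ext fun f => Subtype.ext <| funext fun x => ?_
  have h3 : dz v f.1 x = ∑ i, b.repr v i * dz (b i) f.1 x := by
    conv_lhs => rw [← b.sum_repr v]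
    rw [dz_sum_dir]
    exact Finset.sum_congr rfl fun i _ => dz_smul_dir _ _ _ _
  change _ = dz v f.1 x
  rw [h3]
  simp only [LinearMap.sum_apply, LinearMap.smul_apply, Submodule.coe_sum, Submodule.coe_smul,
    Finset.sum_apply, Pi.smul_apply, smul_eq_mul]
  rfl

/-- The function `exp (∑ᵢ lᵢ xᵢ)`. -/
def expFun {n : ℕ} (b : Module.Basis (Fin n) ℂ F) (l : Fin n → ℂ) : F → ℂ :=
  fun x => Complex.exp (∑ i, l i * b.repr x i)

theorem hasFDerivAt_expFun [FiniteDimensional ℂ F] {n : ℕ} (b : Module.Basis (Fin n) ℂ F)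
    (l : Fin n → ℂ) (x : F) : HasFDerivAt (expFun b l)
      (expFun b l x • ∑ i, l i • LinearMap.toContinuousLinearMap (b.coord i)) x := by
  refine HasFDerivAt.cexp ?_
  have h := (∑ i, l i • LinearMap.toContinuousLinearMap (b.coord i)).hasFDerivAt (x := x)
  refine h.congr_of_eventuallyEq (Eventually.of_forall fun y => ?_)
  simp [sum_apply]

/-- Exponentials are joint eigenfunctions of the constant coefficient operators; the eigenvalue is
the symbol evaluated at `l`. -/
theorem dzs_expFun [FiniteDimensional ℂ F] {n : ℕ} (b : Module.Basis (Fin n) ℂ F)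
    (l : Fin n → ℂ) (w : List F) :
    dzs w (expFun b l)
      = fun x => MvPolynomial.eval l (w.map (linPoly b)).prod * expFun b l x := by
  induction w with
  | nil => simp
  | cons v w ih =>
    rw [dzs_cons, ih]
    funext x
    rw [dz_of_hasFDerivAt ((hasFDerivAt_expFun b l x).const_mul _), List.map_cons, List.prod_cons,
      map_mul]
    simp only [linPoly, map_sum, map_mul, MvPolynomial.eval_C, MvPolynomial.eval_X,
      smul_apply, sum_apply, smul_eq_mul, LinearMap.coe_toContinuousLinearMap',
      Module.Basis.coord_apply]
    rw [Finset.sum_congr rfl fun i _ => mul_comm (l i) _]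
    ring

theorem contDiff_expFun [FiniteDimensional ℂ F] {n : ℕ} (b : Module.Basis (Fin n) ℂ F)
    (l : Fin n → ℂ) : ContDiff ℝ ∞ (expFun b l) :=
  contDiff_iff_contDiffAt.2 fun _ =>
    (Hol.sm (Eventually.of_forall fun y => (hasFDerivAt_expFun b l y).differentiableAt)).self

/-- If a differential operator kills the germ at `x₀` of every smooth function, then it vanishes
near `x₀`, uniformly. -/
theorem IsDOAlong.eventually_eq_zero [FiniteDimensional ℂ F'] {q : F → F'} {x₀ : F}
    {B : (F' → ℂ) → F → ℂ} (hB : IsDOAlong q x₀ B)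
    (h : ∀ f, ContDiff ℝ ∞ f → ∀ᶠ x in 𝓝 x₀, B f x = 0) :
    ∀ᶠ x in 𝓝 x₀, ∀ f, Sm f (q x) → B f x = 0 := by
  obtain ⟨ι, _, a, w, -, hB⟩ := hB
  let b := Module.finBasis ℂ F'
  obtain ⟨Φ, hΦ⟩ := exists_algHom_dzEnd b
  -- At a fixed `x` the operator has constant coefficients, and `p x` is its symbol.
  let W : ι → MvPolynomial (Fin (Module.finrank ℂ F')) ℂ := fun k => ((w k).map (linPoly b)).prod
  let p : F → MvPolynomial (Fin (Module.finrank ℂ F')) ℂ := fun x =>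
    ∑ k, MvPolynomial.C (a k x) * W k
  -- `N` bounds the degree of `p x` in each variable, for all `x` at once. A polynomial with this
  -- bound is zero if it vanishes on the grid `{0, …, N}ⁿ`, so finitely many exponentials, hence one
  -- neighbourhood of `x₀`, suffice.
  let N : ℕ := Finset.univ.sup fun i => Finset.univ.sup fun k => MvPolynomial.degreeOf i (W k)
  let S : Finset ℂ := (Finset.range (N + 1)).map ⟨fun m : ℕ => (m : ℂ), Nat.cast_injective⟩
  have hgrid : ∀ᶠ x in 𝓝 x₀, ∀ l ∈ Fintype.piFinset fun _ : Fin (Module.finrank ℂ F') => S,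
      MvPolynomial.eval l (p x) = 0 := by
    refine (Finset.eventually_all _).2 fun l _ => ?_
    filter_upwards [hB, h _ (contDiff_expFun b l)] with x h1 h2
    rw [h1 _ (ContDiff.sm (contDiff_expFun b l) _)] at h2
    simp only [dzs_expFun, ← mul_assoc, ← Finset.sum_mul] at h2
    have h3 := (mul_eq_zero.1 h2).resolve_right (Complex.exp_ne_zero _)
    simpa [p, W] using h3
  have hp : ∀ᶠ x in 𝓝 x₀, p x = 0 := by
    filter_upwards [hgrid] with x hx
    refine MvPolynomial.eq_zero_of_eval_zero_at_prod_finset (p x) (fun _ => S) (fun i => ?_)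
      fun l hl => hx l (Fintype.mem_piFinset.2 hl)
    have h1 : MvPolynomial.degreeOf i (p x) ≤ N := by
      refine (MvPolynomial.degreeOf_sum_le _ _ _).trans (Finset.sup_le fun k _ => ?_)
      refine (MvPolynomial.degreeOf_C_mul_le _ _ _).trans ?_
      exact (Finset.le_sup (f := fun k => MvPolynomial.degreeOf i (W k)) (Finset.mem_univ k)).trans
        (Finset.le_sup (f := fun i => Finset.univ.sup fun k => MvPolynomial.degreeOf i (W k))
          (Finset.mem_univ i))
    simpa [S] using Nat.lt_succ_of_le h1
  filter_upwards [hB, hp] with x h1 h2 f hf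
  rw [h1 f hf]
  obtain ⟨g, hg, hgf⟩ := hf.exists_contDiff
  -- Since the `∂_v` commute, the operator acts through its symbol. The algebra acts on global
  -- smooth functions, so `f` is replaced by such a function with the same germ at `q x`.
  have h3 : ∀ k, dzs (w k) f (q x) = ((Φ (W k) ⟨g, hg⟩ : smoothFun F') : F' → ℂ) (q x) := by
    intro k
    have h4 : Φ (W k) = ((w k).map dzEnd).prod := by
      simp only [W, map_list_prod, List.map_map]
      congr 1
      exact List.map_congr_left fun v _ => hΦ v
    rw [h4, dzEnd_prod_apply, (dzs_congr hgf (w k)).self_of_nhds]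
  have h5 : ((Φ (p x) ⟨g, hg⟩ : smoothFun F') : F' → ℂ) (q x)
      = ∑ k, a k x * ((Φ (W k) ⟨g, hg⟩ : smoothFun F') : F' → ℂ) (q x) := by
    simp only [p, map_sum, map_mul, LinearMap.sum_apply, Submodule.coe_sum, Finset.sum_apply]
    refine Finset.sum_congr rfl fun k _ => ?_
    rw [← MvPolynomial.algebraMap_eq, AlgHom.commutes, ← Algebra.smul_def]
    rfl
  simp only [h3]
  rw [← h5, h2]
  simp

theorem IsDOAlong.eventually_eq [FiniteDimensional ℂ F'] {q : F → F'} {x₀ : F}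
    {A B : (F' → ℂ) → F → ℂ} (hA : IsDOAlong q x₀ A) (hB : IsDOAlong q x₀ B)
    (h : ∀ f, ContDiff ℝ ∞ f → ∀ᶠ x in 𝓝 x₀, A f x = B f x) :
    ∀ᶠ x in 𝓝 x₀, ∀ f, Sm f (q x) → A f x = B f x := by
  filter_upwards [(hA.sub hB).eventually_eq_zero fun f hf =>
    (h f hf).mono fun x hx => sub_eq_zero.2 hx] with x hx f hf using sub_eq_zero.1 (hx f hf)

/-- Together with `IsDO.along_pullback` this puts both sides of a lifting identity `T ∘ p^* = p^* ∘
S` into the form `IsDOAlong q`, with `q` the linear model of `p`, so that `IsDOAlong.eventually_eq`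
makes the identity uniform. -/
theorem IsDO.along_comp [FiniteDimensional ℂ F] [FiniteDimensional ℂ F'] {x₀ : F}
    {A : (F → ℂ) → F → ℂ} (hA : IsDO x₀ A) (q : F →L[ℂ] F') :
    IsDOAlong q x₀ (fun f => A (fun x => f (q x))) := by
  obtain ⟨ι, _, a, w, ha, hA⟩ := hA
  refine ⟨ι, inferInstance, a, fun k => (w k).map q, ha, ?_⟩
  filter_upwards [hA] with x h1 f hf
  have hq : ∀ y : F, ∀ᶠ x' in 𝓝 y, DifferentiableAt ℂ q x' := fun y =>
    Eventually.of_forall fun _ => q.differentiableAt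
  rw [h1 _ (hf.comp (hq x))]
  have key : ∀ u : List F, ∀ᶠ y in 𝓝 x, dzs u (fun x => f (q x)) y = dzs (u.map q) f (q y) := by
    intro u
    induction u with
    | nil => exact Eventually.of_forall fun _ => rfl
    | cons v u ih =>
      have h2 : dzs u (fun x => f (q x)) =ᶠ[𝓝 x] fun y => dzs (u.map q) f (q y) := ih
      filter_upwards [dz_congr h2 v, q.continuous.continuousAt.eventually hf.eventually]
        with y hy hfy
      rw [dzs_cons, hy, IntegralTransform.dz_comp q.differentiableAt (hfy.dzs _).differentiableAt]
      simp
  exact Finset.sum_congr rfl fun k _ => by rw [(key (w k)).self_of_nhds]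

theorem IsDO.along_pullback {q : F →L[ℂ] F'} {x₀ : F} {A : (F' → ℂ) → F' → ℂ}
    (hA : IsDO (q x₀) A) : IsDOAlong q x₀ (fun f x => A f (q x)) := by
  obtain ⟨ι, _, a, w, ha, hA⟩ := hA
  refine ⟨ι, inferInstance, fun k x => a k (q x), w, fun k => ?_, ?_⟩
  · filter_upwards [q.continuous.continuousAt.eventually (ha k)] with x hx
    exact hx.comp x q.differentiableAt
  · filter_upwards [q.continuous.continuousAt.eventually hA] with x hx f hf using hx f hf

end DiffOps

/-! ### Integration by parts -/

section Transpose

variable {F : Type*} [NormedAddCommGroup F] [NormedSpace ℂ F]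

/-- Smooth functions `f`, `g` on an open set `O` such that `f g` is supported in the compact
subset `K` of `O`. -/
structure Adm (O K : Set F) (f g : F → ℂ) : Prop where
  isOpen : IsOpen O
  isCompact : IsCompact K
  subset : K ⊆ O
  left : ∀ x ∈ O, Sm f x
  right : ∀ x ∈ O, Sm g x
  supp : ∀ x ∈ O, x ∉ K → f =ᶠ[𝓝 x] (fun _ => 0) ∨ g =ᶠ[𝓝 x] (fun _ => 0)

theorem Sm.continuousOn {f : F → ℂ} {K : Set F} (h : ∀ x ∈ K, Sm f x) : ContinuousOn f K :=
  fun x hx => (h x hx).self.continuousAt.continuousWithinAt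

theorem continuousOn_conj {c : F → ℂ} {K : Set F} (h : ∀ x ∈ K, DifferentiableAt ℂ c x) :
    ContinuousOn (fun x => starRingEnd ℂ (c x)) K :=
  fun x hx => (Complex.continuous_conj.continuousAt.comp (h x hx).continuousAt).continuousWithinAt

/-- A local operator keeps a zero germ zero, so the same `K` still works. This is why `Adm.supp`
asks for the vanishing of one factor and not of the product, a condition which differentiating a
single factor could destroy. -/
theorem Adm.map_left [FiniteDimensional ℂ F] {x₀ : F} {A : (F → ℂ) → F → ℂ} (hA : IsDO x₀ A) :
    ∀ᶠ O in (𝓝 x₀).smallSets, ∀ K f g, Adm O K f g → Adm O K (A f) g := by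
  filter_upwards [eventually_smallSets_forall.2 (hA.eventually_local.and
    (eventually_eventually_nhds.2 hA.eventually_map_zero))] with O hO K f g h
  refine { h with
    left := fun x hx => ((hO x hx).1 f (h.left x hx)).1
    supp := fun x hx hxK => (h.supp x hx hxK).imp_left fun h1 => ?_ }
  exact (((hO x hx).1 f (h.left x hx)).2 _ h1).trans (hO x hx).2

theorem Adm.symm {O K : Set F} {f g : F → ℂ} (h : Adm O K f g) : Adm O K g f :=
  { h with left := h.right, right := h.left, supp := fun x hx hxK => (h.supp x hx hxK).symm }

theorem Adm.map_right [FiniteDimensional ℂ F] {x₀ : F} {A : (F → ℂ) → F → ℂ} (hA : IsDO x₀ A) :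
    ∀ᶠ O in (𝓝 x₀).smallSets, ∀ K f g, Adm O K f g → Adm O K f (A g) := by
  filter_upwards [Adm.map_left hA] with O hO K f g h using (hO K g f h.symm).symm

variable [FiniteDimensional ℂ F] [MeasurableSpace F] [BorelSpace F] (μ : Measure F)
  [μ.IsAddHaarMeasure]

theorem integral_dz_eq_zero {φ : F → ℂ} (hφ : ContDiff ℝ ∞ φ) (hs : HasCompactSupport φ) (v : F) :
    ∫ x, dz v φ x ∂μ = 0 := by
  have hint : ∀ u : F, Integrable (fun x => fderiv ℝ φ x u) μ := fun u =>
    ((hφ.continuous_fderiv (by simp)).clm_apply continuous_const).integrable_of_hasCompactSupport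
      ((hs.fderiv (𝕜 := ℝ)).mono fun x hx => by
        contrapose! hx
        simp only [Function.mem_support, not_not] at hx ⊢
        simp [hx])
  have hzero : ∀ u : F, ∫ x, fderiv ℝ φ x u ∂μ = 0 := by
    intro u
    have := integral_mul_fderiv_eq_neg_fderiv_mul_of_integrable (μ := μ) (f := fun _ => (1 : ℂ))
      (g := φ) (v := u) (by simp) (by simpa using hint u)
      (by simpa using hφ.continuous.integrable_of_hasCompactSupport hs)
      (fun x _ => differentiableAt_const _) (fun x _ => hφ.differentiable (by simp) x)
    simpa using this
  simp only [dz]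
  rw [integral_const_mul, integral_sub (hint v) ((hint _).const_mul _), integral_const_mul,
    hzero, hzero]
  simp

/-- The integral of `∂_v (c̄ f g)` is zero, and by the product rule this derivative is `c̄ (∂_v f ·
g + f · ∂_v g)`, because `∂_v c̄ = 0`. -/
theorem Adm.integral_dz {O K : Set F} {f g c : F → ℂ} (h : Adm O K f g)
    (hc : ∀ x ∈ O, DifferentiableAt ℂ c x) (v : F) :
    ∫ x in K, starRingEnd ℂ (c x) * (dz v f x * g x) ∂μ
      = - ∫ x in K, starRingEnd ℂ (c x) * (f x * dz v g x) ∂μ := by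
  let Ψ : F → ℂ := fun x => starRingEnd ℂ (c x) * (f x * g x)
  have hcS : ∀ x ∈ O, Sm (fun y => starRingEnd ℂ (c y)) x := fun x hx =>
    (Hol.sm (Filter.eventually_of_mem (h.isOpen.mem_nhds hx) hc)).conj
  have hΨ : ∀ x ∈ O, Sm Ψ x := fun x hx => (hcS x hx).mul ((h.left x hx).mul (h.right x hx))
  have hΨ0 : ∀ x ∈ O, x ∉ K → Ψ =ᶠ[𝓝 x] fun _ => 0 := by
    intro x hx hxK
    rcases h.supp x hx hxK with h1 | h1 <;> filter_upwards [h1] with y hy <;> simp [Ψ, hy]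
  -- The extension of `Ψ` by zero is smooth everywhere: on `O` it coincides with `Ψ`, and it is zero
  -- on the open complement of `K`.
  have hφΨ : ∀ x ∈ O, K.indicator Ψ =ᶠ[𝓝 x] Ψ := by
    intro x hx
    filter_upwards [h.isOpen.mem_nhds hx] with y hy
    by_cases hyK : y ∈ K
    · simp [hyK]
    · simp [hyK, (hΨ0 y hy hyK).self_of_nhds]
  have hφ0 : ∀ x, x ∉ K → K.indicator Ψ =ᶠ[𝓝 x] fun _ => 0 := by
    intro x hx
    filter_upwards [h.isCompact.isClosed.isOpen_compl.mem_nhds hx] with y hy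
    exact Set.indicator_of_notMem hy _
  have hφ : ContDiff ℝ ∞ (K.indicator Ψ) := by
    rw [contDiff_iff_contDiffAt]
    intro x
    by_cases hx : x ∈ K
    · exact ((hΨ x (h.subset hx)).congr (hφΨ x (h.subset hx)).symm).self
    · exact contDiffAt_const.congr_of_eventuallyEq (hφ0 x hx)
  have hφs : HasCompactSupport (K.indicator Ψ) :=
    HasCompactSupport.intro h.isCompact fun x hx => Set.indicator_of_notMem hx _
  have hdz : dz v (K.indicator Ψ) = K.indicator fun x => starRingEnd ℂ (c x) * (dz v f x * g x)
      + starRingEnd ℂ (c x) * (f x * dz v g x) := by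
    funext x
    by_cases hx : x ∈ K
    · have hxO := h.subset hx
      rw [Set.indicator_of_mem hx, (dz_congr (hφΨ x hxO) v).self_of_nhds,
        dz_mul (hcS x hxO).differentiableAt
          ((h.left x hxO).mul (h.right x hxO)).differentiableAt, dz_conj_hol (hc x hxO),
        dz_mul (h.left x hxO).differentiableAt (h.right x hxO).differentiableAt]
      ring
    · rw [Set.indicator_of_notMem hx, (dz_congr (hφ0 x hx) v).self_of_nhds, dz_const]
  have h0 := integral_dz_eq_zero μ hφ hφs v
  have hcK := continuousOn_conj fun x hx => hc x (h.subset hx)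
  rw [hdz, integral_indicator h.isCompact.measurableSet, integral_add] at h0
  · exact eq_neg_of_add_eq_zero_left h0
  · exact (hcK.mul ((Sm.continuousOn fun x hx => (h.left x (h.subset hx)).dz v).mul
      (Sm.continuousOn fun x hx => h.right x (h.subset hx)))).integrableOn_compact h.isCompact
  · exact (hcK.mul ((Sm.continuousOn fun x hx => h.left x (h.subset hx)).mul
      (Sm.continuousOn fun x hx => (h.right x (h.subset hx)).dz v))).integrableOn_compact
        h.isCompact

theorem Adm.integrableOn {O K : Set F} {f g c : F → ℂ} (h : Adm O K f g)
    (hc : ∀ x ∈ O, DifferentiableAt ℂ c x) :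
    IntegrableOn (fun x => starRingEnd ℂ (c x) * (f x * g x)) K μ :=
  ((continuousOn_conj fun x hx => hc x (h.subset hx)).mul
    ((Sm.continuousOn fun x hx => h.left x (h.subset hx)).mul
      (Sm.continuousOn fun x hx => h.right x (h.subset hx)))).integrableOn_compact h.isCompact

/-- Differential operators `A` and `At` near `x₀` which are transposed to each other, also with
respect to antiholomorphic weights. -/
structure TransposedDO (x₀ : F) (A At : (F → ℂ) → F → ℂ) : Prop where
  isDO : IsDO x₀ A
  isDO_transpose : IsDO x₀ At
  integral_eq : ∀ᶠ O in (𝓝 x₀).smallSets, ∀ K f g c, Adm O K f g →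
    (∀ x ∈ O, DifferentiableAt ℂ c x) →
    ∫ x in K, starRingEnd ℂ (c x) * (At f x * g x) ∂μ
      = ∫ x in K, starRingEnd ℂ (c x) * (f x * A g x) ∂μ

theorem transposedDO_mul {x₀ : F} {a : F → ℂ} (ha : Hol a x₀) :
    TransposedDO μ x₀ (fun f x => a x * f x) (fun f x => a x * f x) where
  isDO := (isDO_id x₀).mul_left ha
  isDO_transpose := (isDO_id x₀).mul_left ha
  integral_eq := Eventually.of_forall fun O K f g c _ _ => by
    congr 1
    funext x
    ring

theorem transposedDO_dz (x₀ v : F) :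
    TransposedDO μ x₀ (dz v) (fun f x => (-1) * dz v f x) where
  isDO := isDO_dzs x₀ [v]
  isDO_transpose := (isDO_dzs x₀ [v]).mul_left (hol_const (-1) x₀)
  integral_eq := Eventually.of_forall fun O K f g c h hc => by
    rw [← neg_eq_iff_eq_neg.2 (h.integral_dz μ hc v), ← integral_neg]
    congr 1
    funext x
    ring

theorem TransposedDO.add {x₀ : F} {A At B Bt : (F → ℂ) → F → ℂ} (hA : TransposedDO μ x₀ A At)
    (hB : TransposedDO μ x₀ B Bt) :
    TransposedDO μ x₀ (fun f x => A f x + B f x) (fun f x => At f x + Bt f x) where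
  isDO := hA.isDO.add hB.isDO
  isDO_transpose := hA.isDO_transpose.add hB.isDO_transpose
  integral_eq := by
    filter_upwards [hA.integral_eq, hB.integral_eq, Adm.map_left hA.isDO_transpose,
      Adm.map_left hB.isDO_transpose, Adm.map_right hA.isDO, Adm.map_right hB.isDO]
      with O h1 h2 h3 h4 h5 h6 K f g c h hc
    simp only [add_mul, mul_add]
    rw [integral_add ((h3 K f g h).integrableOn μ hc) ((h4 K f g h).integrableOn μ hc),
      integral_add ((h5 K f g h).integrableOn μ hc) ((h6 K f g h).integrableOn μ hc),
      h1 K f g c h hc, h2 K f g c h hc]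

/-- Move `B` first and then `A`. The intermediate pairs `(At f, g)` and `(f, B g)` must be
admissible on the same `O` and `K`. -/
theorem TransposedDO.comp {x₀ : F} {A At B Bt : (F → ℂ) → F → ℂ} (hA : TransposedDO μ x₀ A At)
    (hB : TransposedDO μ x₀ B Bt) :
    TransposedDO μ x₀ (fun f => A (B f)) (fun f => Bt (At f)) where
  isDO := hA.isDO.comp hB.isDO
  isDO_transpose := hB.isDO_transpose.comp hA.isDO_transpose
  integral_eq := by
    filter_upwards [hA.integral_eq, hB.integral_eq, Adm.map_left hA.isDO_transpose,
      Adm.map_right hB.isDO] with O h1 h2 h3 h4 K f g c h hc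
    rw [h2 K _ g c (h3 K f g h) hc, h1 K f _ c (h4 K f g h) hc]

end Transpose

/-! ### Germs and coordinates -/

section Coordinates

variable {X : Type*} [TopologicalSpace X] {E : Type*} [NormedAddCommGroup E] [NormedSpace ℂ E]
  [ChartedSpace E X] {Y : Type*} [TopologicalSpace Y] {E' : Type*} [NormedAddCommGroup E']
  [NormedSpace ℂ E'] [ChartedSpace E' Y]
  {F : Type*} [NormedAddCommGroup F] [NormedSpace ℂ F]

/-- A holomorphic map is `C^∞` in the real sense. -/
theorem contMDiffAt_of_eventually_mdifferentiableAt [FiniteDimensional ℂ E]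
    [FiniteDimensional ℂ E'] [IsManifold 𝓘(ℂ, E) ω X] [IsManifold 𝓘(ℂ, E') ω Y]
    {p : X → Y} {x : X}
    (h : ∀ᶠ x' in 𝓝 x, MDifferentiableAt 𝓘(ℂ, E) 𝓘(ℂ, E') p x') :
    ContMDiffAt 𝓘(ℝ, E) 𝓘(ℝ, E') ∞ p x := by
  have hcont : ContinuousAt p x := h.self_of_nhds.continuousAt
  rw [contMDiffAt_iff]
  refine ⟨hcont, ContDiffAt.contDiffWithinAt ?_⟩
  simp only [mfld_simps]
  refine (contDiffAt_of_eventually_differentiableAt ?_).restrict_scalars ℝ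
  have hx : (chartAt E x).symm (chartAt E x x) = x :=
    (chartAt E x).left_inv (mem_chart_source E x)
  have hsymm : Tendsto (chartAt E x).symm (𝓝 (chartAt E x x)) (𝓝 x) := by
    have := (chartAt E x).continuousAt_symm (mem_chart_target E x)
    rwa [ContinuousAt, hx] at this
  filter_upwards [hsymm.eventually h, (chartAt E x).open_target.mem_nhds (mem_chart_target E x),
    hsymm.eventually (hcont.eventually ((chartAt E' (p x)).open_source.mem_nhds
      (mem_chart_source E' (p x))))] with y h1 h2 h3
  rw [← mdifferentiableAt_iff_differentiableAt]
  exact (mdifferentiableAt_atlas (chart_mem_atlas E' (p x)) h3).comp y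
    (h1.comp y (mdifferentiableAt_atlas_symm (chart_mem_atlas E x) h2))

theorem SmoothNear.congr {f g : X → ℂ} {x : X} (h : SmoothNear E f x) (hfg : f =ᶠ[𝓝 x] g) :
    SmoothNear E g x := by
  filter_upwards [h, hfg.eventuallyEq_nhds] with x' h1 h2
  exact h1.congr_of_eventuallyEq h2.symm

theorem SmoothNear.eventually {f : X → ℂ} {x : X} (h : SmoothNear E f x) :
    ∀ᶠ x' in 𝓝 x, SmoothNear E f x' := eventually_eventually_nhds.2 h

theorem SmoothNear.comp [FiniteDimensional ℂ E] [FiniteDimensional ℂ E']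
    [IsManifold 𝓘(ℂ, E) ω X] [IsManifold 𝓘(ℂ, E') ω Y] {p : X → Y} {x : X} {f : Y → ℂ}
    (hf : SmoothNear E' f (p x))
    (h : ∀ᶠ x' in 𝓝 x, MDifferentiableAt 𝓘(ℂ, E) 𝓘(ℂ, E') p x') :
    SmoothNear E (fun y => f (p y)) x := by
  filter_upwards [eventually_eventually_nhds.2 h,
    h.self_of_nhds.continuousAt.eventually hf] with x' h1 h2
  exact h2.comp x' (contMDiffAt_of_eventually_mdifferentiableAt h1)

theorem smoothNear_iff_sm {f : F → ℂ} {x : F} : SmoothNear F f x ↔ Sm f x := by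
  simp only [SmoothNear, Sm, contMDiffAt_iff_contDiffAt]

theorem holNear_iff_hol {f : F → ℂ} {x : F} : HolNear F f x ↔ Hol f x := by
  simp only [HolNear, Hol, mdifferentiableAt_iff_differentiableAt]

namespace SmoothGerm

/-- The germ of a smooth function. -/
def mk {x : X} (f : X → ℂ) (hf : SmoothNear E f x) : SmoothGerm E x :=
  ⟨(f : Germ (𝓝 x) ℂ), f, rfl, hf⟩

@[simp] theorem germ_mk {x : X} (f : X → ℂ) (hf : SmoothNear E f x) : (mk f hf).germ = f := rfl

theorem ext_germ {x : X} {u v : SmoothGerm E x} (h : u.germ = v.germ) : u = v := Subtype.ext h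

theorem exists_rep {x : X} (u : SmoothGerm E x) :
    ∃ (f : X → ℂ) (hf : SmoothNear E f x), u = mk f hf := by
  obtain ⟨_, f, rfl, hf⟩ := u
  exact ⟨f, hf, rfl⟩

@[simp] theorem germ_add {x : X} (u v : SmoothGerm E x) : (u + v).germ = u.germ + v.germ := rfl

@[simp] theorem germ_smul {x : X} (c : ℂ) (u : SmoothGerm E x) : (c • u).germ = c • u.germ := rfl

@[simp] theorem germ_zero {x : X} : (0 : SmoothGerm E x).germ = 0 := rfl

end SmoothGerm

/-- `κ` is a holomorphic coordinate system at `z`. -/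
structure HolCoord (E : Type*) [NormedAddCommGroup E] [NormedSpace ℂ E] [ChartedSpace E X]
    (κ : OpenPartialHomeomorph X F) (z : X) : Prop where
  mem : z ∈ κ.source
  hol : MDifferentiableOn 𝓘(ℂ, E) 𝓘(ℂ, F) κ κ.source
  hol_symm : MDifferentiableOn 𝓘(ℂ, F) 𝓘(ℂ, E) κ.symm κ.target

namespace HolCoord

variable {κ : OpenPartialHomeomorph X F} {z : X}

theorem of_mem (h : HolCoord E κ z) {z' : X} (hz' : z' ∈ κ.source) : HolCoord E κ z' :=
  ⟨hz', h.hol, h.hol_symm⟩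

theorem mem_target (h : HolCoord E κ z) : κ z ∈ κ.target := κ.map_source h.mem

theorem eventually_mdifferentiableAt (h : HolCoord E κ z) :
    ∀ᶠ z' in 𝓝 z, MDifferentiableAt 𝓘(ℂ, E) 𝓘(ℂ, F) κ z' := by
  filter_upwards [κ.open_source.mem_nhds h.mem] with z' hz'
  exact (h.hol z' hz').mdifferentiableAt (κ.open_source.mem_nhds hz')

theorem eventually_mdifferentiableAt_symm (h : HolCoord E κ z) :
    ∀ᶠ x in 𝓝 (κ z), MDifferentiableAt 𝓘(ℂ, F) 𝓘(ℂ, E) κ.symm x := by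
  filter_upwards [κ.open_target.mem_nhds h.mem_target] with x hx
  exact (h.hol_symm x hx).mdifferentiableAt (κ.open_target.mem_nhds hx)

theorem tendsto_symm (h : HolCoord E κ z) : Tendsto κ.symm (𝓝 (κ z)) (𝓝 z) := by
  have := κ.continuousAt_symm h.mem_target
  rwa [ContinuousAt, κ.left_inv h.mem] at this

theorem tendsto (h : HolCoord E κ z) : Tendsto κ (𝓝 z) (𝓝 (κ z)) := κ.continuousAt h.mem

variable [FiniteDimensional ℂ E] [FiniteDimensional ℂ F] [IsManifold 𝓘(ℂ, E) ω X]

theorem smoothNear_comp (h : HolCoord E κ z) {f : F → ℂ} (hf : Sm f (κ z)) :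
    SmoothNear E (fun x => f (κ x)) z :=
  (smoothNear_iff_sm.2 hf).comp h.eventually_mdifferentiableAt

theorem sm_comp_symm (h : HolCoord E κ z) {f : X → ℂ} (hf : SmoothNear E f z) :
    Sm (fun x => f (κ.symm x)) (κ z) := by
  rw [← smoothNear_iff_sm]
  refine SmoothNear.comp (p := κ.symm) (E' := E) ?_ h.eventually_mdifferentiableAt_symm
  rwa [κ.left_inv h.mem]

omit [FiniteDimensional ℂ E] [FiniteDimensional ℂ F] [IsManifold 𝓘(ℂ, E) ω X] in
theorem hol_comp_symm (h : HolCoord E κ z) {f : X → ℂ} (hf : HolNear E f z) :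
    Hol (fun x => f (κ.symm x)) (κ z) := by
  rw [← holNear_iff_hol]
  filter_upwards [h.tendsto_symm.eventually hf, h.eventually_mdifferentiableAt_symm] with x h1 h2
  exact h1.comp x h2

end HolCoord

/-- The germ operator `Q` at `z` is the operator `A` in the coordinates `κ`. -/
structure Rep (κ : OpenPartialHomeomorph X F) (z : X) (Q : GermOp E z) (A : (F → ℂ) → F → ℂ) :
    Prop where
  isDO : IsDO (κ z) A
  germ_eq : ∀ f, Sm f (κ z) → ∀ u : SmoothGerm E z,
    u.germ = ((fun x => f (κ x) : X → ℂ) : Germ (𝓝 z) ℂ) →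
    (Q u).germ = ((fun x => A f (κ x) : X → ℂ) : Germ (𝓝 z) ℂ)

/-! ### Germ operators written in coordinates -/

section Rep

variable [FiniteDimensional ℂ E] [FiniteDimensional ℂ F] [IsManifold 𝓘(ℂ, E) ω X]
  {κ : OpenPartialHomeomorph X F} {z : X}

theorem rep_mul (h : HolCoord E κ z) {f : X → ℂ} (hf : HolNear E f z) {M : GermOp E z}
    (hM : IsMulBy E f M) : Rep κ z M (fun g x => f (κ.symm x) * g x) where
  isDO := (isDO_id _).mul_left (h.hol_comp_symm hf)
  germ_eq g _ u hu := by
    rw [hM u, hu]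
    refine Germ.coe_eq.2 ?_
    filter_upwards [κ.eventually_left_inverse h.mem] with x hx
    simp [hx]

theorem rep_deriv (h : HolCoord E κ z) {δ : GermOp E z} {v : F}
    (hδ : ∀ (f : X → ℂ) (u : SmoothGerm E z), u.germ = f → (δ u).germ = (wirt κ v f : X → ℂ)) :
    Rep κ z δ (dz v) where
  isDO := isDO_dzs _ [v]
  germ_eq g _ u hu := by
    rw [hδ _ u hu]
    refine Germ.coe_eq.2 ?_
    filter_upwards [κ.open_source.mem_nhds h.mem] with x hx
    have h1 : (fun x => g (κ x)) ∘ κ.symm =ᶠ[𝓝 (κ x)] g := by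
      filter_upwards [κ.eventually_right_inverse (κ.map_source hx)] with y hy
      simp [hy]
    simp only [wirt, dz, h1.fderiv_eq]

omit [FiniteDimensional ℂ E] [FiniteDimensional ℂ F] [IsManifold 𝓘(ℂ, E) ω X] in
theorem Rep.zero : Rep κ z (0 : GermOp E z) (fun _ _ => 0) where
  isDO := isDO_zero _
  germ_eq _ _ _ _ := rfl

omit [FiniteDimensional ℂ E] [FiniteDimensional ℂ F] [IsManifold 𝓘(ℂ, E) ω X] in
theorem Rep.add {Q R : GermOp E z} {A B : (F → ℂ) → F → ℂ} (hA : Rep κ z Q A) (hB : Rep κ z R B) :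
    Rep κ z (Q + R) (fun f x => A f x + B f x) where
  isDO := hA.isDO.add hB.isDO
  germ_eq f hf u hu := by
    rw [LinearMap.add_apply, SmoothGerm.germ_add, hA.germ_eq f hf u hu, hB.germ_eq f hf u hu]
    rfl

omit [FiniteDimensional ℂ E] [FiniteDimensional ℂ F] [IsManifold 𝓘(ℂ, E) ω X] in
theorem Rep.smul (c : ℂ) {Q : GermOp E z} {A : (F → ℂ) → F → ℂ} (hA : Rep κ z Q A) :
    Rep κ z (c • Q) (fun f x => c * A f x) where
  isDO := hA.isDO.mul_left (hol_const c _)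
  germ_eq f hf u hu := by
    rw [LinearMap.smul_apply, SmoothGerm.germ_smul, hA.germ_eq f hf u hu]
    rfl

omit [FiniteDimensional ℂ E] [FiniteDimensional ℂ F] [IsManifold 𝓘(ℂ, E) ω X] in
theorem Rep.one : Rep κ z (1 : GermOp E z) (fun f => f) where
  isDO := isDO_id _
  germ_eq _ _ _ hu := hu

omit [FiniteDimensional ℂ E] [IsManifold 𝓘(ℂ, E) ω X] in
theorem Rep.mul {Q R : GermOp E z} {A B : (F → ℂ) → F → ℂ} (hA : Rep κ z Q A) (hB : Rep κ z R B) :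
    Rep κ z (Q * R) (fun f => A (B f)) where
  isDO := hA.isDO.comp hB.isDO
  germ_eq f hf u hu :=
    hA.germ_eq _ ((hB.isDO.eventually_local.self_of_nhds f hf).1) _ (hB.germ_eq f hf u hu)

/-- Representatives of a germ operator agree near the point. -/
theorem Rep.unique (h : HolCoord E κ z) {Q : GermOp E z} {A B : (F → ℂ) → F → ℂ}
    (hA : Rep κ z Q A) (hB : Rep κ z Q B) :
    ∀ᶠ x in 𝓝 (κ z), ∀ f, Sm f x → A f x = B f x := by
  refine hA.isDO.along_id.eventually_eq hB.isDO.along_id fun f hf => ?_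
  have hs := ContDiff.sm hf (κ z)
  let u : SmoothGerm E z := SmoothGerm.mk _ (h.smoothNear_comp hs)
  have h1 := (hA.germ_eq f hs u rfl).symm.trans (hB.germ_eq f hs u rfl)
  exact (κ.eventually_nhds _ h.mem).2 (Germ.coe_eq.1 h1)

/-- The germ operators that have a coordinate representative form an algebra containing the
generators of the stalk. -/
theorem exists_rep_of_mem_DStalk (h : HolCoord E κ z) {Q : GermOp E z} (hQ : Q ∈ DStalk E κ z) :
    ∃ A, Rep κ z Q A := by
  refine Algebra.adjoin_induction (fun Q hQ => ?_) (fun r => ?_) (fun Q R _ _ hQ hR => ?_)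
    (fun Q R _ _ hQ hR => ?_) hQ
  · rcases hQ with ⟨f, hf, hM⟩ | ⟨v, hδ⟩
    exacts [⟨_, rep_mul h hf hM⟩, ⟨_, rep_deriv h hδ⟩]
  · rw [Algebra.algebraMap_eq_smul_one]
    exact ⟨_, Rep.one.smul r⟩
  · obtain ⟨A, hA⟩ := hQ
    obtain ⟨B, hB⟩ := hR
    exact ⟨_, hA.add hB⟩
  · obtain ⟨A, hA⟩ := hQ
    obtain ⟨B, hB⟩ := hR
    exact ⟨_, hA.mul hB⟩

/-- The formal transposition becomes integration by parts. It suffices to check the generators;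
products in the opposite algebra reverse the order of the transposes, exactly as in
`TransposedDO.comp`. -/
theorem exists_rep_of_mem_transposePairs [MeasurableSpace F] [BorelSpace F] (μ : Measure F)
    [μ.IsAddHaarMeasure] (h : HolCoord E κ z) {Q : GermOp E z × (GermOp E z)ᵐᵒᵖ}
    (hQ : Q ∈ transposePairs E κ z) :
    ∃ A At, Rep κ z Q.1 A ∧ Rep κ z Q.2.unop At ∧ TransposedDO μ (κ z) A At := by
  refine Algebra.adjoin_induction (fun Q hQ => ?_) (fun r => ?_) (fun Q R _ _ hQ hR => ?_)
    (fun Q R _ _ hQ hR => ?_) hQ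
  · rcases hQ with ⟨M, ⟨f, hf, hM⟩, rfl⟩ | ⟨δ, ⟨v, hδ⟩, rfl⟩
    · exact ⟨_, _, rep_mul h hf hM, rep_mul h hf hM, transposedDO_mul μ (h.hol_comp_symm hf)⟩
    · refine ⟨_, _, rep_deriv h hδ, ?_, transposedDO_dz μ _ v⟩
      have := (rep_deriv h hδ).smul (-1)
      rwa [neg_one_smul] at this
  · rw [Algebra.algebraMap_eq_smul_one]
    exact ⟨_, _, Rep.one.smul r, Rep.one.smul r, transposedDO_mul μ (hol_const r _)⟩
  · obtain ⟨A, At, hA, hAt, hAA⟩ := hQ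
    obtain ⟨B, Bt, hB, hBt, hBB⟩ := hR
    exact ⟨_, _, hA.add hB, hAt.add hBt, hAA.add μ hBB⟩
  · obtain ⟨A, At, hA, hAt, hAA⟩ := hQ
    obtain ⟨B, Bt, hB, hBt, hBB⟩ := hR
    exact ⟨_, _, hA.mul hB, hBt.mul hAt, hAA.comp μ hBB⟩

/-- A vector field acts by `f ↦ ∂_{V(x)} f`. -/
theorem exists_vectorField_of_mem_ThetaStalk (h : HolCoord E κ z) {θ : GermOp E z}
    (hθ : θ ∈ ThetaStalk E κ z) : ∃ V : F → F, Rep κ z θ (fun f x => dz (V x) f x) := by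
  refine Submodule.span_induction (fun θ hθ => ?_) ?_ (fun θ θ' _ _ h1 h2 => ?_)
    (fun c θ _ h1 => ?_) hθ
  · obtain ⟨M, ⟨f, hf, hM⟩, δ, ⟨v, hδ⟩, rfl⟩ := hθ
    refine ⟨fun x => f (κ.symm x) • v, ?_⟩
    simp only [dz_smul_dir]
    exact (rep_mul h hf hM).mul (rep_deriv h hδ)
  · refine ⟨fun _ => 0, ?_⟩
    simpa [dz] using Rep.zero
  · obtain ⟨V, hV⟩ := h1
    obtain ⟨V', hV'⟩ := h2
    refine ⟨fun x => V x + V' x, ?_⟩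
    simp only [dz_add_dir]
    exact hV.add hV'
  · obtain ⟨V, hV⟩ := h1
    refine ⟨fun x => c • V x, ?_⟩
    simp only [dz_smul_dir]
    exact hV.smul c

end Rep

/-! ### Relative vector fields and the left ideals they generate -/

section Relative

variable [FiniteDimensional ℂ E] [FiniteDimensional ℂ F] [IsManifold 𝓘(ℂ, E) ω X]
  [FiniteDimensional ℂ E'] [IsManifold 𝓘(ℂ, E') ω Y]
  {κ : OpenPartialHomeomorph X F} {z : X} {p : X → Y}

/-- A relative vector field kills functions pulled back from the base at all nearby points. -/
theorem Rep.eventually_eq_zero_of_mem_relTheta (h : HolCoord E κ z)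
    (hp : ∀ᶠ z' in 𝓝 z, MDifferentiableAt 𝓘(ℂ, E) 𝓘(ℂ, E') p z') {θ : GermOp E z}
    (hθ : θ ∈ relTheta E E' κ p z) {A : (F → ℂ) → F → ℂ} (hA : Rep κ z θ A) :
    ∀ᶠ x in 𝓝 (κ z), ∀ u : Y → ℂ, SmoothNear E' u (p (κ.symm x)) →
      A (fun x' => u (p (κ.symm x'))) x = 0 := by
  obtain ⟨V, hV⟩ := exists_vectorField_of_mem_ThetaStalk h hθ.1
  let ψ := chartAt E' (p z)
  let P : F → E' := fun x => ψ (p (κ.symm x))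
  have hψ : HolCoord E' ψ (p z) :=
    ⟨mem_chart_source E' (p z), fun y hy => (mdifferentiableAt_atlas (chart_mem_atlas E' _)
      hy).mdifferentiableWithinAt, fun y hy => (mdifferentiableAt_atlas_symm
        (chart_mem_atlas E' _) hy).mdifferentiableWithinAt⟩
  have hpc : Tendsto p (𝓝 z) (𝓝 (p z)) := hp.self_of_nhds.continuousAt
  have hP : ∀ᶠ x in 𝓝 (κ z), DifferentiableAt ℂ P x := by
    filter_upwards [h.tendsto_symm.eventually hp, h.eventually_mdifferentiableAt_symm,
      h.tendsto_symm.eventually (hpc.eventually hψ.eventually_mdifferentiableAt)] with x h1 h2 h3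
    rw [← mdifferentiableAt_iff_differentiableAt]
    exact h3.comp x (h1.comp x h2)
  let b := Module.finBasis ℂ E'
  -- Testing `θ` on the finitely many coordinate functions of `Y` gives `dP(V) = 0` on one
  -- neighbourhood. The chain rule then covers every smooth `u` at every point of it.
  have hVP : ∀ᶠ x in 𝓝 (κ z), ∀ i, b.coord i (fderiv ℂ P x (V x)) = 0 := by
    refine eventually_all.2 fun i => ?_
    let l : E' →L[ℂ] ℂ := LinearMap.toContinuousLinearMap (b.coord i)
    have hl : ∀ y : E', Sm l y := fun y => (Hol.sm (Eventually.of_forall fun _ =>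
      l.differentiableAt))
    have hu : SmoothNear E' (fun y => l (ψ y)) (p z) := hψ.smoothNear_comp (hl _)
    have hw : SmoothNear E (fun x => l (ψ (p x))) z :=
      SmoothNear.comp (f := fun y => l (ψ y)) hu hp
    have h0 := hθ.2 _ hu (SmoothGerm.mk _ hw) rfl
    have hs : Sm (fun x => l (P x)) (κ z) := h.sm_comp_symm hw
    have h1 := hV.germ_eq (fun x => l (P x)) hs (SmoothGerm.mk _ hw) (by
      refine Germ.coe_eq.2 ?_
      filter_upwards [κ.eventually_left_inverse h.mem] with x hx
      simp [P, hx])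
    rw [h0, SmoothGerm.germ_zero] at h1
    have h2 : ∀ᶠ x in 𝓝 (κ z), (0 : ℂ) = dz (V x) (fun x => l (P x)) x :=
      (κ.eventually_nhds _ h.mem).2 (Germ.coe_eq.1 h1)
    filter_upwards [h2, hP] with x h3 h4
    exact (dz_of_hasFDerivAt (l.hasFDerivAt.comp x h4.hasFDerivAt) (V x)).symm.trans h3.symm
  filter_upwards [hVP, hP, hA.unique h hV, κ.open_target.mem_nhds h.mem_target,
    eventually_eventually_nhds.2 (h.tendsto_symm.eventually hp),
    eventually_eventually_nhds.2 (h.tendsto_symm.eventually (hpc.eventually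
      (ψ.open_source.mem_nhds hψ.mem)))] with x h1 h2 h3 h4 h5 h6 u hu
  have hκx : HolCoord E κ (κ.symm x) := h.of_mem (κ.map_target h4)
  have hx : κ (κ.symm x) = x := κ.right_inv h4
  have h5' : ∀ᶠ z' in 𝓝 (κ.symm x), MDifferentiableAt 𝓘(ℂ, E) 𝓘(ℂ, E') p z' := by
    refine (κ.eventually_nhds (fun y => MDifferentiableAt 𝓘(ℂ, E) 𝓘(ℂ, E') p (κ.symm y))
      hκx.mem).1 (by rwa [hx]) |>.mp ?_
    filter_upwards [κ.eventually_left_inverse hκx.mem] with z' hz' hz''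
    rwa [hz'] at hz''
  have hs : Sm (fun x' => u (p (κ.symm x'))) x := by
    have := hκx.sm_comp_symm (SmoothNear.comp hu h5')
    rwa [hx] at this
  rw [h3 _ hs]
  have hψx : HolCoord E' ψ (p (κ.symm x)) := hψ.of_mem h6.self_of_nhds
  have hu' : Sm (fun y => u (ψ.symm y)) (P x) := hψx.sm_comp_symm hu
  have heq : (fun x' => u (p (κ.symm x'))) =ᶠ[𝓝 x] fun x' => u (ψ.symm (P x')) := by
    filter_upwards [h6] with y hy
    simp only [P]
    rw [ψ.left_inv hy]
  rw [(dz_congr heq (V x)).self_of_nhds,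
    dz_comp (f := fun y => u (ψ.symm y)) h2 hu'.differentiableAt]
  have hzero : fderiv ℂ P x (V x) = 0 := by
    refine b.repr.map_eq_zero_iff.1 (Finsupp.ext fun i => ?_)
    simpa using h1 i
  rw [hzero]
  simp [dz]

/-- In a product `D · θ` the vector field acts first and already kills the function on a
neighbourhood of `x`. To be a pullback near `x` is an open condition on `x`, which is what makes
this work. -/
theorem Rep.eventually_eq_zero_of_mem_relIdeal (h : HolCoord E κ z)
    (hp : ∀ᶠ z' in 𝓝 z, MDifferentiableAt 𝓘(ℂ, E) 𝓘(ℂ, E') p z') {R : DStalk E κ z}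
    (hR : R ∈ relIdeal E E' κ p z) {A : (F → ℂ) → F → ℂ} (hA : Rep κ z (R : GermOp E z) A) :
    ∀ᶠ x in 𝓝 (κ z), ∀ f : F → ℂ, Sm f x → (∃ u : Y → ℂ, SmoothNear E' u (p (κ.symm x)) ∧
      f =ᶠ[𝓝 x] fun x' => u (p (κ.symm x'))) → A f x = 0 := by
  -- The induction builds a representative of its own; `Rep.unique` transfers the conclusion to `A`.
  have main : ∃ B, Rep κ z (R : GermOp E z) B ∧
      ∀ᶠ x in 𝓝 (κ z), ∀ f : F → ℂ, Sm f x → (∃ u : Y → ℂ, SmoothNear E' u (p (κ.symm x)) ∧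
        f =ᶠ[𝓝 x] fun x' => u (p (κ.symm x'))) → B f x = 0 := by
    refine Submodule.span_induction (fun R hR => ?_) ?_ (fun R R' _ _ h1 h2 => ?_)
      (fun D R _ h1 => ?_) hR
    · obtain ⟨B, hB⟩ := exists_rep_of_mem_DStalk h R.2
      refine ⟨B, hB, ?_⟩
      filter_upwards [hB.eventually_eq_zero_of_mem_relTheta h hp hR, hB.isDO.eventually_local]
        with x h1 h2 f hf ⟨u, hu, hfu⟩
      rw [((h2 f hf).2 _ hfu).self_of_nhds, h1 u hu]
    · exact ⟨_, Rep.zero, by simp⟩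
    · obtain ⟨B, hB, h1⟩ := h1
      obtain ⟨B', hB', h2⟩ := h2
      refine ⟨_, hB.add hB', ?_⟩
      filter_upwards [h1, h2] with x h3 h4 f hf hu
      rw [h3 f hf hu, h4 f hf hu, add_zero]
    · obtain ⟨B, hB, h1⟩ := h1
      obtain ⟨A', hA'⟩ := exists_rep_of_mem_DStalk h D.2
      refine ⟨_, hA'.mul hB, ?_⟩
      filter_upwards [eventually_eventually_nhds.2 h1, hA'.isDO.eventually_local,
        hA'.isDO.eventually_map_zero, hB.isDO.eventually_local,
        κ.open_target.mem_nhds h.mem_target,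
        h.tendsto_symm.eventually (eventually_eventually_nhds.2 hp)]
        with x h3 h4 h5 h6 h7 h8 f hf ⟨u, hu, hfu⟩
      have h9 : B f =ᶠ[𝓝 x] fun _ => 0 := by
        have hc : ContinuousAt (fun x' => p (κ.symm x')) x :=
          h8.self_of_nhds.continuousAt.comp (κ.continuousAt_symm h7)
        filter_upwards [h3, hf.eventually, hc.eventually hu.eventually,
          hfu.eventuallyEq_nhds] with y hy1 hy2 hy3 hy4
        exact hy1 f hy2 ⟨u, hy3, hy4⟩
      rw [((h4 _ (h6 f hf).1).2 _ h9).self_of_nhds, h5]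
  obtain ⟨B, hB, hB0⟩ := main
  filter_upwards [hB0, hA.unique h hB] with x h1 h2 f hf hu
  rw [h2 f hf, h1 f hf hu]

end Relative

end Coordinates

/-! ### The pairing of the kernel module with functions -/

section Pairing

/-- The quotients are by left `A`-submodules while the tensor product is over `ℂ`, so the form is
descended one variable at a time after restricting scalars. -/
theorem exists_lift_tensor_quotient {A W : Type*} [Ring A] [Algebra ℂ A] [AddCommGroup W]
    [Module ℂ W] (I J : Submodule A A) (Λ : A →ₗ[ℂ] A →ₗ[ℂ] W)
    (hI : ∀ r ∈ I, ∀ t, Λ r t = 0) (hJ : ∀ t ∈ J, ∀ r, Λ r t = 0) :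
    ∃ Λ' : (A ⧸ I) ⊗[ℂ] (A ⧸ J) →ₗ[ℂ] W, ∀ r t,
      Λ' ((Submodule.Quotient.mk r : A ⧸ I) ⊗ₜ[ℂ] (Submodule.Quotient.mk t : A ⧸ J)) = Λ r t := by
  let eI := Submodule.Quotient.restrictScalarsEquiv ℂ I
  let eJ := Submodule.Quotient.restrictScalarsEquiv ℂ J
  let Λ₁ : (A ⧸ I) →ₗ[ℂ] A →ₗ[ℂ] W :=
    ((I.restrictScalars ℂ).liftQ Λ fun r hr => LinearMap.ext fun t => hI r hr t).comp
      eI.symm.toLinearMap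
  let Λ₂ : (A ⧸ J) →ₗ[ℂ] (A ⧸ I) →ₗ[ℂ] W :=
    ((J.restrictScalars ℂ).liftQ Λ₁.flip fun t ht => LinearMap.ext fun r => by
      obtain ⟨r, rfl⟩ := Submodule.Quotient.mk_surjective _ r
      exact hJ t ht r).comp eJ.symm.toLinearMap
  exact ⟨TensorProduct.lift Λ₂.flip, fun r t => rfl⟩

variable {Z Y₁ Y₂ : Type*} [TopologicalSpace Z] [TopologicalSpace Y₁] [TopologicalSpace Y₂]
  {EZ : Type*} [NormedAddCommGroup EZ] [NormedSpace ℂ EZ] [ChartedSpace EZ Z]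
  (E₁ : Type*) [NormedAddCommGroup E₁] [NormedSpace ℂ E₁] [ChartedSpace E₁ Y₁]
  (E₂ : Type*) [NormedAddCommGroup E₂] [NormedSpace ℂ E₂] [ChartedSpace E₂ Y₂]
  {F : Type*} [NormedAddCommGroup F] [NormedSpace ℂ F]

/-- Functions `f₂` and `f₁`, locally pulled back from `Y₂` and `Y₁`, on an open subset `O` of the
coordinate space, such that `f₂ f₁` is supported in the compact set `K`. -/
structure TestDatum (κ : OpenPartialHomeomorph Z F) (p₁ : Z → Y₁) (p₂ : Z → Y₂) where
  /-- the open set -/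
  O : Set F
  /-- the compact set -/
  K : Set F
  /-- the function pulled back from `Y₂` -/
  f₂ : F → ℂ
  /-- the function pulled back from `Y₁` -/
  f₁ : F → ℂ
  adm : Adm O K f₂ f₁
  pull₂ : ∀ x ∈ O, ∃ u : Y₂ → ℂ, SmoothNear E₂ u (p₂ (κ.symm x)) ∧
    f₂ =ᶠ[𝓝 x] fun x' => u (p₂ (κ.symm x'))
  pull₁ : ∀ x ∈ O, ∃ u : Y₁ → ℂ, SmoothNear E₁ u (p₁ (κ.symm x)) ∧
    f₁ =ᶠ[𝓝 x] fun x' => u (p₁ (κ.symm x'))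

/-- Test data concentrated near a point. -/
def testFilter (κ : OpenPartialHomeomorph Z F) (p₁ : Z → Y₁) (p₂ : Z → Y₂) (x₀ : F) :
    Filter (TestDatum E₁ E₂ κ p₁ p₂) := comap TestDatum.O (𝓝 x₀).smallSets

variable {E₁ E₂} [FiniteDimensional ℂ EZ] [IsManifold 𝓘(ℂ, EZ) ω Z]
  [FiniteDimensional ℂ F] [MeasurableSpace F] [BorelSpace F] (μ : Measure F) [μ.IsAddHaarMeasure]
  {κ : OpenPartialHomeomorph Z F} {p₁ : Z → Y₁} {p₂ : Z → Y₂} {z : Z}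

/-- The pairing of operators in coordinates with a test datum. -/
def testIntegral (c : F → ℂ) (A B : (F → ℂ) → F → ℂ) (i : TestDatum E₁ E₂ κ p₁ p₂) : ℂ :=
  ∫ x in i.K, starRingEnd ℂ (c x) * (A i.f₂ x * B i.f₁ x) ∂μ

theorem eventually_testFilter {x₀ : F} {P : Set F → Prop} (h : ∀ᶠ O in (𝓝 x₀).smallSets, P O) :
    ∀ᶠ i in testFilter E₁ E₂ κ p₁ p₂ x₀, P i.O := tendsto_comap.eventually h

theorem eventually_testFilter_forall {x₀ : F} {P : F → Prop} (h : ∀ᶠ x in 𝓝 x₀, P x) :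
    ∀ᶠ i in testFilter E₁ E₂ κ p₁ p₂ x₀, ∀ x ∈ i.O, P x :=
  eventually_testFilter (eventually_smallSets_forall.2 h)

/-- Representatives of a germ operator agree only near the point. The integral is therefore
independent of them only for test data concentrated there, and the pairing takes its values in germs
along `testFilter` instead of numbers. -/
theorem testIntegral_congr (hκ : HolCoord EZ κ z) {c : F → ℂ} {R T : GermOp EZ z}
    {A A' B B' : (F → ℂ) → F → ℂ} (hA : Rep κ z R A) (hA' : Rep κ z R A') (hB : Rep κ z T B)
    (hB' : Rep κ z T B') :
    testIntegral μ c A B =ᶠ[testFilter E₁ E₂ κ p₁ p₂ (κ z)] testIntegral μ c A' B' := by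
  filter_upwards [eventually_testFilter_forall (hA.unique hκ hA'),
    eventually_testFilter_forall (hB.unique hκ hB')] with i h1 h2
  refine setIntegral_congr_fun i.adm.isCompact.measurableSet fun x hx => ?_
  have hxO := i.adm.subset hx
  rw [h1 x hxO _ (i.adm.left x hxO), h2 x hxO _ (i.adm.right x hxO)]

omit [FiniteDimensional ℂ EZ] [IsManifold 𝓘(ℂ, EZ) ω Z] in
theorem testIntegral_add_left {c : F → ℂ} (hc : Hol c (κ z)) {R R' T : GermOp EZ z}
    {A A' B : (F → ℂ) → F → ℂ} (hA : Rep κ z R A) (hA' : Rep κ z R' A') (hB : Rep κ z T B) :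
    testIntegral μ c (fun f x => A f x + A' f x) B =ᶠ[testFilter E₁ E₂ κ p₁ p₂ (κ z)]
      fun i => testIntegral μ c A B i + testIntegral μ c A' B i := by
  filter_upwards [eventually_testFilter (Adm.map_left hA.isDO),
    eventually_testFilter (Adm.map_left hA'.isDO), eventually_testFilter (Adm.map_right hB.isDO),
    eventually_testFilter_forall hc] with i h1 h2 h3 h4
  simp only [testIntegral, add_mul, mul_add]
  exact integral_add ((h1 _ _ _ (h3 _ _ _ i.adm)).integrableOn μ h4)
    ((h2 _ _ _ (h3 _ _ _ i.adm)).integrableOn μ h4)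

omit [FiniteDimensional ℂ EZ] [IsManifold 𝓘(ℂ, EZ) ω Z] in
theorem testIntegral_add_right {c : F → ℂ} (hc : Hol c (κ z)) {R T T' : GermOp EZ z}
    {A B B' : (F → ℂ) → F → ℂ} (hA : Rep κ z R A) (hB : Rep κ z T B) (hB' : Rep κ z T' B') :
    testIntegral μ c A (fun f x => B f x + B' f x) =ᶠ[testFilter E₁ E₂ κ p₁ p₂ (κ z)]
      fun i => testIntegral μ c A B i + testIntegral μ c A B' i := by
  filter_upwards [eventually_testFilter (Adm.map_right hB.isDO),
    eventually_testFilter (Adm.map_right hB'.isDO), eventually_testFilter (Adm.map_left hA.isDO),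
    eventually_testFilter_forall hc] with i h1 h2 h3 h4
  simp only [testIntegral, mul_add]
  exact integral_add ((h1 _ _ _ (h3 _ _ _ i.adm)).integrableOn μ h4)
    ((h2 _ _ _ (h3 _ _ _ i.adm)).integrableOn μ h4)

/-- The pairing of pairs of differential operators with test data, with values in germs. -/
theorem exists_pairing (hκ : HolCoord EZ κ z) {c : F → ℂ} (hc : Hol c (κ z)) :
    ∃ Λ : DStalk EZ κ z →ₗ[ℂ] DStalk EZ κ z →ₗ[ℂ] Germ (testFilter E₁ E₂ κ p₁ p₂ (κ z)) ℂ,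
      ∀ (R T : DStalk EZ κ z) (A B : (F → ℂ) → F → ℂ), Rep κ z (R : GermOp EZ z) A →
        Rep κ z (T : GermOp EZ z) B →
        Λ R T = ((testIntegral μ c A B : TestDatum E₁ E₂ κ p₁ p₂ → ℂ) : Germ _ ℂ) := by
  -- The representatives are chosen without any linearity. It is recovered from `key`: the germ of
  -- the integral does not depend on the choice.
  choose rep hrep using fun R : DStalk EZ κ z => exists_rep_of_mem_DStalk hκ R.2
  have key : ∀ (R T : DStalk EZ κ z) (A B : (F → ℂ) → F → ℂ), Rep κ z (R : GermOp EZ z) A →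
      Rep κ z (T : GermOp EZ z) B →
      ((testIntegral μ c (rep R) (rep T) : TestDatum E₁ E₂ κ p₁ p₂ → ℂ) :
        Germ (testFilter E₁ E₂ κ p₁ p₂ (κ z)) ℂ)
        = ((testIntegral μ c A B : TestDatum E₁ E₂ κ p₁ p₂ → ℂ) : Germ _ ℂ) :=
    fun R T A B hA hB => Germ.coe_eq.2 (testIntegral_congr μ hκ (hrep R) hA (hrep T) hB)
  refine ⟨LinearMap.mk₂ ℂ (fun R T => ((testIntegral μ c (rep R) (rep T) :
      TestDatum E₁ E₂ κ p₁ p₂ → ℂ) : Germ (testFilter E₁ E₂ κ p₁ p₂ (κ z)) ℂ))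
      ?_ ?_ ?_ ?_, fun R T A B hA hB => key R T A B hA hB⟩
  · intro R R' T
    rw [key (R + R') T _ _ ((hrep R).add (hrep R')) (hrep T)]
    exact Germ.coe_eq.2 (testIntegral_add_left μ hc (hrep R) (hrep R') (hrep T))
  · intro a R T
    rw [key (a • R) T _ _ ((hrep R).smul a) (hrep T)]
    refine Germ.coe_eq.2 (Eventually.of_forall fun i => ?_)
    simp only [testIntegral, Function.comp_apply, smul_eq_mul]
    rw [← integral_const_mul]
    congr 1
    funext x
    ring
  · intro R T T'
    rw [key R (T + T') _ _ (hrep R) ((hrep T).add (hrep T'))]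
    exact Germ.coe_eq.2 (testIntegral_add_right μ hc (hrep R) (hrep T) (hrep T'))
  · intro a R T
    rw [key R (a • T) _ _ (hrep R) ((hrep T).smul a)]
    refine Germ.coe_eq.2 (Eventually.of_forall fun i => ?_)
    simp only [testIntegral, Function.comp_apply, smul_eq_mul]
    rw [← integral_const_mul]
    congr 1
    funext x
    ring

variable [FiniteDimensional ℂ E₁] [IsManifold 𝓘(ℂ, E₁) ω Y₁]
  [FiniteDimensional ℂ E₂] [IsManifold 𝓘(ℂ, E₂) ω Y₂]

/-- If `[R] ⊗ [T]` vanishes in the kernel module, then its pairing with test data concentrated near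
the point vanishes. -/
theorem testIntegral_eq_zero_of_kernelMk (hκ : HolCoord EZ κ z) {c : F → ℂ} (hc : Hol c (κ z))
    (hp₁ : ∀ᶠ z' in 𝓝 z, MDifferentiableAt 𝓘(ℂ, EZ) 𝓘(ℂ, E₁) p₁ z')
    (hp₂ : ∀ᶠ z' in 𝓝 z, MDifferentiableAt 𝓘(ℂ, EZ) 𝓘(ℂ, E₂) p₂ z')
    {R T : DStalk EZ κ z} (h : kernelMk EZ E₁ E₂ κ p₁ p₂ z R T = 0) {A B : (F → ℂ) → F → ℂ}
    (hA : Rep κ z (R : GermOp EZ z) A) (hB : Rep κ z (T : GermOp EZ z) B) :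
    ∀ᶠ i in testFilter E₁ E₂ κ p₁ p₂ (κ z), testIntegral μ c A B i = 0 := by
  obtain ⟨Λ, hΛ⟩ := exists_pairing (E₁ := E₁) (E₂ := E₂) (p₁ := p₁) (p₂ := p₂) μ hκ hc
  -- The first argument acts on `f₂`, a pullback from `Y₂`, which `D · Θ_{Z/Y₂}` kills; below, `hJ`
  -- is the same for `f₁` and `Y₁`.
  have hI : ∀ r ∈ relIdeal EZ E₂ κ p₂ z, ∀ t, Λ r t = 0 := by
    intro r hr t
    obtain ⟨A, hA⟩ := exists_rep_of_mem_DStalk hκ r.2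
    obtain ⟨B, hB⟩ := exists_rep_of_mem_DStalk hκ t.2
    rw [hΛ r t A B hA hB]
    refine Germ.coe_eq.2 ?_
    filter_upwards [eventually_testFilter_forall
      (hA.eventually_eq_zero_of_mem_relIdeal hκ hp₂ hr)] with i hi
    refine setIntegral_eq_zero_of_forall_eq_zero fun x hx => ?_
    have hxO := i.adm.subset hx
    simp [hi x hxO _ (i.adm.left x hxO) (i.pull₂ x hxO)]
  have hJ : ∀ t ∈ relIdeal EZ E₁ κ p₁ z, ∀ r, Λ r t = 0 := by
    intro t ht r
    obtain ⟨A, hA⟩ := exists_rep_of_mem_DStalk hκ r.2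
    obtain ⟨B, hB⟩ := exists_rep_of_mem_DStalk hκ t.2
    rw [hΛ r t A B hA hB]
    refine Germ.coe_eq.2 ?_
    filter_upwards [eventually_testFilter_forall
      (hB.eventually_eq_zero_of_mem_relIdeal hκ hp₁ ht)] with i hi
    refine setIntegral_eq_zero_of_forall_eq_zero fun x hx => ?_
    have hxO := i.adm.subset hx
    simp [hi x hxO _ (i.adm.right x hxO) (i.pull₁ x hxO)]
  obtain ⟨Λ', hΛ'⟩ := exists_lift_tensor_quotient _ _ Λ hI hJ
  -- The relation `a · Q ⊗ n = a ⊗ Q · n` is the integration by parts which moves `Q` from `f₁` to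
  -- `f₂` as `Qt`.
  have hbal : balanced EZ E₁ E₂ κ p₁ p₂ z ≤ LinearMap.ker Λ' := by
    refine Submodule.span_le.2 ?_
    rintro _ ⟨Q, Qt, R, T, hQ, rfl⟩
    obtain ⟨D, Dt, hD, hDt, hDD⟩ := exists_rep_of_mem_transposePairs μ hκ hQ
    obtain ⟨A, hA⟩ := exists_rep_of_mem_DStalk hκ R.2
    obtain ⟨B, hB⟩ := exists_rep_of_mem_DStalk hκ T.2
    change Λ' _ = 0
    rw [map_sub, hΛ', hΛ', sub_eq_zero, hΛ (Qt * R) T _ _ (hDt.mul hA) hB,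
      hΛ R (Q * T) _ _ hA (hD.mul hB)]
    refine Germ.coe_eq.2 ?_
    filter_upwards [eventually_testFilter hDD.integral_eq,
      eventually_testFilter (Adm.map_left hA.isDO), eventually_testFilter (Adm.map_right hB.isDO),
      eventually_testFilter_forall hc] with i h1 h2 h3 h4
    exact h1 i.K _ _ c (h2 _ _ _ (h3 _ _ _ i.adm)) h4
  have hmem := hbal ((Submodule.Quotient.mk_eq_zero _).1 h)
  rw [LinearMap.mem_ker, hΛ', hΛ R T A B hA hB] at hmem
  exact Germ.coe_eq.1 hmem

end Pairing

/-! ### Frames of line bundles -/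

section Frames

variable {Y : Type*} [TopologicalSpace Y]
  (L : Y → Type*) [TopologicalSpace (TotalSpace ℂ L)] [∀ y, AddCommGroup (L y)]
  [∀ y, Module ℂ (L y)] [∀ y, TopologicalSpace (L y)] [FiberBundle ℂ L] [VectorBundle ℂ ℂ L]
  {L' : Y → Type*} [TopologicalSpace (TotalSpace ℂ L')] [∀ y, AddCommGroup (L' y)]
  [∀ y, Module ℂ (L' y)] [∀ y, TopologicalSpace (L' y)] [FiberBundle ℂ L'] [VectorBundle ℂ ℂ L']

theorem eventually_mem_baseSet (y₀ : Y) : ∀ᶠ y in 𝓝 y₀, y ∈ (trivializationAt ℂ L y₀).baseSet :=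
  (trivializationAt ℂ L y₀).open_baseSet.mem_nhds (mem_baseSet_trivializationAt ℂ L y₀)

variable {L}

theorem fibreCoord_smul_frame {y₀ y : Y} (hy : y ∈ (trivializationAt ℂ L y₀).baseSet) (l : L y) :
    fibreCoord L y₀ y l • frame L y₀ y = l := by
  have h := (trivializationAt ℂ L y₀).symmₗ_linearMapAt (R := ℂ) hy l
  have h1 : frame L y₀ y = (trivializationAt ℂ L y₀).symmₗ ℂ y 1 :=
    ((trivializationAt ℂ L y₀).symmₗ_apply hy 1).symm
  rw [h1, ← map_smul, smul_eq_mul, mul_one]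
  exact h

theorem fibreCoord_frame {y₀ y : Y} (hy : y ∈ (trivializationAt ℂ L y₀).baseSet) :
    fibreCoord L y₀ y (frame L y₀ y) = 1 := by
  have h := (trivializationAt ℂ L y₀).linearMapAt_symmₗ (R := ℂ) hy 1
  rwa [(trivializationAt ℂ L y₀).symmₗ_apply hy 1] at h

/-- Functionals on a line are multiples of the fibre coordinate. -/
theorem dual_eq_smul_fibreCoord {y₀ y : Y} (hy : y ∈ (trivializationAt ℂ L y₀).baseSet)
    (φ : Module.Dual ℂ (L y)) : φ = φ (frame L y₀ y) • fibreCoord L y₀ y := by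
  refine LinearMap.ext fun l => ?_
  conv_lhs => rw [← fibreCoord_smul_frame hy l]
  simp [mul_comm]

/-- With `c = e` the factor is `|c|²`, the source of all densities and Jacobians below. -/
theorem sesq_apply_smul {A B : Type*} [AddCommGroup A] [Module ℂ A] [AddCommGroup B] [Module ℂ B]
    (s : Sesq A B) (c e : ℂ) (φ : Module.Dual ℂ A) (ψ : Module.Dual ℂ B) :
    s (c • φ) (e • ψ) = starRingEnd ℂ e * (c * s φ ψ) := by
  rw [LinearMap.map_smulₛₗ, s.map_smul]
  rfl

/-- An element of `L' ⊗ \bar L` vanishes if its coefficient vanishes. -/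
theorem sesq_eq_zero_of_coeff {y₀ y : Y} (hy : y ∈ (trivializationAt ℂ L y₀).baseSet)
    (hy' : y ∈ (trivializationAt ℂ L' y₀).baseSet) {s : Sesq (L' y) (L y)}
    (h : s (fibreCoord L' y₀ y) (fibreCoord L y₀ y) = 0) : s = 0 := by
  refine LinearMap.ext fun φ => LinearMap.ext fun ψ => ?_
  rw [dual_eq_smul_fibreCoord hy' φ, dual_eq_smul_fibreCoord hy ψ, sesq_apply_smul, h]
  simp

theorem coeff_ofVec_frame {y₀ y : Y} (c : Y → ℂ) (hy : y ∈ (trivializationAt ℂ L y₀).baseSet) :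
    coeff y₀ (fun y => Sesq.ofVec (c y) (frame L y₀ y) (frame L y₀ y)) y = c y := by
  simp [coeff, Sesq.ofVec, fibreCoord_frame hy]

variable {E : Type*} [NormedAddCommGroup E] [NormedSpace ℂ E] [ChartedSpace E Y]

/-- The germ of an operator is unique. -/
theorem HolDiffOp.IsGermAt.unique {P : HolDiffOp E L L'} {y : Y} {G G' : GermOp E y}
    (h : P.IsGermAt y G) (h' : P.IsGermAt y G') : G = G' := by
  refine LinearMap.ext fun u => SmoothGerm.ext_germ ?_
  obtain ⟨f, hf, rfl⟩ := u.exists_rep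
  have hu : (SmoothGerm.mk f hf).germ =
      ((coeff y (fun y' => Sesq.ofVec (f y') (frame L y y') (frame L y y')) : Y → ℂ) :
        Germ (𝓝 y) ℂ) := by
    refine Germ.coe_eq.2 ?_
    filter_upwards [eventually_mem_baseSet L y] with y' hy' using (coeff_ofVec_frame f hy').symm
  rw [h _ _ hu, h' _ _ hu]

end Frames

/-! ### Coordinates of submersion charts -/

section SubmersionCharts

variable {Z Y₁ Y₂ : Type*} [TopologicalSpace Z] [TopologicalSpace Y₁] [TopologicalSpace Y₂]
  {EZ : Type*} [NormedAddCommGroup EZ] [NormedSpace ℂ EZ] [ChartedSpace EZ Z]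
  {E₂ : Type*} [NormedAddCommGroup E₂] [NormedSpace ℂ E₂] [ChartedSpace E₂ Y₂]
  {p₂ : Z → Y₂} {d : ℕ}

theorem holCoord_chartAt [IsManifold 𝓘(ℂ, E₂) ω Y₂] (y : Y₂) : HolCoord E₂ (chartAt E₂ y) y :=
  ⟨mem_chart_source E₂ y, fun _ hy => (mdifferentiableAt_atlas (chart_mem_atlas E₂ _)
    hy).mdifferentiableWithinAt, fun _ hy => (mdifferentiableAt_atlas_symm
      (chart_mem_atlas E₂ _) hy).mdifferentiableWithinAt⟩

namespace SubmersionChart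

variable (Φ : SubmersionChart EZ E₂ p₂ d)

theorem coords_apply (y : Y₂) (z : Z) :
    Φ.coords y z = ((Φ.toFun z).1, chartAt E₂ y (Φ.toFun z).2) := rfl

theorem coords_symm_apply (y : Y₂) (x : (Fin d → ℂ) × E₂) :
    (Φ.coords y).symm x = Φ.invFun (x.1, (chartAt E₂ y).symm x.2) := rfl

theorem mem_coords_source {y : Y₂} {z : Z} :
    z ∈ (Φ.coords y).source ↔ z ∈ Φ.source ∧ p₂ z ∈ (chartAt E₂ y).source := by
  have h : z ∈ (Φ.coords y).source ↔
      z ∈ Φ.source ∧ (Φ.toFun z).2 ∈ (chartAt E₂ y).source := by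
    simp [SubmersionChart.coords]
  rw [h]
  refine and_congr_right fun hz => ?_
  rw [Φ.snd_eq z hz]

theorem mem_coords_target {y : Y₂} {x : (Fin d → ℂ) × E₂} :
    x ∈ (Φ.coords y).target ↔
      x.2 ∈ (chartAt E₂ y).target ∧ (x.1, (chartAt E₂ y).symm x.2) ∈ Φ.target := by
  simp [SubmersionChart.coords]

theorem snd_coords {y : Y₂} {z : Z} (hz : z ∈ Φ.source) :
    (Φ.coords y z).2 = chartAt E₂ y (p₂ z) := by
  rw [coords_apply, Φ.snd_eq z hz]

theorem map_invFun {x : (Fin d → ℂ) × Y₂} (hx : x ∈ Φ.target) : p₂ (Φ.invFun x) = x.2 := by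
  exact (Φ.snd_eq _ (Φ.map_target hx)).symm.trans (congrArg Prod.snd (Φ.right_inv hx))

theorem holCoord [IsManifold 𝓘(ℂ, E₂) ω Y₂] {y : Y₂} {z : Z} (hz : z ∈ Φ.source)
    (hy : p₂ z ∈ (chartAt E₂ y).source) : HolCoord EZ (Φ.coords y) z where
  mem := Φ.mem_coords_source.2 ⟨hz, hy⟩
  hol := by
    intro z' hz'
    obtain ⟨h1, h2⟩ := Φ.mem_coords_source.1 hz'
    have h3 := (Φ.hol z' h1).mdifferentiableAt (Φ.open_source.mem_nhds h1)
    rw [← Φ.snd_eq z' h1] at h2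
    exact (h3.fst.prodMk_space
      ((mdifferentiableAt_atlas (chart_mem_atlas E₂ y) h2).comp z' h3.snd)).mdifferentiableWithinAt
  hol_symm := by
    intro x hx
    obtain ⟨h1, h2⟩ := Φ.mem_coords_target.1 hx
    have h3 := (Φ.hol_symm _ h2).mdifferentiableAt (Φ.open_target.mem_nhds h2)
    have h4 : MDifferentiableAt 𝓘(ℂ, (Fin d → ℂ) × E₂) 𝓘(ℂ, E₂)
        (fun x : (Fin d → ℂ) × E₂ => x.2) x := differentiableAt_snd.mdifferentiableAt
    have h5 : MDifferentiableAt 𝓘(ℂ, (Fin d → ℂ) × E₂) 𝓘(ℂ, Fin d → ℂ)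
        (fun x : (Fin d → ℂ) × E₂ => x.1) x := differentiableAt_fst.mdifferentiableAt
    have h6 := (mdifferentiableAt_atlas_symm (I := 𝓘(ℂ, E₂)) (chart_mem_atlas E₂ y) h1).comp x h4
    exact (h3.comp x (h5.prodMk h6)).mdifferentiableWithinAt

end SubmersionChart

variable {L₁ : Y₁ → Type*} [TopologicalSpace (TotalSpace ℂ L₁)] [∀ y, AddCommGroup (L₁ y)]
  [∀ y, Module ℂ (L₁ y)] [∀ y, TopologicalSpace (L₁ y)] [FiberBundle ℂ L₁] [VectorBundle ℂ ℂ L₁]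
  {L₂ : Y₂ → Type*} [TopologicalSpace (TotalSpace ℂ L₂)] [∀ y, AddCommGroup (L₂ y)]
  [∀ y, Module ℂ (L₂ y)] [∀ y, TopologicalSpace (L₂ y)] [FiberBundle ℂ L₂] [VectorBundle ℂ ℂ L₂]
  {p₁ : Z → Y₁}

/-- The function `c` such that the isomorphism sends `e₁` to `c · e₂ ⊗ dx`. -/
def TwistIso.coef (a : TwistIso EZ E₂ L₁ L₂ p₁ p₂ d) (Φ : SubmersionChart EZ E₂ p₂ d) (y₁ : Y₁)
    (y₂ : Y₂) (z : Z) : ℂ := a.contract Φ y₂ z (frame L₁ y₁ (p₁ z))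

theorem TwistIso.holNear_coef (a : TwistIso EZ E₂ L₁ L₂ p₁ p₂ d) (Φ : SubmersionChart EZ E₂ p₂ d)
    {y₁ : Y₁} {y₂ : Y₂} {z : Z} (hz : z ∈ Φ.source)
    (h₁ : p₁ z ∈ (trivializationAt ℂ L₁ y₁).baseSet)
    (h₂ : p₂ z ∈ (trivializationAt ℂ L₂ y₂).baseSet) (hp₁ : Continuous p₁)
    (hp₂ : Continuous p₂) : HolNear EZ (a.coef Φ y₁ y₂) z := by
  have hopen : IsOpen (Φ.source ∩ p₁ ⁻¹' (trivializationAt ℂ L₁ y₁).baseSet ∩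
        p₂ ⁻¹' (trivializationAt ℂ L₂ y₂).baseSet) :=
    (Φ.open_source.inter ((trivializationAt ℂ L₁ y₁).open_baseSet.preimage hp₁)).inter
      ((trivializationAt ℂ L₂ y₂).open_baseSet.preimage hp₂)
  filter_upwards [hopen.mem_nhds ⟨⟨hz, h₁⟩, h₂⟩] with z' hz'
  exact (a.hol Φ y₁ y₂ z' hz').mdifferentiableAt (hopen.mem_nhds hz')

/-- The density of a section of `|p₁^* L₁|²` in a submersion chart. -/
theorem TwistIso.apply_contract (a : TwistIso EZ E₂ L₁ L₂ p₁ p₂ d)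
    (Φ : SubmersionChart EZ E₂ p₂ d) {y₁ : Y₁} (y₂ : Y₂) {z : Z}
    (h₁ : p₁ z ∈ (trivializationAt ℂ L₁ y₁).baseSet) (s : ∀ y, Sesq (L₁ y) (L₁ y)) :
    s (p₁ z) (a.contract Φ y₂ z) (a.contract Φ y₂ z)
      = starRingEnd ℂ (a.coef Φ y₁ y₂ z) * (a.coef Φ y₁ y₂ z * coeff y₁ s (p₁ z)) := by
  conv_lhs => rw [dual_eq_smul_fibreCoord h₁ (a.contract Φ y₂ z), sesq_apply_smul]
  rfl

end SubmersionCharts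

/-! ### Local vanishing of fibre integrals -/

section ParametricIntegral

variable {A B : Type*} [NormedAddCommGroup A] [NormedSpace ℂ A] [FiniteDimensional ℂ A]
  [MeasurableSpace A] [BorelSpace A] [NormedAddCommGroup B] [NormedSpace ℂ B]

/-- Integrals of smooth functions with compact support depend smoothly on parameters. -/
theorem sm_integral (m : Measure A) [m.IsAddHaarMeasure] {φ : A × B → ℂ} {β : Set B} {k : Set A}
    (hβ : IsOpen β) (hk : IsCompact k) (hφ : ∀ x, ∀ η ∈ β, Sm φ (x, η))
    (h0 : ∀ x, ∀ η ∈ β, x ∉ k → φ (x, η) = 0) {η₀ : B} (hη₀ : η₀ ∈ β) :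
    Sm (fun η => ∫ x, φ (x, η) ∂m) η₀ := by
  have h1 : ContDiffOn ℝ ∞ (↿(fun (η : B) (x : A) => φ (x, η))) (β ×ˢ Set.univ) := by
    rintro ⟨η, x⟩ ⟨hη, -⟩
    have h2 : ContDiffAt ℝ ∞ φ (x, η) := (hφ x η hη).self
    have h3 : ContDiffAt ℝ ∞ (fun q : B × A => (q.2, q.1)) (η, x) :=
      contDiffAt_snd.prodMk contDiffAt_fst
    exact (ContDiffAt.comp (η, x) (g := φ) h2 h3).contDiffWithinAt
  -- The integral over `A` is the convolution of `1` with `φ(·, η)` at the point `0`, up to the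
  -- reflection `x ↦ -x`.
  have h4 := contDiffOn_convolution_right_with_param (μ := m) (n := ⊤) (f := fun _ : A => (1 : ℂ))
    (ContinuousLinearMap.mul ℝ ℂ) hβ hk (fun η x hη hx => h0 x η hη hx)
    (locallyIntegrable_const 1) h1
  filter_upwards [hβ.mem_nhds hη₀] with η hη
  have h5 := (h4.contDiffAt ((hβ.prod isOpen_univ).mem_nhds
    (Set.mk_mem_prod hη (Set.mem_univ (0 : A)))))
  have h6 : ContDiffAt ℝ ∞ (fun η : B => (η, (0 : A))) η := contDiffAt_id.prodMk contDiffAt_const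
  refine (ContDiffAt.comp η h5 h6).congr_of_eventuallyEq (Eventually.of_forall fun η' => ?_)
  simp only [Function.comp, convolution, ContinuousLinearMap.mul_apply', one_mul, zero_sub]
  exact (integral_neg_eq_self (fun x => φ (x, η')) m).symm

/-- If the integral of `φ` over the fibres of `A × B → B` is orthogonal to all `S v`, with `v`
supported near `η₀`, then it is killed by the transpose `G` of `S` near `η₀`. -/
theorem eventually_apply_integral_eq_zero [FiniteDimensional ℂ B] [MeasurableSpace B]
    [BorelSpace B] (m : Measure A) [m.IsAddHaarMeasure] (ν : Measure B) [ν.IsAddHaarMeasure]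
    {φ : A × B → ℂ} {β β₁ : Set B} {K : Set (A × B)} (hβ : IsOpen β) (hK : IsCompact K)
    (hφ : ∀ x, ∀ η ∈ β, Sm φ (x, η)) (h0 : ∀ x, ∀ η ∈ β, (x, η) ∉ K → φ (x, η) = 0)
    {η₀ : B} (hη₀ : η₀ ∈ β) (hβ₁ : β₁ ∈ 𝓝 η₀) {G S : (B → ℂ) → B → ℂ}
    (hGS : TransposedDO ν η₀ G S)
    (hv : ∀ v : B → ℂ, ContDiff ℝ ∞ v → HasCompactSupport v → tsupport v ⊆ β₁ →
      ∫ x in K ∩ Set.univ ×ˢ tsupport v, S v x.2 * φ x ∂(m.prod ν) = 0) :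
    ∀ᶠ η in 𝓝 η₀, G (fun η => ∫ x, φ (x, η) ∂m) η = 0 := by
  have hpA : ProperSpace A := FiniteDimensional.proper ℂ A
  have hpB : ProperSpace B := FiniteDimensional.proper ℂ B
  have hJ : ∀ η ∈ β, Sm (fun η => ∫ x, φ (x, η) ∂m) η := fun η hη =>
    sm_integral m hβ (hK.image continuous_fst) hφ (fun x η hη hx => h0 x η hη fun h =>
      hx ⟨_, h, rfl⟩) hη
  set J : B → ℂ := fun η => ∫ x, φ (x, η) ∂m with hJdef
  obtain ⟨s, hs, hsP⟩ := eventually_smallSets.1 ((hGS.integral_eq.and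
    (Adm.map_left hGS.isDO_transpose)).and (Adm.map_right hGS.isDO))
  let β' : Set B := interior s ∩ β ∩ interior β₁
  have hβ'o : IsOpen β' := (isOpen_interior.inter hβ).inter isOpen_interior
  have hβ'η : β' ∈ 𝓝 η₀ := inter_mem (inter_mem (interior_mem_nhds.2 hs) (hβ.mem_nhds hη₀))
    (interior_mem_nhds.2 hβ₁)
  obtain ⟨⟨hint, hS⟩, hG⟩ := hsP β' fun η hη => interior_subset hη.1.1
  -- The pair `(0, J)` is admissible with empty `K`; it serves only to extract the smoothness of `G
  -- J`.
  have hGJ : ∀ η ∈ β', Sm (G J) η := by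
    have hadm : Adm β' ∅ (fun _ => 0) J :=
      ⟨hβ'o, isCompact_empty, Set.empty_subset _, fun x _ => sm_const 0 x,
        fun x hx => hJ x hx.1.2, fun x _ _ => Or.inl EventuallyEq.rfl⟩
    exact (hG _ _ _ hadm).right
  -- Fundamental lemma of the calculus of variations: `∫ w · G J = ∫ S w · J = 0` for every real
  -- test function `w` supported in `β'`.
  have hae : ∀ᵐ η ∂ν, η ∈ β' → G J η = 0 := by
    refine hβ'o.ae_eq_zero_of_integral_contDiff_smul_eq_zero
      ((Sm.continuousOn hGJ).locallyIntegrableOn hβ'o.measurableSet) ?_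
    intro w hw hwc hwβ
    let v : B → ℂ := fun η => (w η : ℂ)
    have hvs : ContDiff ℝ ∞ v := Complex.ofRealCLM.contDiff.comp hw
    have hsupp : tsupport v = tsupport w := by
      unfold tsupport
      congr 1
      ext η
      simp [v]
    have hK' : IsCompact (tsupport w) := hwc
    have hadm : Adm β' (tsupport w) v J :=
      ⟨hβ'o, hK', hwβ, fun x _ => ContDiff.sm hvs x, fun x hx => hJ x hx.1.2, fun x _ hx =>
        Or.inl (by rw [← hsupp] at hx; exact notMem_tsupport_iff_eventuallyEq.1 hx)⟩
    have h1 := hint _ v J (fun _ => 1) hadm fun x _ => differentiableAt_const 1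
    simp only [map_one, one_mul] at h1
    have h2 : ∫ η, w η • G J η ∂ν = ∫ η in tsupport w, v η * G J η ∂ν := by
      rw [setIntegral_eq_integral_of_forall_compl_eq_zero]
      · rfl
      · intro η hη
        simp [v, image_eq_zero_of_notMem_tsupport hη]
    rw [h2, ← h1]
    have h3 := hv v hvs (by rw [HasCompactSupport, hsupp]; exact hK')
      (by rw [hsupp]; exact fun η hη => interior_subset (hwβ hη).2)
    rw [hsupp] at h3
    have hKv : IsCompact (K ∩ Set.univ ×ˢ tsupport w) :=
      hK.inter_right (isClosed_univ.prod hK'.isClosed)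
    have hSv : ∀ η ∈ β', Sm (S v) η := (hS _ _ _ hadm).left
    have hcont : ContinuousOn (fun x : A × B => S v x.2 * φ x) (K ∩ Set.univ ×ˢ tsupport w) := by
      intro x hx
      have hxβ : x.2 ∈ β' := hwβ hx.2.2
      refine ContinuousAt.continuousWithinAt (ContinuousAt.mul ?_ ?_)
      · exact ContinuousAt.comp (f := fun x : A × B => x.2) (hSv _ hxβ).self.continuousAt
          continuousAt_snd
      · exact (hφ x.1 x.2 hxβ.1.2).self.continuousAt
    -- By Fubini the integral over `K` is `∫ S v · J`, because `φ` vanishes off `K` over `β`.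
    rw [← integral_indicator hKv.measurableSet, integral_prod_symm _
      ((integrable_indicator_iff hKv.measurableSet).2 (hcont.integrableOn_compact hKv))] at h3
    rw [← integral_indicator hK'.measurableSet, ← h3]
    congr 1
    funext η
    by_cases hη : η ∈ tsupport w
    · rw [Set.indicator_of_mem hη, hJdef, ← integral_const_mul]
      congr 1
      funext x
      by_cases hx : (x, η) ∈ K
      · rw [Set.indicator_of_mem (show (x, η) ∈ K ∩ Set.univ ×ˢ tsupport w from
          ⟨hx, Set.mem_univ _, hη⟩)]
      · rw [Set.indicator_of_notMem fun h => hx h.1, h0 x η (hwβ hη).1.2 hx, mul_zero]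
    · rw [Set.indicator_of_notMem hη]
      symm
      convert! integral_zero A ℂ with x
      exact Set.indicator_of_notMem (fun h => hη h.2.2) _
  have hzero : Set.EqOn (G J) (fun _ => 0) β' :=
    Measure.eqOn_open_of_ae_eq ((ae_restrict_iff' hβ'o.measurableSet).2 hae) hβ'o
      (Sm.continuousOn hGJ) continuousOn_const
  exact Filter.eventually_of_mem hβ'η hzero

end ParametricIntegral

/-! ### Annihilation of the fibre integrals in one chart -/

section LocalVanishing

variable {Z Y₁ Y₂ : Type*} [TopologicalSpace Z] [TopologicalSpace Y₁] [TopologicalSpace Y₂]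
  {EZ : Type*} [NormedAddCommGroup EZ] [NormedSpace ℂ EZ] [ChartedSpace EZ Z]
  {E₁ : Type*} [NormedAddCommGroup E₁] [NormedSpace ℂ E₁] [ChartedSpace E₁ Y₁]
  {E₂ : Type*} [NormedAddCommGroup E₂] [NormedSpace ℂ E₂] [ChartedSpace E₂ Y₂]
  {L₁ : Y₁ → Type*} [TopologicalSpace (TotalSpace ℂ L₁)] [∀ y, AddCommGroup (L₁ y)]
  [∀ y, Module ℂ (L₁ y)] [∀ y, TopologicalSpace (L₁ y)] [FiberBundle ℂ L₁] [VectorBundle ℂ ℂ L₁]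
  {L₂ : Y₂ → Type*} [TopologicalSpace (TotalSpace ℂ L₂)] [∀ y, AddCommGroup (L₂ y)]
  [∀ y, Module ℂ (L₂ y)] [∀ y, TopologicalSpace (L₂ y)] [FiberBundle ℂ L₂] [VectorBundle ℂ ℂ L₂]
  {L₂' : Y₂ → Type*} [TopologicalSpace (TotalSpace ℂ L₂')] [∀ y, AddCommGroup (L₂' y)]
  [∀ y, Module ℂ (L₂' y)] [∀ y, TopologicalSpace (L₂' y)] [FiberBundle ℂ L₂']
  [VectorBundle ℂ ℂ L₂']
  {p₁ : Z → Y₁} {p₂ : Z → Y₂} {d : ℕ}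

/-- The density `|c|² · u ∘ p₁` on the domain of a submersion chart. -/
def TwistIso.density (a : TwistIso EZ E₂ L₁ L₂ p₁ p₂ d) (Φ : SubmersionChart EZ E₂ p₂ d) (y₁ : Y₁)
    (y₂ : Y₂) (u : Y₁ → ℂ) (z : Z) : ℂ :=
  starRingEnd ℂ (a.coef Φ y₁ y₂ z) * (a.coef Φ y₁ y₂ z * u (p₁ z))

/-- The integral of the density `|c|² · u ∘ p₁` over the fibres of `p₂` in a submersion chart. -/
def TwistIso.localIntegral (a : TwistIso EZ E₂ L₁ L₂ p₁ p₂ d) (Φ : SubmersionChart EZ E₂ p₂ d)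
    (y₁ : Y₁) (y₂ : Y₂) (u : Y₁ → ℂ) (y : Y₂) : ℂ :=
  ∫ x in {x : Fin d → ℂ | (x, y) ∈ Φ.target}, a.density Φ y₁ y₂ u (Φ.invFun (x, y))

variable [FiniteDimensional ℂ EZ] [IsManifold 𝓘(ℂ, EZ) ω Z]
  [FiniteDimensional ℂ E₁] [IsManifold 𝓘(ℂ, E₁) ω Y₁]
  [FiniteDimensional ℂ E₂] [IsManifold 𝓘(ℂ, E₂) ω Y₂]

/-- A lift of a differential operator acts on pulled back functions at all nearby points. -/
theorem IsLift.eventually_eq {Φ : SubmersionChart EZ E₂ p₂ d} {z : Z} (hz : z ∈ Φ.source)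
    (hp₂ : MDifferentiable 𝓘(ℂ, EZ) 𝓘(ℂ, E₂) p₂) {S : GermOp E₂ (p₂ z)} {T : GermOp EZ z}
    (h : IsLift EZ E₂ p₂ z S T) {A : (E₂ → ℂ) → E₂ → ℂ}
    {B : (((Fin d → ℂ) × E₂) → ℂ) → ((Fin d → ℂ) × E₂) → ℂ}
    (hA : Rep (chartAt E₂ (p₂ z)) (p₂ z) S A) (hB : Rep (Φ.coords (p₂ z)) z T B) :
    ∀ᶠ x in 𝓝 (Φ.coords (p₂ z) z), ∀ v, Sm v x.2 → B (fun x => v x.2) x = A v x.2 := by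
  have hψ := holCoord_chartAt (E₂ := E₂) (p₂ z)
  have hκ := Φ.holCoord hz hψ.mem
  have hx₀ : (Φ.coords (p₂ z) z).2 = chartAt E₂ (p₂ z) (p₂ z) := Φ.snd_coords hz
  let q := ContinuousLinearMap.snd ℂ (Fin d → ℂ) E₂
  have hA' : IsDO (q (Φ.coords (p₂ z) z)) A := by
    change IsDO (Φ.coords (p₂ z) z).2 A
    rw [hx₀]
    exact hA.isDO
  refine (hB.isDO.along_comp q).eventually_eq hA'.along_pullback fun v hv => ?_
  have hvs : SmoothNear E₂ (fun y => v (chartAt E₂ (p₂ z) y)) (p₂ z) :=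
    hψ.smoothNear_comp (ContDiff.sm hv _)
  have hw : SmoothNear EZ (fun z' => v (chartAt E₂ (p₂ z) (p₂ z'))) z :=
    SmoothNear.comp (f := fun y => v (chartAt E₂ (p₂ z) y)) hvs (Eventually.of_forall hp₂)
  have hf : Sm (fun x : (Fin d → ℂ) × E₂ => v x.2) (Φ.coords (p₂ z) z) :=
    (ContDiff.sm hv _).comp (q := q) (Eventually.of_forall fun _ => q.differentiableAt)
  have h1 := h _ _ (SmoothGerm.mk _ hvs) (SmoothGerm.mk _ hw) rfl
    (hA.germ_eq v (ContDiff.sm hv _) (SmoothGerm.mk _ hvs) rfl) rfl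
  have h2 := hB.germ_eq _ hf (SmoothGerm.mk _ hw) (by
    refine Germ.coe_eq.2 ?_
    filter_upwards [Φ.open_source.mem_nhds hz] with z' hz'
    rw [Φ.snd_coords hz'])
  rw [h1] at h2
  refine ((Φ.coords (p₂ z)).eventually_nhds _ hκ.mem).2 ?_
  filter_upwards [Germ.coe_eq.1 h2, Φ.open_source.mem_nhds hz] with z' h3 h4
  change B (fun x => v x.2) _ = A v (Φ.coords (p₂ z) z').2
  rw [Φ.snd_coords h4]
  exact h3.symm

/-- The vanishing of the germ of `P · ψ_Z` at `z`, paired with `v` and `u`, says that the fibre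
integral of `|c|² u ∘ p₁` is orthogonal to all `S v`, where `S` is the transpose of `G`; hence `G`
kills it. The inclusion in `N` makes the part of the density lying over `C` compactly supported in
the coordinate patch. -/
theorem TwistIso.exists_local_annihilation [T2Space Z] [T2Space Y₂]
    (a : TwistIso EZ E₂ L₁ L₂ p₁ p₂ d) (P : HolDiffOp E₂ L₂ L₂')
    (hp₁ : MDifferentiable 𝓘(ℂ, EZ) 𝓘(ℂ, E₁) p₁) (hp₂ : MDifferentiable 𝓘(ℂ, EZ) 𝓘(ℂ, E₂) p₂)
    (hproper : IsProperMap p₂) {y₀ : Y₂} {z : Z} (hz : p₂ z = y₀) (h : a.KillsPsiAt E₁ P z) :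
    ∃ (Φ : SubmersionChart EZ E₂ p₂ d) (N : Set Z) (G : GermOp E₂ y₀), IsOpen N ∧ z ∈ N ∧
      N ⊆ Φ.source ∧ (∀ z' ∈ N, p₁ z' ∈ (trivializationAt ℂ L₁ (p₁ z)).baseSet) ∧
      P.IsGermAt y₀ G ∧
      ∀ (u : Y₁ → ℂ) (C : Set Y₂), (∀ y, SmoothNear E₁ u y) → IsCompact C → C ∈ 𝓝 y₀ →
        C ⊆ (chartAt E₂ y₀).source → p₁ ⁻¹' (tsupport u) ∩ p₂ ⁻¹' C ⊆ N →
        ∃ hJ : SmoothNear E₂ (a.localIntegral Φ (p₁ z) y₀ u) y₀,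
          G (SmoothGerm.mk _ hJ) = 0 := by
  subst hz
  obtain ⟨Φ, hzΦ, G, S, c, T, hG, hGS, hlift, hc, hker⟩ := h
  let y₀ := p₂ z
  let ψ := chartAt E₂ y₀
  let κ := Φ.coords y₀
  have hψ : HolCoord E₂ ψ y₀ := holCoord_chartAt y₀
  have hκ : HolCoord EZ κ z := Φ.holCoord hzΦ hψ.mem
  borelize E₂
  have hpE₂ : ProperSpace E₂ := FiniteDimensional.proper ℂ E₂
  let m : Measure (Fin d → ℂ) := volume
  let ν : Measure E₂ := Measure.addHaar
  let cf : Z → ℂ := a.coef Φ (p₁ z) y₀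
  let W : Set Z := κ.source ∩ p₁ ⁻¹' (trivializationAt ℂ L₁ (p₁ z)).baseSet ∩
    p₂ ⁻¹' (trivializationAt ℂ L₂ y₀).baseSet
  have hWo : IsOpen W := (κ.open_source.inter
    ((trivializationAt ℂ L₁ (p₁ z)).open_baseSet.preimage hp₁.continuous)).inter
      ((trivializationAt ℂ L₂ y₀).open_baseSet.preimage hp₂.continuous)
  have hzW : z ∈ W := ⟨⟨hκ.mem, mem_baseSet_trivializationAt ℂ L₁ _⟩,
    mem_baseSet_trivializationAt ℂ L₂ _⟩
  have hcf : ∀ z' ∈ W, HolNear EZ cf z' := fun z' hz' =>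
    a.holNear_coef Φ (Φ.mem_coords_source.1 hz'.1.1).1 hz'.1.2 hz'.2 hp₁.continuous hp₂.continuous
  obtain ⟨AG, AS, hAG, hAS, hAGS⟩ := exists_rep_of_mem_transposePairs ν hψ hGS
  obtain ⟨AT, hAT⟩ := exists_rep_of_mem_DStalk hκ T.2
  -- The weight `c̄` of the pairing and the factor `c` in `[c T] ⊗ [1]` combine to the density
  -- `|c|²`.
  have htest := testIntegral_eq_zero_of_kernelMk (m.prod ν) hκ
    (hκ.hol_comp_symm (hcf z hzW)) (Eventually.of_forall hp₁) (Eventually.of_forall hp₂) hker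
    ((rep_mul hκ (hcf z hzW) hc).mul hAT) Rep.one
  obtain ⟨s, hs, hsP⟩ := eventually_smallSets.1 ((eventually_comap.1 htest).and
    (eventually_smallSets_forall.2 (hlift.eventually_eq hzΦ hp₂ hAS hAT)))
  let N : Set Z := W ∩ (κ.source ∩ κ ⁻¹' interior s)
  have hNo : IsOpen N := hWo.inter (κ.isOpen_inter_preimage isOpen_interior)
  have hNκ : N ⊆ κ.source := fun z' hz' => hz'.2.1
  refine ⟨Φ, N, G, hNo, ⟨hzW, hκ.mem, mem_interior_iff_mem_nhds.2 hs⟩,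
    fun z' hz' => (Φ.mem_coords_source.1 (hNκ hz')).1, fun z' hz' => hz'.1.1.2, hG, ?_⟩
  intro u C hu hC hCy hCψ hCN
  let K : Set ((Fin d → ℂ) × E₂) := κ '' (p₁ ⁻¹' (tsupport u) ∩ p₂ ⁻¹' C)
  have hK : IsCompact K := by
    refine IsCompact.image_of_continuousOn ?_ (κ.continuousOn.mono (hCN.trans hNκ))
    exact (hproper.isCompact_preimage hC).inter_left
      ((isClosed_tsupport u).preimage hp₁.continuous)
  let β : Set E₂ := ψ '' (interior C)
  have hCi : interior C ⊆ ψ.source := interior_subset.trans hCψ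
  have hβ : IsOpen β := ψ.isOpen_image_of_subset_source isOpen_interior hCi
  have hη₀ : ψ y₀ ∈ β := ⟨y₀, mem_interior_iff_mem_nhds.2 hCy, rfl⟩
  -- The density in coordinates, extended by zero off the chart. Over `β` it vanishes off the
  -- compact set `K ⊆ κ '' N`, so the extension is smooth there.
  let φ : (Fin d → ℂ) × E₂ → ℂ :=
    κ.target.indicator fun x => a.density Φ (p₁ z) y₀ u (κ.symm x)
  have hO : IsOpen (κ '' N) := κ.isOpen_image_of_subset_source hNo hNκ
  have hKO : K ⊆ κ '' N := Set.image_mono hCN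
  -- points over the interior of `C` which are not in `K` are not over the support of `u`
  have hout : ∀ x ∈ κ.target, x.2 ∈ β → x ∉ K → p₁ (κ.symm x) ∉ tsupport u := by
    rintro x hx ⟨y, hy, hyx⟩ hxK hsupp
    refine hxK ⟨κ.symm x, ⟨hsupp, ?_⟩, κ.right_inv hx⟩
    have h1 := Φ.snd_coords (y := y₀) (Φ.mem_coords_source.1 (κ.map_target hx)).1
    have h2 : ψ (p₂ (κ.symm x)) = ψ y := by
      rw [hyx, ← h1]
      exact congrArg Prod.snd (κ.right_inv hx)
    have h3 := ψ.injOn (Φ.mem_coords_source.1 (κ.map_target hx)).2 (hCi hy) h2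
    change p₂ (κ.symm x) ∈ C
    rw [h3]
    exact interior_subset hy
  have hφ0 : ∀ x, ∀ η ∈ β, (x, η) ∉ K → φ (x, η) = 0 := by
    intro x η hη hxK
    by_cases hx : (x, η) ∈ κ.target
    · have h1 := image_eq_zero_of_notMem_tsupport (hout _ hx hη hxK)
      simp only [φ, Set.indicator_of_mem hx, TwistIso.density, h1, mul_zero]
    · exact Set.indicator_of_notMem hx _
  have hφ : ∀ x, ∀ η ∈ β, Sm φ (x, η) := by
    intro x η hη
    by_cases hxK : (x, η) ∈ K
    · obtain ⟨z', hz', hz'x⟩ := hKO hxK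
      have hκz' : HolCoord EZ κ z' := hκ.of_mem (hNκ hz')
      have h1 : Sm (fun x => cf (κ.symm x)) (x, η) := by
        rw [← hz'x]
        exact (hκz'.hol_comp_symm (hcf z' hz'.1)).sm
      have h2 : Sm (fun x => u (p₁ (κ.symm x))) (x, η) := by
        rw [← hz'x]
        exact hκz'.sm_comp_symm (SmoothNear.comp (hu (p₁ z')) (Eventually.of_forall hp₁))
      refine (h1.conj.mul (h1.mul h2)).congr ?_
      have h3 : (x, η) ∈ κ.target := by
        rw [← hz'x]
        exact hκz'.mem_target
      filter_upwards [κ.open_target.mem_nhds h3] with x' hx'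
      simp only [φ]
      rw [Set.indicator_of_mem hx']
      rfl
    · refine (sm_const 0 _).congr ?_
      have h1 : IsOpen ((Set.univ ×ˢ β) ∩ Kᶜ) :=
        (isOpen_univ.prod hβ).inter hK.isClosed.isOpen_compl
      filter_upwards [h1.mem_nhds ⟨⟨Set.mem_univ _, hη⟩, hxK⟩] with x' hx'
      exact (hφ0 x'.1 x'.2 hx'.1.2 hx'.2).symm
  have hJeq : ∀ y ∈ ψ.source, a.localIntegral Φ (p₁ z) y₀ u y = ∫ x, φ (x, ψ y) ∂m := by
    intro y hy
    have h1 : ∀ x : Fin d → ℂ, φ (x, ψ y) = {x : Fin d → ℂ | (x, y) ∈ Φ.target}.indicator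
        (fun x => a.density Φ (p₁ z) y₀ u (Φ.invFun (x, y))) x := by
      intro x
      by_cases hx : (x, y) ∈ Φ.target
      · have h2 : (x, ψ y) ∈ κ.target :=
          Φ.mem_coords_target.2 ⟨ψ.map_source hy, by rwa [ψ.left_inv hy]⟩
        simp only [φ]
        rw [Set.indicator_of_mem h2, Set.indicator_of_mem (by exact hx), Φ.coords_symm_apply]
        simp only
        rw [ψ.left_inv hy]
      · have h2 : (x, ψ y) ∉ κ.target := fun h => hx (by
          have := (Φ.mem_coords_target.1 h).2
          rwa [ψ.left_inv hy] at this)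
        simp only [φ]
        rw [Set.indicator_of_notMem h2, Set.indicator_of_notMem (by exact hx)]
    simp only [h1]
    rw [integral_indicator]
    · rfl
    · exact (Φ.open_target.preimage (by fun_prop : Continuous fun x : Fin d → ℂ =>
        (x, y))).measurableSet
  have hJgerm : a.localIntegral Φ (p₁ z) y₀ u =ᶠ[𝓝 y₀] fun y => ∫ x, φ (x, ψ y) ∂m :=
    Filter.eventually_of_mem (ψ.open_source.mem_nhds hψ.mem) hJeq
  have hJt : Sm (fun η => ∫ x, φ (x, η) ∂m) (ψ y₀) :=
    sm_integral m hβ (hK.image continuous_fst) hφ (fun x η hη hx => hφ0 x η hη fun h =>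
      hx ⟨_, h, rfl⟩) hη₀
  have hJ : SmoothNear E₂ (a.localIntegral Φ (p₁ z) y₀ u) y₀ :=
    SmoothNear.congr (hψ.smoothNear_comp hJt) hJgerm.symm
  refine ⟨hJ, SmoothGerm.ext_germ ?_⟩
  rw [hAG.germ_eq _ hJt (SmoothGerm.mk _ hJ) (Germ.coe_eq.2 hJgerm)]
  suffices h0 : ∀ᶠ η in 𝓝 (ψ y₀), AG (fun η => ∫ x, φ (x, η) ∂m) η = 0 from
    Germ.coe_eq.2 (hψ.tendsto.eventually h0)
  refine eventually_apply_integral_eq_zero m ν hβ hK hφ hφ0 hη₀ (hβ.mem_nhds hη₀) hAGS ?_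
  intro v hv hvc hvβ
  -- Over `β` a point of the patch outside `K` lies off the preimage of `tsupport u`. This gives the
  -- support condition of the test datum.
  let O : Set ((Fin d → ℂ) × E₂) := κ '' N ∩ Set.univ ×ˢ β
  have hOt : ∀ x ∈ O, x ∈ κ.target := by
    rintro _ ⟨⟨z', hz', rfl⟩, -⟩
    exact κ.map_source (hNκ hz')
  have hON : ∀ x ∈ O, κ.symm x ∈ N := by
    rintro _ ⟨⟨z', hz', rfl⟩, -⟩
    rwa [κ.left_inv (hNκ hz')]
  have hOs : O ⊆ s := by
    rintro _ ⟨⟨z', hz', rfl⟩, -⟩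
    exact interior_subset hz'.2.2
  have hOo : IsOpen O := hO.inter (isOpen_univ.prod hβ)
  have hpull₁ : ∀ x ∈ O, Sm (fun x => u (p₁ (κ.symm x))) x := by
    intro x hx
    have h1 := (hκ.of_mem (hNκ (hON x hx))).sm_comp_symm
      (SmoothNear.comp (hu (p₁ (κ.symm x))) (Eventually.of_forall hp₁))
    rwa [κ.right_inv (hOt x hx)] at h1
  let q := ContinuousLinearMap.snd ℂ (Fin d → ℂ) E₂
  let i : TestDatum E₁ E₂ κ p₁ p₂ :=
    { O := O
      K := K ∩ Set.univ ×ˢ tsupport v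
      f₂ := fun x => v x.2
      f₁ := fun x => u (p₁ (κ.symm x))
      adm :=
        { isOpen := hOo
          isCompact := hK.inter_right (isClosed_univ.prod (isClosed_tsupport v))
          subset := fun x hx => ⟨hKO hx.1, Set.mem_univ _, hvβ hx.2.2⟩
          left := fun x _ => (ContDiff.sm hv (q x)).comp (q := q)
            (Eventually.of_forall fun _ => q.differentiableAt)
          right := hpull₁
          supp := by
            intro x hx hxK
            by_cases hxv : x.2 ∈ tsupport v
            · have h1 : p₁ (κ.symm x) ∉ tsupport u :=
                hout x (hOt x hx) hx.2.2 fun h => hxK ⟨h, Set.mem_univ _, hxv⟩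
              exact Or.inr ((hp₁.continuous.continuousAt.comp
                (κ.continuousAt_symm (hOt x hx))).eventually
                  (notMem_tsupport_iff_eventuallyEq.1 h1))
            · exact Or.inl ((continuous_snd.tendsto x).eventually
                (notMem_tsupport_iff_eventuallyEq.1 hxv)) }
      pull₂ := by
        intro x hx
        have h1 : κ.symm x ∈ κ.source := hNκ (hON x hx)
        refine ⟨fun y => v (ψ y), (hψ.of_mem (Φ.mem_coords_source.1 h1).2).smoothNear_comp
          (ContDiff.sm hv _), ?_⟩
        filter_upwards [hOo.mem_nhds hx] with x' hx'
        have h2 := Φ.snd_coords (y := y₀) (Φ.mem_coords_source.1 (hNκ (hON x' hx'))).1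
        rw [← h2]
        exact congrArg (fun x : (Fin d → ℂ) × E₂ => v x.2) (κ.right_inv (hOt x' hx')).symm
      pull₁ := fun x _ => ⟨u, hu _, EventuallyEq.rfl⟩ }
  -- `h1` is the vanishing of the pairing for data with open set `O`; `h2` is the lifting identity
  -- `T (v ∘ p₂) = (S v) ∘ p₂`, uniform on `O`.
  obtain ⟨h1, h2⟩ := hsP O hOs
  have h3 := h1 i rfl
  rw [← h3]
  refine setIntegral_congr_fun i.adm.isCompact.measurableSet fun x hx => ?_
  have hxO : x ∈ O := i.adm.subset hx
  have h4 := h2 x hxO v (ContDiff.sm hv _)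
  have h5 : φ x = _ := Set.indicator_of_mem (hOt x hxO) _
  simp only [i, h5, h4, TwistIso.density]
  change _ * (starRingEnd ℂ (cf (κ.symm x)) * (cf (κ.symm x) * _))
    = starRingEnd ℂ (cf (κ.symm x)) * (cf (κ.symm x) * _ * _)
  ring

end LocalVanishing

/-! ### Independence of fibre integrals of charts and partitions -/

section FibreIntegral

variable {Z Y₁ Y₂ : Type*} [TopologicalSpace Z] [TopologicalSpace Y₁] [TopologicalSpace Y₂]
  {EZ : Type*} [NormedAddCommGroup EZ] [NormedSpace ℂ EZ] [ChartedSpace EZ Z]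
  {E₁ : Type*} [NormedAddCommGroup E₁] [NormedSpace ℂ E₁] [ChartedSpace E₁ Y₁]
  {E₂ : Type*} [NormedAddCommGroup E₂] [NormedSpace ℂ E₂] [ChartedSpace E₂ Y₂]
  {L₁ : Y₁ → Type*} [TopologicalSpace (TotalSpace ℂ L₁)] [∀ y, AddCommGroup (L₁ y)]
  [∀ y, Module ℂ (L₁ y)] [∀ y, TopologicalSpace (L₁ y)] [FiberBundle ℂ L₁] [VectorBundle ℂ ℂ L₁]
  {L₂ : Y₂ → Type*} [TopologicalSpace (TotalSpace ℂ L₂)] [∀ y, AddCommGroup (L₂ y)]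
  [∀ y, Module ℂ (L₂ y)] [∀ y, TopologicalSpace (L₂ y)] [FiberBundle ℂ L₂] [VectorBundle ℂ ℂ L₂]
  {p₁ : Z → Y₁} {p₂ : Z → Y₂} {d : ℕ}

namespace SubmersionChart

variable (Φ Φ' : SubmersionChart EZ E₂ p₂ d)

/-- The relative coordinates of a submersion chart. -/
def fibreMap (z : Z) : Fin d → ℂ := (Φ.toFun z).1

theorem mdifferentiableAt_fibreMap {z : Z} (hz : z ∈ Φ.source) :
    MDifferentiableAt 𝓘(ℂ, EZ) 𝓘(ℂ, Fin d → ℂ) Φ.fibreMap z :=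
  ((Φ.hol z hz).mdifferentiableAt (Φ.open_source.mem_nhds hz)).fst

theorem invFun_fibreMap {z : Z} (hz : z ∈ Φ.source) : Φ.invFun (Φ.fibreMap z, p₂ z) = z := by
  rw [← Φ.snd_eq z hz]
  exact Φ.left_inv hz

theorem mem_target_fibreMap {z : Z} (hz : z ∈ Φ.source) : (Φ.fibreMap z, p₂ z) ∈ Φ.target := by
  rw [← Φ.snd_eq z hz]
  exact Φ.map_source hz

theorem fibreMap_invFun {x : (Fin d → ℂ) × Y₂} (hx : x ∈ Φ.target) :
    Φ.fibreMap (Φ.invFun x) = x.1 := congrArg Prod.fst (Φ.right_inv hx)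

theorem isOpen_slice (y : Y₂) : IsOpen {x : Fin d → ℂ | (x, y) ∈ Φ.target} :=
  Φ.open_target.preimage (Continuous.prodMk_left y)

theorem mdifferentiableAt_slice {x : Fin d → ℂ} {y : Y₂} (hx : (x, y) ∈ Φ.target) :
    MDifferentiableAt 𝓘(ℂ, Fin d → ℂ) 𝓘(ℂ, EZ) (fun x => Φ.invFun (x, y)) x := by
  have h := (Φ.hol_symm _ hx).mdifferentiableAt (Φ.open_target.mem_nhds hx)
  exact h.comp x (mdifferentiableAt_id.prodMk mdifferentiableAt_const)

variable {Φ}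

/-- A vertical tangent vector is determined by its relative coordinates. -/
theorem vertSpace_ext [IsManifold 𝓘(ℂ, E₂) ω Y₂]
    (hp₂ : MDifferentiable 𝓘(ℂ, EZ) 𝓘(ℂ, E₂) p₂) {z : Z} (hz : z ∈ Φ.source)
    {v w : VertSpace EZ E₂ p₂ z}
    (h : mfderiv 𝓘(ℂ, EZ) 𝓘(ℂ, Fin d → ℂ) Φ.fibreMap z (v : TangentSpace 𝓘(ℂ, EZ) z)
      = mfderiv 𝓘(ℂ, EZ) 𝓘(ℂ, Fin d → ℂ) Φ.fibreMap z (w : TangentSpace 𝓘(ℂ, EZ) z)) :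
    v = w := by
  let ψ := chartAt E₂ (p₂ z)
  let κ := Φ.coords (p₂ z)
  have hκ : HolCoord EZ κ z := Φ.holCoord hz (mem_chart_source E₂ _)
  have hψ : MDifferentiableAt 𝓘(ℂ, E₂) 𝓘(ℂ, E₂) ψ (p₂ z) :=
    mdifferentiableAt_atlas (chart_mem_atlas E₂ _) (mem_chart_source E₂ _)
  have h1 : HasMFDerivAt 𝓘(ℂ, EZ) 𝓘(ℂ, (Fin d → ℂ) × E₂) κ z
      ((mfderiv 𝓘(ℂ, EZ) 𝓘(ℂ, Fin d → ℂ) Φ.fibreMap z).prod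
        ((mfderiv 𝓘(ℂ, E₂) 𝓘(ℂ, E₂) ψ (p₂ z)).comp (mfderiv 𝓘(ℂ, EZ) 𝓘(ℂ, E₂) p₂ z))) := by
    have h2 := (Φ.mdifferentiableAt_fibreMap hz).hasMFDerivAt
    have h3 := hψ.hasMFDerivAt.comp z (hp₂ z).hasMFDerivAt
    have h4 : HasMFDerivAt 𝓘(ℂ, EZ) 𝓘(ℂ, (Fin d → ℂ) × E₂)
      (fun z' => (Φ.fibreMap z', (ψ ∘ p₂) z')) z _ := ⟨h2.1.prodMk h3.1, h2.2.prodMk h3.2⟩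
    refine h4.congr_of_eventuallyEq ?_
    filter_upwards [Φ.open_source.mem_nhds hz] with z' hz'
    change Φ.coords (p₂ z) z' = _
    rw [coords_apply, Φ.snd_eq z' hz']
    rfl
  have h3 : MDifferentiableAt 𝓘(ℂ, (Fin d → ℂ) × E₂) 𝓘(ℂ, EZ) κ.symm (κ z) :=
    (hκ.hol_symm _ hκ.mem_target).mdifferentiableAt (κ.open_target.mem_nhds hκ.mem_target)
  have h4 := h3.hasMFDerivAt.comp z h1
  have h5 : HasMFDerivAt 𝓘(ℂ, EZ) 𝓘(ℂ, EZ) (κ.symm ∘ κ) z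
      (ContinuousLinearMap.id ℂ (TangentSpace 𝓘(ℂ, EZ) z)) := by
    refine (hasMFDerivAt_id z).congr_of_eventuallyEq ?_
    filter_upwards [κ.open_source.mem_nhds hκ.mem] with z' hz' using κ.left_inv hz'
  have h6 := hasMFDerivAt_unique h4 h5
  have hv : mfderiv 𝓘(ℂ, EZ) 𝓘(ℂ, E₂) p₂ z (v : TangentSpace 𝓘(ℂ, EZ) z) = 0 := v.2
  have hw : mfderiv 𝓘(ℂ, EZ) 𝓘(ℂ, E₂) p₂ z (w : TangentSpace 𝓘(ℂ, EZ) z) = 0 := w.2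
  have h7 : ∀ q : TangentSpace 𝓘(ℂ, EZ) z, mfderiv 𝓘(ℂ, (Fin d → ℂ) × E₂) 𝓘(ℂ, EZ) κ.symm (κ z)
      (((mfderiv 𝓘(ℂ, EZ) 𝓘(ℂ, Fin d → ℂ) Φ.fibreMap z q : Fin d → ℂ),
        (mfderiv 𝓘(ℂ, E₂) 𝓘(ℂ, E₂) ψ (p₂ z) (mfderiv 𝓘(ℂ, EZ) 𝓘(ℂ, E₂) p₂ z q) : E₂)) :
          (Fin d → ℂ) × E₂) = q := fun q => DFunLike.congr_fun h6 q
  refine Subtype.ext ?_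
  rw [← h7 v, ← h7 w, h, hv, hw]

/-- The derivative of the parametrisation of a fibre by a submersion chart. -/
theorem vertFrame_eq [IsManifold 𝓘(ℂ, E₂) ω Y₂]
    (hp₂ : MDifferentiable 𝓘(ℂ, EZ) 𝓘(ℂ, E₂) p₂) {x : Fin d → ℂ} {y : Y₂}
    (hx : (x, y) ∈ Φ.target) (i : Fin d) :
    mfderiv 𝓘(ℂ, Fin d → ℂ) 𝓘(ℂ, EZ) (fun x => Φ.invFun (x, y)) x (Pi.single i 1 : Fin d → ℂ)
        = (Φ.vertFrame (Φ.invFun (x, y)) i : TangentSpace 𝓘(ℂ, EZ) (Φ.invFun (x, y))) ∧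
    mfderiv 𝓘(ℂ, EZ) 𝓘(ℂ, Fin d → ℂ) Φ.fibreMap (Φ.invFun (x, y))
      (Φ.vertFrame (Φ.invFun (x, y)) i : TangentSpace 𝓘(ℂ, EZ) (Φ.invFun (x, y)))
        = (Pi.single i 1 : Fin d → ℂ) := by
  have hz : Φ.invFun (x, y) ∈ Φ.source := Φ.map_target hx
  have hnear : ∀ᶠ x' in 𝓝 x, (x', y) ∈ Φ.target := (Φ.isOpen_slice y).mem_nhds hx
  have h0 := (Φ.mdifferentiableAt_slice hx).hasMFDerivAt
  have h1 : mfderiv 𝓘(ℂ, EZ) 𝓘(ℂ, Fin d → ℂ) Φ.fibreMap (Φ.invFun (x, y))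
      (mfderiv 𝓘(ℂ, Fin d → ℂ) 𝓘(ℂ, EZ) (fun x => Φ.invFun (x, y)) x
        (Pi.single i 1 : Fin d → ℂ)) = (Pi.single i 1 : Fin d → ℂ) := by
    have h2 := (Φ.mdifferentiableAt_fibreMap hz).hasMFDerivAt.comp x h0
    have h3 : HasMFDerivAt 𝓘(ℂ, Fin d → ℂ) 𝓘(ℂ, Fin d → ℂ)
        (Φ.fibreMap ∘ fun x => Φ.invFun (x, y)) x
        (ContinuousLinearMap.id ℂ (Fin d → ℂ)) := by
      refine (hasMFDerivAt_id x).congr_of_eventuallyEq ?_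
      filter_upwards [hnear] with x' hx' using Φ.fibreMap_invFun hx'
    exact DFunLike.congr_fun (hasMFDerivAt_unique h2 h3) (Pi.single i 1 : Fin d → ℂ)
  have h4 : mfderiv 𝓘(ℂ, EZ) 𝓘(ℂ, E₂) p₂ (Φ.invFun (x, y))
      (mfderiv 𝓘(ℂ, Fin d → ℂ) 𝓘(ℂ, EZ) (fun x => Φ.invFun (x, y)) x
        (Pi.single i 1 : Fin d → ℂ)) = 0 := by
    have h2 := (hp₂ (Φ.invFun (x, y))).hasMFDerivAt.comp x h0
    have h3 : HasMFDerivAt 𝓘(ℂ, Fin d → ℂ) 𝓘(ℂ, E₂) (p₂ ∘ fun x => Φ.invFun (x, y)) x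
        (0 : (Fin d → ℂ) →L[ℂ] E₂) := by
      refine (hasMFDerivAt_const y x).congr_of_eventuallyEq ?_
      filter_upwards [hnear] with x' hx' using Φ.map_invFun hx'
    exact DFunLike.congr_fun (hasMFDerivAt_unique h2 h3) (Pi.single i 1 : Fin d → ℂ)
  -- The velocity of the slice is vertical and has the required relative coordinates. So the choice
  -- in `vertFrame` is not vacuous, and `vertSpace_ext` identifies it with this velocity.
  let v : VertSpace EZ E₂ p₂ (Φ.invFun (x, y)) := ⟨_, h4⟩
  have h5 : mfderiv 𝓘(ℂ, EZ) 𝓘(ℂ, Fin d → ℂ) Φ.fibreMap (Φ.invFun (x, y))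
      (Φ.vertFrame (Φ.invFun (x, y)) i : TangentSpace 𝓘(ℂ, EZ) (Φ.invFun (x, y)))
        = (Pi.single i 1 : Fin d → ℂ) :=
    Classical.epsilon_spec (p := fun v : VertSpace EZ E₂ p₂ (Φ.invFun (x, y)) =>
      mfderiv 𝓘(ℂ, EZ) 𝓘(ℂ, Fin d → ℂ) (fun z' => (Φ.toFun z').1) (Φ.invFun (x, y))
      (v : TangentSpace 𝓘(ℂ, EZ) (Φ.invFun (x, y))) = (Pi.single i 1 : Fin d → ℂ)) ⟨v, h1⟩
  exact ⟨congrArg Subtype.val (vertSpace_ext (v := v) hp₂ hz (h1.trans h5.symm)), h5⟩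

end SubmersionChart

variable [IsManifold 𝓘(ℂ, E₂) ω Y₂]

theorem SubmersionChart.mfderiv_vertFrame {Φ : SubmersionChart EZ E₂ p₂ d}
    (hp₂ : MDifferentiable 𝓘(ℂ, EZ) 𝓘(ℂ, E₂) p₂) {z : Z} (hz : z ∈ Φ.source) (i : Fin d) :
    mfderiv 𝓘(ℂ, EZ) 𝓘(ℂ, Fin d → ℂ) Φ.fibreMap z (Φ.vertFrame z i : TangentSpace 𝓘(ℂ, EZ) z)
      = (Pi.single i 1 : Fin d → ℂ) := by
  have h := (SubmersionChart.vertFrame_eq hp₂ (Φ.mem_target_fibreMap hz) i).2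
  rwa [Φ.invFun_fibreMap hz] at h

/-- The vertical frame of a submersion chart, as a basis of the relative tangent space. -/
theorem SubmersionChart.exists_basis {Φ : SubmersionChart EZ E₂ p₂ d}
    (hp₂ : MDifferentiable 𝓘(ℂ, EZ) 𝓘(ℂ, E₂) p₂) {z : Z} (hz : z ∈ Φ.source) :
    ∃ b : Module.Basis (Fin d) ℂ (VertSpace EZ E₂ p₂ z), ⇑b = Φ.vertFrame z ∧
      ∀ v i, b.repr v i = (mfderiv 𝓘(ℂ, EZ) 𝓘(ℂ, Fin d → ℂ) Φ.fibreMap z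
        (v : TangentSpace 𝓘(ℂ, EZ) z) : Fin d → ℂ) i := by
  let B : VertSpace EZ E₂ p₂ z →ₗ[ℂ] (Fin d → ℂ) :=
    (mfderiv 𝓘(ℂ, EZ) 𝓘(ℂ, Fin d → ℂ) Φ.fibreMap z).toLinearMap ∘ₗ Submodule.subtype _
  have hB : ∀ i, B (Φ.vertFrame z i) = Pi.single i 1 := Φ.mfderiv_vertFrame hp₂ hz
  have hinj : Function.Injective B := fun v w h => SubmersionChart.vertSpace_ext hp₂ hz h
  have hsurj : Function.Surjective B := fun w => ⟨∑ i, w i • Φ.vertFrame z i, by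
    rw [map_sum]
    simp only [map_smul, hB]
    exact (pi_eq_sum_univ' w).symm⟩
  let e := LinearEquiv.ofBijective B ⟨hinj, hsurj⟩
  refine ⟨Module.Basis.ofEquivFun e, funext fun i => hinj ?_, fun v i => ?_⟩
  · rw [hB, Module.Basis.coe_ofEquivFun]
    exact e.apply_symm_apply _
  · rw [Module.Basis.ofEquivFun_repr_apply]
    rfl

/-- Contractions with the frames of two submersion charts differ by the Jacobian determinant. -/
theorem TwistIso.contract_eq_det_smul (a : TwistIso EZ E₂ L₁ L₂ p₁ p₂ d)
    (hp₂ : MDifferentiable 𝓘(ℂ, EZ) 𝓘(ℂ, E₂) p₂) {Φ Φ' : SubmersionChart EZ E₂ p₂ d}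
    {x : Fin d → ℂ} {y : Y₂} (hx : (x, y) ∈ Φ.target) (hx' : Φ.invFun (x, y) ∈ Φ'.source) :
    ∃ A : (Fin d → ℂ) →L[ℂ] (Fin d → ℂ),
      HasFDerivAt (fun x => Φ'.fibreMap (Φ.invFun (x, y))) A x ∧
      ∀ y₂, a.contract Φ y₂ (Φ.invFun (x, y))
        = LinearMap.det A.toLinearMap • a.contract Φ' y₂ (Φ.invFun (x, y)) := by
  let z := Φ.invFun (x, y)
  have h1 := (Φ'.mdifferentiableAt_fibreMap hx').hasMFDerivAt.comp x
    (Φ.mdifferentiableAt_slice hx).hasMFDerivAt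
  let A : (Fin d → ℂ) →L[ℂ] (Fin d → ℂ) :=
    (mfderiv 𝓘(ℂ, EZ) 𝓘(ℂ, Fin d → ℂ) Φ'.fibreMap z).comp
      (mfderiv 𝓘(ℂ, Fin d → ℂ) 𝓘(ℂ, EZ) (fun x => Φ.invFun (x, y)) x)
  refine ⟨A, h1.hasFDerivAt, fun y₂ => LinearMap.ext fun l => ?_⟩
  obtain ⟨b, hb, hrepr⟩ := SubmersionChart.exists_basis hp₂ hx'
  -- A form of top degree is its value on a basis times the determinant in that basis. The matrix of
  -- one vertical frame in the other is the Jacobian of the transition map.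
  let f : VertSpace EZ E₂ p₂ z [⋀^Fin d]→ₗ[ℂ] ℂ :=
    (fibreCoord L₂ y₂ (p₂ z)).compAlternatingMap (a.iso z l)
  have h2 := DFunLike.congr_fun (f.eq_smul_basis_det b) (Φ.vertFrame z)
  have h3 : b.det (Φ.vertFrame z) = LinearMap.det A.toLinearMap := by
    rw [Module.Basis.det_apply, ← LinearMap.det_toMatrix']
    congr 1
    ext i j
    rw [Module.Basis.toMatrix_apply, hrepr, LinearMap.toMatrix'_apply,
      ← (SubmersionChart.vertFrame_eq hp₂ hx j).1]
    rfl
  change f (Φ.vertFrame z) = LinearMap.det A.toLinearMap * f (Φ'.vertFrame z)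
  rw [h2, AlternatingMap.smul_apply, h3, hb, smul_eq_mul, mul_comm]

/-- The integral of the section `w · g` of `|p₁^* L₁|²` over the part of the fibre over `y` which
lies in the domain of a submersion chart. -/
def TwistIso.sliceIntegral (a : TwistIso EZ E₂ L₁ L₂ p₁ p₂ d)
    (g : ∀ z, Sesq (L₁ (p₁ z)) (L₁ (p₁ z))) (Φ : SubmersionChart EZ E₂ p₂ d) (y : Y₂)
    (w : Z → ℂ) : ℂ :=
  ∫ x in {x : Fin d → ℂ | (x, y) ∈ Φ.target}, w (Φ.invFun (x, y)) *
    g (Φ.invFun (x, y)) (a.contract Φ y (Φ.invFun (x, y))) (a.contract Φ y (Φ.invFun (x, y)))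

/-- The norm of `ℂ` over `ℝ` is `|·|²`. So the real Jacobian in the change of variables is precisely
the factor by which the two contractions change a section of `|L₁|²`. -/
theorem abs_det_restrictScalars {A : (Fin d → ℂ) →L[ℂ] (Fin d → ℂ)} :
    |(A.restrictScalars ℝ).det| = Complex.normSq (LinearMap.det A.toLinearMap) := by
  have h := LinearMap.det_restrictScalars (R := ℝ) (S := ℂ) (f := A.toLinearMap)
  have h1 : (A.restrictScalars ℝ).det = Complex.normSq (LinearMap.det A.toLinearMap) := by
    rw [ContinuousLinearMap.det, ContinuousLinearMap.coe_restrictScalars, h,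
      Algebra.norm_complex_apply]
  rw [h1, abs_of_nonneg (Complex.normSq_nonneg _)]

/-- Integrals over fibres do not depend on the submersion chart. -/
theorem TwistIso.sliceIntegral_congr_chart (a : TwistIso EZ E₂ L₁ L₂ p₁ p₂ d)
    (hp₂ : MDifferentiable 𝓘(ℂ, EZ) 𝓘(ℂ, E₂) p₂) (g : ∀ z, Sesq (L₁ (p₁ z)) (L₁ (p₁ z)))
    (Φ Φ' : SubmersionChart EZ E₂ p₂ d) (y : Y₂) {w : Z → ℂ}
    (hw : ∀ z, w z ≠ 0 → z ∈ Φ.source) (hw' : ∀ z, w z ≠ 0 → z ∈ Φ'.source) :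
    a.sliceIntegral g Φ y w = a.sliceIntegral g Φ' y w := by
  have hcont : ∀ (Φ Φ' : SubmersionChart EZ E₂ p₂ d),
      IsOpen {x : Fin d → ℂ | (x, y) ∈ Φ.target ∧ Φ.invFun (x, y) ∈ Φ'.source} := by
    intro Φ Φ'
    have h := Φ.toOpenPartialHomeomorph.symm.isOpen_inter_preimage Φ'.open_source
    exact h.preimage (Continuous.prodMk_left y)
  have hred : ∀ (Φ Φ' : SubmersionChart EZ E₂ p₂ d), (∀ z, w z ≠ 0 → z ∈ Φ'.source) →
      a.sliceIntegral g Φ y w =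
        ∫ x in {x : Fin d → ℂ | (x, y) ∈ Φ.target ∧ Φ.invFun (x, y) ∈ Φ'.source},
          w (Φ.invFun (x, y)) * g (Φ.invFun (x, y)) (a.contract Φ y (Φ.invFun (x, y)))
            (a.contract Φ y (Φ.invFun (x, y))) := by
    intro Φ Φ' h
    refine (setIntegral_eq_of_subset_of_forall_sdiff_eq_zero (Φ.isOpen_slice y).measurableSet
      (fun x hx => hx.1) fun x hx => ?_)
    have h1 : w (Φ.invFun (x, y)) = 0 := by
      by_contra hne
      exact hx.2 ⟨hx.1, h _ hne⟩
    rw [h1, zero_mul]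
  rw [hred Φ Φ' hw', hred Φ' Φ hw]
  -- The transition map between the two parametrisations of the fibre over `y`.
  let τ : (Fin d → ℂ) → (Fin d → ℂ) := fun x => Φ'.fibreMap (Φ.invFun (x, y))
  have hτ : ∀ x, (x, y) ∈ Φ.target → Φ.invFun (x, y) ∈ Φ'.source →
      (τ x, y) ∈ Φ'.target ∧ Φ'.invFun (τ x, y) = Φ.invFun (x, y) := by
    intro x hx hx'
    have h1 := Φ'.mem_target_fibreMap hx'
    have h2 := Φ'.invFun_fibreMap hx'
    rw [Φ.map_invFun hx] at h1 h2
    exact ⟨h1, h2⟩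
  have himage : {x : Fin d → ℂ | (x, y) ∈ Φ'.target ∧ Φ'.invFun (x, y) ∈ Φ.source}
      = τ '' {x : Fin d → ℂ | (x, y) ∈ Φ.target ∧ Φ.invFun (x, y) ∈ Φ'.source} := by
    ext x
    constructor
    · rintro ⟨hx, hx'⟩
      have h1 := Φ.mem_target_fibreMap hx'
      have h2 := Φ.invFun_fibreMap hx'
      rw [Φ'.map_invFun hx] at h1 h2
      refine ⟨Φ.fibreMap (Φ'.invFun (x, y)), ⟨h1, ?_⟩, ?_⟩
      · rw [h2]
        exact Φ'.map_target hx
      · simp only [τ]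
        rw [h2, Φ'.fibreMap_invFun hx]
    · rintro ⟨x, ⟨hx, hx'⟩, rfl⟩
      obtain ⟨h1, h2⟩ := hτ x hx hx'
      refine ⟨h1, ?_⟩
      rw [h2]
      exact Φ.map_target hx
  have hinj : Set.InjOn τ
      {x : Fin d → ℂ | (x, y) ∈ Φ.target ∧ Φ.invFun (x, y) ∈ Φ'.source} := by
    rintro x ⟨hx, hx'⟩ x' ⟨hx2, hx2'⟩ h
    have h1 := (hτ x hx hx').2
    rw [h, (hτ x' hx2 hx2').2] at h1
    exact (congrArg Prod.fst (Φ.toOpenPartialHomeomorph.symm.injOn hx2 hx h1)).symm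
  choose! A hA hcon using fun x (hx : (x, y) ∈ Φ.target ∧ Φ.invFun (x, y) ∈ Φ'.source) =>
    a.contract_eq_det_smul hp₂ hx.1 hx.2
  rw [himage, integral_image_eq_integral_abs_det_fderiv_smul volume (hcont Φ Φ').measurableSet
    (f' := fun x => (A x).restrictScalars ℝ)
    (fun x hx => ((hA x hx).restrictScalars ℝ).hasFDerivWithinAt) hinj]
  refine setIntegral_congr_fun (hcont Φ Φ').measurableSet fun x hx => ?_
  rw [abs_det_restrictScalars, (hτ x hx.1 hx.2).2, hcon x hx y, sesq_apply_smul,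
    Complex.real_smul, Complex.normSq_eq_conj_mul_self]
  ring

/-- Sections of `p₁⁻¹(C^∞_{|L₁|²})` have continuous densities in submersion charts. -/
theorem TwistIso.continuousAt_density (a : TwistIso EZ E₂ L₁ L₂ p₁ p₂ d) (hp₁ : Continuous p₁)
    (hp₂ : Continuous p₂) {V : Set Y₂} {g : ∀ z, Sesq (L₁ (p₁ z)) (L₁ (p₁ z))}
    (hg : IsPullbackSection E₁ p₁ p₂ V g) (Φ : SubmersionChart EZ E₂ p₂ d) {z : Z}
    (hz : z ∈ Φ.source) (hV : p₂ z ∈ V) :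
    ContinuousAt (fun z' => g z' (a.contract Φ (p₂ z) z') (a.contract Φ (p₂ z) z')) z := by
  obtain ⟨s, hs, hgs⟩ := hg z hV
  have h1 : ContinuousAt (coeff (p₁ z) s) (p₁ z) := hs.self_of_nhds.continuousAt
  have h2 : ContinuousAt (a.coef Φ (p₁ z) (p₂ z)) z :=
    (a.holNear_coef Φ hz (mem_baseSet_trivializationAt ℂ L₁ _)
      (mem_baseSet_trivializationAt ℂ L₂ _) hp₁ hp₂).self_of_nhds.continuousAt
  have h3 : ContinuousAt (fun z' => starRingEnd ℂ (a.coef Φ (p₁ z) (p₂ z) z') *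
      (a.coef Φ (p₁ z) (p₂ z) z' * coeff (p₁ z) s (p₁ z'))) z :=
    (Complex.continuous_conj.continuousAt.comp h2).mul
      (h2.mul (ContinuousAt.comp (g := coeff (p₁ z) s) h1 hp₁.continuousAt))
  refine h3.congr ?_
  filter_upwards [hgs, hp₁.continuousAt.eventually (eventually_mem_baseSet L₁ (p₁ z))]
    with z' hz' hz''
  rw [hz', a.apply_contract Φ (p₂ z) hz'' s]

/-- By properness `tsupport w` meets the fibre in a compact set, inside the chart; the integrand is
continuous on its image in the slice and zero elsewhere. -/
theorem TwistIso.integrableOn_slice [T2Space Y₂] (a : TwistIso EZ E₂ L₁ L₂ p₁ p₂ d)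
    (hp₁ : Continuous p₁) (hproper : IsProperMap p₂) {V : Set Y₂}
    {g : ∀ z, Sesq (L₁ (p₁ z)) (L₁ (p₁ z))} (hg : IsPullbackSection E₁ p₁ p₂ V g)
    (Φ : SubmersionChart EZ E₂ p₂ d) {y : Y₂} (hy : y ∈ V) {w : Z → ℂ} (hw : Continuous w)
    (hwΦ : tsupport w ⊆ Φ.source) :
    IntegrableOn (fun x : Fin d → ℂ => w (Φ.invFun (x, y)) *
      g (Φ.invFun (x, y)) (a.contract Φ y (Φ.invFun (x, y))) (a.contract Φ y (Φ.invFun (x, y))))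
      {x : Fin d → ℂ | (x, y) ∈ Φ.target} := by
  let K : Set (Fin d → ℂ) := Φ.fibreMap '' (tsupport w ∩ p₂ ⁻¹' {y})
  have hK : IsCompact K := by
    refine IsCompact.image_of_continuousOn
      ((hproper.isCompact_preimage isCompact_singleton).inter_left (isClosed_tsupport w)) ?_
    exact fun z hz => (Φ.mdifferentiableAt_fibreMap (hwΦ hz.1)).continuousAt.continuousWithinAt
  have hKs : ∀ x ∈ K, (x, y) ∈ Φ.target := by
    rintro _ ⟨z, ⟨hz, hzy⟩, rfl⟩
    have h := Φ.mem_target_fibreMap (hwΦ hz)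
    rwa [hzy] at h
  have hcont : ContinuousOn (fun x : Fin d → ℂ => w (Φ.invFun (x, y)) *
      g (Φ.invFun (x, y)) (a.contract Φ y (Φ.invFun (x, y)))
        (a.contract Φ y (Φ.invFun (x, y)))) K := by
    intro x hx
    have h1 := hKs x hx
    have h2 : p₂ (Φ.invFun (x, y)) = y := Φ.map_invFun h1
    have h3 := (Φ.mdifferentiableAt_slice h1).continuousAt
    have h4 := a.continuousAt_density hp₁ hproper.continuous hg Φ (z := Φ.invFun (x, y))
      (Φ.map_target h1)
      (by rwa [h2])
    rw [h2] at h4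
    exact ((hw.continuousAt.comp h3).mul (ContinuousAt.comp (f := fun x => Φ.invFun (x, y))
      (g := fun z' => g z' (a.contract Φ y z') (a.contract Φ y z')) h4 h3)).continuousWithinAt
  refine (hcont.integrableOn_compact hK).of_forall_sdiff_eq_zero
    (Φ.isOpen_slice y).measurableSet fun x hx => ?_
  have h1 : w (Φ.invFun (x, y)) = 0 := by
    refine image_eq_zero_of_notMem_tsupport fun h => hx.2 ?_
    exact ⟨_, ⟨h, Φ.map_invFun hx.1⟩, Φ.fibreMap_invFun hx.1⟩
  rw [h1, zero_mul]

/-- Splitting a fibre integral by a finite partition of unity. -/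
theorem TwistIso.sliceIntegral_eq_sum [T2Space Y₂] (a : TwistIso EZ E₂ L₁ L₂ p₁ p₂ d)
    (hp₁ : Continuous p₁) (hproper : IsProperMap p₂) {V : Set Y₂}
    {g : ∀ z, Sesq (L₁ (p₁ z)) (L₁ (p₁ z))} (hg : IsPullbackSection E₁ p₁ p₂ V g)
    (Φ : SubmersionChart EZ E₂ p₂ d) {y : Y₂} (hy : y ∈ V) {w : Z → ℂ} (hw : Continuous w)
    (hwΦ : tsupport w ⊆ Φ.source) {n : ℕ} {ρ : Fin n → Z → ℂ} (hρ : ∀ j, Continuous (ρ j))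
    (hsum : ∀ z, p₂ z = y → ∑ j, ρ j z = 1) :
    a.sliceIntegral g Φ y w = ∑ j, a.sliceIntegral g Φ y (fun z => ρ j z * w z) := by
  unfold TwistIso.sliceIntegral
  rw [← integral_finsetSum]
  · refine setIntegral_congr_fun (Φ.isOpen_slice y).measurableSet fun x hx => ?_
    simp only [mul_assoc]
    rw [← Finset.sum_mul, hsum _ (Φ.map_invFun hx), one_mul]
  · intro j _
    exact a.integrableOn_slice hp₁ hproper hg Φ hy ((hρ j).mul hw)
      ((closure_mono (Function.support_mul_subset_right _ _)).trans hwΦ)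

/-- Refine both sums by the products `ρ i * ρ' j`, each supported in both charts, and change the
chart term by term. Since `TwistIso.transform` picks a value by `Classical.epsilon`, this is what
allows it to be computed. -/
theorem TwistIso.IsFibreIntegral.unique [T2Space Y₂] {a : TwistIso EZ E₂ L₁ L₂ p₁ p₂ d}
    (hp₁ : Continuous p₁) (hp₂ : MDifferentiable 𝓘(ℂ, EZ) 𝓘(ℂ, E₂) p₂)
    (hproper : IsProperMap p₂) {V : Set Y₂} {g : ∀ z, Sesq (L₁ (p₁ z)) (L₁ (p₁ z))}
    (hg : IsPullbackSection E₁ p₁ p₂ V g) {y : Y₂} (hy : y ∈ V) {I I' : ℂ}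
    (h : a.IsFibreIntegral g y I) (h' : a.IsFibreIntegral g y I') : I = I' := by
  obtain ⟨n, Φ, ρ, hρ, hρs, rfl⟩ := h
  obtain ⟨n', Φ', ρ', hρ', hρs', rfl⟩ := h'
  have hsupp : ∀ f : Z → ℝ, tsupport (fun z => (f z : ℂ)) = tsupport f := by
    intro f
    unfold tsupport
    congr 1
    ext z
    simp
  have hc : ∀ i, Continuous fun z => (ρ i z : ℂ) := fun i =>
    Complex.continuous_ofReal.comp (hρ i).1
  have hc' : ∀ i, Continuous fun z => (ρ' i z : ℂ) := fun i =>
    Complex.continuous_ofReal.comp (hρ' i).1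
  have h1 : ∀ i, a.sliceIntegral g (Φ i) y (fun z => (ρ i z : ℂ))
      = ∑ j, a.sliceIntegral g (Φ i) y (fun z => (ρ' j z : ℂ) * (ρ i z : ℂ)) := fun i =>
    a.sliceIntegral_eq_sum hp₁ hproper hg (Φ i) hy (hc i) ((hsupp _).trans_subset (hρ i).2) hc'
      fun z hz => by exact_mod_cast congrArg (fun t : ℝ => (t : ℂ)) (hρs' z hz)
  have h2 : ∀ j, a.sliceIntegral g (Φ' j) y (fun z => (ρ' j z : ℂ))
      = ∑ i, a.sliceIntegral g (Φ' j) y (fun z => (ρ i z : ℂ) * (ρ' j z : ℂ)) := fun j =>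
    a.sliceIntegral_eq_sum hp₁ hproper hg (Φ' j) hy (hc' j) ((hsupp _).trans_subset (hρ' j).2) hc
      fun z hz => by exact_mod_cast congrArg (fun t : ℝ => (t : ℂ)) (hρs z hz)
  change ∑ i, a.sliceIntegral g (Φ i) y (fun z => (ρ i z : ℂ))
    = ∑ j, a.sliceIntegral g (Φ' j) y (fun z => (ρ' j z : ℂ))
  simp only [h1, h2]
  rw [Finset.sum_comm]
  refine Finset.sum_congr rfl fun j _ => Finset.sum_congr rfl fun i _ => ?_
  simp only [mul_comm (ρ' j _ : ℂ)]
  refine a.sliceIntegral_congr_chart hp₂ g _ _ y (fun z hz => ?_) (fun z hz => ?_)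
  · refine (hρ i).2 (subset_tsupport _ ?_)
    exact fun h0 => hz (by simp [h0])
  · refine (hρ' j).2 (subset_tsupport _ ?_)
    exact fun h0 => hz (by simp [h0])

end FibreIntegral

/-! ### Annihilation of the transform -/

/-- The real manifold underlying a complex manifold. -/
theorem isManifold_real {X : Type*} [TopologicalSpace X] {E : Type*} [NormedAddCommGroup E]
    [NormedSpace ℂ E] [ChartedSpace E X] [IsManifold 𝓘(ℂ, E) ω X] : IsManifold 𝓘(ℝ, E) ∞ X := by
  refine isManifold_of_contDiffOn _ _ _ fun e e' he he' => ?_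
  have h := ((contDiffGroupoid ω 𝓘(ℂ, E)).compatible he he')
  rw [contDiffGroupoid, mem_groupoid_of_pregroupoid] at h
  exact (h.1.restrict_scalars ℝ).of_le le_top

theorem wirt_eventuallyEq_zero {X : Type*} [TopologicalSpace X] {F : Type*}
    [NormedAddCommGroup F] [NormedSpace ℂ F] {κ : OpenPartialHomeomorph X F} {x : X}
    (hx : x ∈ κ.source) (v : F) {f : X → ℂ} (hf : f =ᶠ[𝓝 x] 0) : wirt κ v f =ᶠ[𝓝 x] 0 := by
  filter_upwards [hf.eventuallyEq_nhds, κ.open_source.mem_nhds hx] with y hy hys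
  have h1 : f ∘ κ.symm =ᶠ[𝓝 (κ y)] fun _ => (0 : ℂ) := by
    have h2 := κ.continuousAt_symm (κ.map_source hys)
    rw [ContinuousAt, κ.left_inv hys] at h2
    exact h2.eventually hy
  simp [wirt, h1.fderiv_eq]

section Annihilation

variable {Y : Type*} [TopologicalSpace Y]
  {E : Type*} [NormedAddCommGroup E] [NormedSpace ℂ E] [ChartedSpace E Y]
  {L : Y → Type*} [TopologicalSpace (TotalSpace ℂ L)] [∀ y, AddCommGroup (L y)]
  [∀ y, Module ℂ (L y)] [∀ y, TopologicalSpace (L y)] [FiberBundle ℂ L] [VectorBundle ℂ ℂ L]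
  {L' : Y → Type*} [TopologicalSpace (TotalSpace ℂ L')] [∀ y, AddCommGroup (L' y)]
  [∀ y, Module ℂ (L' y)] [∀ y, TopologicalSpace (L' y)] [FiberBundle ℂ L'] [VectorBundle ℂ ℂ L']

/-- Differential operators kill sections which vanish near a point. -/
theorem HolDiffOp.apply_eq_zero_of_eventually (P : HolDiffOp E L L') {y₀ : Y}
    {s : ∀ y, Sesq (L y) (L y)} (hs : coeff y₀ s =ᶠ[𝓝 y₀] 0) : P.toFun s y₀ = 0 := by
  obtain ⟨n, c, w, -, h⟩ := P.local_expr y₀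
  have h1 : SmoothSection E s y₀ := SmoothNear.congr (f := fun _ => 0)
    (Eventually.of_forall fun _ => contMDiffAt_const) hs.symm
  have h2 := h.self_of_nhds s h1
  have h3 : ∀ l : List E,
      l.foldr (fun v f => wirt (chartAt E y₀) v f) (coeff y₀ s) =ᶠ[𝓝 y₀] 0 := by
    intro l
    induction l with
    | nil => exact hs
    | cons v l ih => exact wirt_eventuallyEq_zero (mem_chart_source E y₀) v ih
  refine sesq_eq_zero_of_coeff (mem_baseSet_trivializationAt ℂ L y₀)
    (mem_baseSet_trivializationAt ℂ L' y₀) (h2.trans (Finset.sum_eq_zero fun k _ => ?_))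
  rw [(h3 (w k)).eq_of_nhds]
  simp

/-- A sum of smooth functions killed by the germ of a differential operator defines sections
killed by the operator. -/
theorem HolDiffOp.apply_eq_zero_of_sum (P : HolDiffOp E L L') {y₀ : Y} {n : ℕ}
    {J : Fin n → Y → ℂ} {G : Fin n → GermOp E y₀} (hG : ∀ i, P.IsGermAt y₀ (G i))
    (hJ : ∀ i, ∃ h : SmoothNear E (J i) y₀, G i (SmoothGerm.mk _ h) = 0)
    {s : ∀ y, Sesq (L y) (L y)} (hs : coeff y₀ s =ᶠ[𝓝 y₀] fun y => ∑ i, J i y) :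
    P.toFun s y₀ = 0 := by
  -- An empty sum provides no germ `G i`; in this case `s` vanishes near `y₀` and the local
  -- expression of `P` is used.
  rcases n with _ | n
  · exact P.apply_eq_zero_of_eventually (hs.trans (Eventually.of_forall fun y => by simp))
  choose h hz using hJ
  have hsum : ∀ t : Finset (Fin (n + 1)),
      (∑ i ∈ t, SmoothGerm.mk (J i) (h i)).germ
        = ((fun y => ∑ i ∈ t, J i y : Y → ℂ) : Germ (𝓝 y₀) ℂ) := by
    intro t
    induction t using Finset.induction_on with
    | empty => simp; rfl
    | insert i t hi ih =>
      rw [Finset.sum_insert hi, SmoothGerm.germ_add, ih, SmoothGerm.germ_mk, ← Germ.coe_add]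
      congr 1
      funext y
      rw [Finset.sum_insert hi]
      rfl
  have h1 := hG 0 s (∑ i, SmoothGerm.mk (J i) (h i))
    ((hsum _).trans (Germ.coe_eq.2 hs.symm))
  -- All `G i` are the same operator, being germs of `P` at `y₀` in the same frames, so a single one
  -- kills the whole sum.
  rw [map_sum, Finset.sum_eq_zero fun i _ => by rw [(hG 0).unique (hG i), hz i]] at h1
  have h2 : coeff y₀ (P.toFun s) =ᶠ[𝓝 y₀] 0 := (Germ.coe_eq.1 h1).symm
  exact sesq_eq_zero_of_coeff (mem_baseSet_trivializationAt ℂ L y₀)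
    (mem_baseSet_trivializationAt ℂ L' y₀) h2.eq_of_nhds

end Annihilation

/-! ### From local data to the transform, by a partition of unity on Y₁ -/

section Globalisation

variable {Z Y₁ Y₂ : Type*} [TopologicalSpace Z] [TopologicalSpace Y₁] [TopologicalSpace Y₂]
  {EZ : Type*} [NormedAddCommGroup EZ] [NormedSpace ℂ EZ] [ChartedSpace EZ Z]
  {E₁ : Type*} [NormedAddCommGroup E₁] [NormedSpace ℂ E₁] [ChartedSpace E₁ Y₁]
  {E₂ : Type*} [NormedAddCommGroup E₂] [NormedSpace ℂ E₂] [ChartedSpace E₂ Y₂]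
  {L₁ : Y₁ → Type*} [TopologicalSpace (TotalSpace ℂ L₁)] [∀ y, AddCommGroup (L₁ y)]
  [∀ y, Module ℂ (L₁ y)] [∀ y, TopologicalSpace (L₁ y)] [FiberBundle ℂ L₁] [VectorBundle ℂ ℂ L₁]
  {L₂ : Y₂ → Type*} [TopologicalSpace (TotalSpace ℂ L₂)] [∀ y, AddCommGroup (L₂ y)]
  [∀ y, Module ℂ (L₂ y)] [∀ y, TopologicalSpace (L₂ y)] [FiberBundle ℂ L₂] [VectorBundle ℂ ℂ L₂]
  {L₂' : Y₂ → Type*} [TopologicalSpace (TotalSpace ℂ L₂')] [∀ y, AddCommGroup (L₂' y)]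
  [∀ y, Module ℂ (L₂' y)] [∀ y, TopologicalSpace (L₂' y)] [FiberBundle ℂ L₂']
  [VectorBundle ℂ ℂ L₂']
  {p₁ : Z → Y₁} {p₂ : Z → Y₂} {d : ℕ}

/-- Replacing the frame of `L₂` multiplies contractions by a scalar. -/
theorem TwistIso.contract_eq_smul (a : TwistIso EZ E₂ L₁ L₂ p₁ p₂ d)
    (Φ : SubmersionChart EZ E₂ p₂ d) (y₀ : Y₂) {y : Y₂} {z : Z} (hz : p₂ z = y) :
    a.contract Φ y₀ z = fibreCoord L₂ y₀ y (frame L₂ y y) • a.contract Φ y z := by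
  subst hz
  refine LinearMap.ext fun l => ?_
  exact DFunLike.congr_fun (dual_eq_smul_fibreCoord (mem_baseSet_trivializationAt ℂ L₂ (p₂ z))
    (fibreCoord L₂ y₀ (p₂ z))) _

variable [FiniteDimensional ℂ EZ] [IsManifold 𝓘(ℂ, EZ) ω Z]
  [FiniteDimensional ℂ E₁] [IsManifold 𝓘(ℂ, E₁) ω Y₁]
  [FiniteDimensional ℂ E₂] [IsManifold 𝓘(ℂ, E₂) ω Y₂]

/-- Adapted local data at a point of a fibre of `p₂`. -/
structure LocalDatum (a : TwistIso EZ E₂ L₁ L₂ p₁ p₂ d) (P : HolDiffOp E₂ L₂ L₂')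
    (g : ∀ z, Sesq (L₁ (p₁ z)) (L₁ (p₁ z))) (y₀ : Y₂) (A : Set Y₁) where
  chart : SubmersionChart EZ E₂ p₂ d
  pt : Y₁
  nhd : Set Y₂
  sec : ∀ y, Sesq (L₁ y) (L₁ y)
  op : GermOp E₂ y₀
  nhd_mem : nhd ∈ 𝓝 y₀
  mem_source : ∀ z, p₁ z ∈ A → p₂ z ∈ nhd → z ∈ chart.source
  mem_baseSet : ∀ z, p₁ z ∈ A → p₂ z ∈ nhd → p₁ z ∈ (trivializationAt ℂ L₁ pt).baseSet
  sec_eq : ∀ z, p₁ z ∈ A → p₂ z ∈ nhd → g z = sec (p₁ z)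
  smooth : ∀ y ∈ A, ContMDiffAt 𝓘(ℝ, E₁) 𝓘(ℝ, ℂ) ∞ (coeff pt sec) y
  isGermAt : P.IsGermAt y₀ op
  annihilates : ∀ (u : Y₁ → ℂ), (∀ y, SmoothNear E₁ u y) → tsupport u ⊆ A →
    ∃ hJ : SmoothNear E₂ (a.localIntegral chart pt y₀ u) y₀, op (SmoothGerm.mk _ hJ) = 0

/-- This is where the embedding enters: a neighbourhood of `z` in `Z` contains all of `p₁⁻¹(A) ∩
p₂⁻¹(C)` for small `A` and `C`. A cut-off in `Y₁` therefore localises at `z`, once `p₂` is confined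
to `C`. -/
theorem TwistIso.exists_localDatum [T2Space Z] [T2Space Y₂]
    (a : TwistIso EZ E₂ L₁ L₂ p₁ p₂ d) (P : HolDiffOp E₂ L₂ L₂')
    (hp₁ : MDifferentiable 𝓘(ℂ, EZ) 𝓘(ℂ, E₁) p₁) (hp₂ : MDifferentiable 𝓘(ℂ, EZ) 𝓘(ℂ, E₂) p₂)
    (hproper : IsProperMap p₂) (hemb : IsEmbedding fun z => (p₁ z, p₂ z)) {V : Set Y₂}
    {g : ∀ z, Sesq (L₁ (p₁ z)) (L₁ (p₁ z))} (hg : IsPullbackSection E₁ p₁ p₂ V g) {y₀ : Y₂}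
    (hy₀ : y₀ ∈ V) {z : Z} (hz : p₂ z = y₀) (h : a.KillsPsiAt E₁ P z) :
    ∃ A : Set Y₁, IsOpen A ∧ p₁ z ∈ A ∧
      Nonempty (LocalDatum (E₁ := E₁) a P g y₀ A) := by
  obtain ⟨Φ, N, G, hNo, hzN, hNΦ, hNb, hG, hann⟩ :=
    a.exists_local_annihilation P hp₁ hp₂ hproper hz h
  obtain ⟨s, hs, hgs⟩ := hg z (by rwa [Set.mem_preimage, hz])
  have h1 : ∀ᶠ z' in 𝓝 z, z' ∈ N ∧ g z' = s (p₁ z') := (hNo.eventually_mem hzN).and hgs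
  rw [hemb.isInducing.nhds_eq_comap, nhds_prod_eq, hz] at h1
  obtain ⟨S, hS, hSN⟩ := h1
  obtain ⟨A', hA', B', hB', hAB⟩ := mem_prod_iff.1 hS
  obtain ⟨A, hA, hAo, hzA⟩ := mem_nhds_iff.1 (inter_mem hA' hs)
  have hpE₂ : ProperSpace E₂ := FiniteDimensional.proper ℂ E₂
  have hlc : LocallyCompactSpace Y₂ := ChartedSpace.locallyCompactSpace E₂ Y₂
  obtain ⟨C, hC, hCB, hCc⟩ := local_compact_nhds
    (inter_mem hB' ((chartAt E₂ y₀).open_source.mem_nhds (mem_chart_source E₂ y₀)))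
  have hmem : ∀ z', p₁ z' ∈ A → p₂ z' ∈ C → z' ∈ N ∧ g z' = s (p₁ z') := fun z' h2 h3 =>
    hSN (hAB ⟨(hA h2).1, (hCB h3).1⟩)
  exact ⟨A, hAo, hzA, ⟨{
    chart := Φ
    pt := p₁ z
    nhd := C
    sec := s
    op := G
    nhd_mem := hC
    mem_source := fun z' h2 h3 => hNΦ (hmem z' h2 h3).1
    mem_baseSet := fun z' h2 h3 => hNb z' (hmem z' h2 h3).1
    sec_eq := fun z' h2 h3 => (hmem z' h2 h3).2
    smooth := fun y hy => (hA hy).2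
    isGermAt := hG
    annihilates := fun u hu huA => hann u C hu hCc hC (fun y hy => (hCB hy).2)
      fun z' hz' => (hmem z' (huA hz'.1) hz'.2).1 }⟩⟩

/-- The sets cover the image of the fibre in `Y₁`, not the fibre itself, because the partition of
unity has to live on `Y₁`. -/
theorem TwistIso.exists_finite_localDatum [T2Space Z] [T2Space Y₂]
    (a : TwistIso EZ E₂ L₁ L₂ p₁ p₂ d) (P : HolDiffOp E₂ L₂ L₂')
    (hp₁ : MDifferentiable 𝓘(ℂ, EZ) 𝓘(ℂ, E₁) p₁) (hp₂ : MDifferentiable 𝓘(ℂ, EZ) 𝓘(ℂ, E₂) p₂)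
    (hproper : IsProperMap p₂) (hemb : IsEmbedding fun z => (p₁ z, p₂ z)) {V : Set Y₂}
    {g : ∀ z, Sesq (L₁ (p₁ z)) (L₁ (p₁ z))} (hg : IsPullbackSection E₁ p₁ p₂ V g) {y₀ : Y₂}
    (hy₀ : y₀ ∈ V) (h : a.KillsPsi E₁ P) :
    ∃ (n : ℕ) (A : Fin n → Set Y₁), (∀ i, IsOpen (A i)) ∧ p₁ '' (p₂ ⁻¹' {y₀}) ⊆ ⋃ i, A i ∧
      Nonempty (∀ i, LocalDatum (E₁ := E₁) a P g y₀ (A i)) := by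
  have hex : ∀ z : p₂ ⁻¹' {y₀}, ∃ A : Set Y₁, IsOpen A ∧ p₁ z ∈ A ∧
      Nonempty (LocalDatum (E₁ := E₁) a P g y₀ A) := fun z =>
    a.exists_localDatum P hp₁ hp₂ hproper hemb hg hy₀ z.2 (h z)
  choose A hA hzA hD using hex
  have hcomp : IsCompact (p₁ '' (p₂ ⁻¹' {y₀})) :=
    (hproper.isCompact_preimage isCompact_singleton).image hp₁.continuous
  obtain ⟨t, ht⟩ := hcomp.elim_finite_subcover A hA (by
    rintro _ ⟨z, hz, rfl⟩
    exact Set.mem_iUnion.2 ⟨⟨z, hz⟩, hzA ⟨z, hz⟩⟩)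
  refine ⟨t.card, fun i => A (t.equivFin.symm i), fun i => hA _, fun y hy => ?_,
    ⟨fun i => (hD _).some⟩⟩
  obtain ⟨z, hz, hyz⟩ := Set.mem_iUnion₂.1 (ht hy)
  refine Set.mem_iUnion.2 ⟨t.equivFin ⟨z, hz⟩, ?_⟩
  rwa [Equiv.symm_apply_apply]

omit [FiniteDimensional ℂ EZ] [IsManifold 𝓘(ℂ, EZ) ω Z] [FiniteDimensional ℂ E₁]
  [IsManifold 𝓘(ℂ, E₁) ω Y₁] [FiniteDimensional ℂ E₂] in
/-- The transform is computed by any partition of unity. -/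
theorem TwistIso.transform_eq [T2Space Y₂] {a : TwistIso EZ E₂ L₁ L₂ p₁ p₂ d}
    (hp₁ : Continuous p₁) (hp₂ : MDifferentiable 𝓘(ℂ, EZ) 𝓘(ℂ, E₂) p₂)
    (hproper : IsProperMap p₂) {V : Set Y₂} {g : ∀ z, Sesq (L₁ (p₁ z)) (L₁ (p₁ z))}
    (hg : IsPullbackSection E₁ p₁ p₂ V g) {y : Y₂} (hy : y ∈ V) {I : ℂ}
    (h : a.IsFibreIntegral g y I) :
    a.transform g y = Sesq.ofVec I (frame L₂ y y) (frame L₂ y y) := by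
  have h1 := TwistIso.IsFibreIntegral.unique hp₁ hp₂ hproper hg hy (Classical.epsilon_spec ⟨I, h⟩) h
  rw [TwistIso.transform, h1]

/-- Near every point the transform is a finite sum of integrals, over the fibres of submersion
charts, which are annihilated by the operator. -/
theorem TwistIso.exists_transform_eq_sum [T2Space Z] [T2Space Y₂] [T2Space Y₁]
    [SigmaCompactSpace Y₁] (a : TwistIso EZ E₂ L₁ L₂ p₁ p₂ d) (P : HolDiffOp E₂ L₂ L₂')
    (hp₁ : MDifferentiable 𝓘(ℂ, EZ) 𝓘(ℂ, E₁) p₁) (hp₂ : MDifferentiable 𝓘(ℂ, EZ) 𝓘(ℂ, E₂) p₂)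
    (hproper : IsProperMap p₂) (hemb : IsEmbedding fun z => (p₁ z, p₂ z)) {V : Set Y₂}
    (hV : IsOpen V) {g : ∀ z, Sesq (L₁ (p₁ z)) (L₁ (p₁ z))}
    (hg : IsPullbackSection E₁ p₁ p₂ V g) {y₀ : Y₂} (hy₀ : y₀ ∈ V) (h : a.KillsPsi E₁ P) :
    (∀ᶠ y in 𝓝 y₀, ∃ I, a.IsFibreIntegral g y I) ∧
    ∃ (n : ℕ) (J : Fin n → Y₂ → ℂ) (G : Fin n → GermOp E₂ y₀), (∀ i, P.IsGermAt y₀ (G i)) ∧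
      (∀ i, ∃ hJ : SmoothNear E₂ (J i) y₀, G i (SmoothGerm.mk _ hJ) = 0) ∧
      coeff y₀ (a.transform g) =ᶠ[𝓝 y₀] fun y => ∑ i, J i y := by
  obtain ⟨n, A, hA, hcov, ⟨D⟩⟩ :=
    a.exists_finite_localDatum P hp₁ hp₂ hproper hemb hg hy₀ h
  have hpE₁ : ProperSpace E₁ := FiniteDimensional.proper ℂ E₁
  have hlc₁ : LocallyCompactSpace Y₁ := ChartedSpace.locallyCompactSpace E₁ Y₁
  have hm₁ : IsManifold 𝓘(ℝ, E₁) ∞ Y₁ := isManifold_real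
  have hm₂ : IsManifold 𝓘(ℝ, E₂) ∞ Y₂ := isManifold_real
  obtain ⟨K, hK, hFK, hKA⟩ := exists_compact_between
    ((hproper.isCompact_preimage isCompact_singleton).image hp₁.continuous)
    (isOpen_iUnion hA) hcov
  obtain ⟨χ, hχ⟩ := SmoothPartitionOfUnity.exists_isSubordinate 𝓘(ℝ, E₁) hK.isClosed A hA hKA
  -- The product is smooth on all of `Y₁`, although the coefficient is known to be smooth only on `A
  -- i`, because `χ i` has its closed support there.
  let u : Fin n → Y₁ → ℂ := fun i y => χ i y • coeff (D i).pt (D i).sec y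
  have hu : ∀ i y, SmoothNear E₁ (u i) y := fun i y => Eventually.of_forall
    (χ.contMDiff_smul fun x hx => (D i).smooth x (hχ i hx))
  have huA : ∀ i, tsupport (u i) ⊆ A i := fun i =>
    (tsupport_smul_subset_left _ _).trans (hχ i)
  -- By properness the fibres near `y₀` also map into `K`, where the `χ i` sum to `1`.
  have hfib : ∀ᶠ y in 𝓝 y₀, ∀ z ∈ p₂ ⁻¹' {y}, p₁ z ∈ K :=
    hproper.isClosedMap.eventually_nhds_fiber y₀ fun z hz =>
      hp₁.continuous.continuousAt.eventually
        (mem_interior_iff_mem_nhds.1 (hFK ⟨z, hz, rfl⟩))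
  -- `IsFibreIntegral` wants supports inside the chart domains on all of `Z`, which `A i` ensures
  -- only over `nhd`. The bump function `θ` cuts off in `Y₂` and equals `1` near `y₀`.
  obtain ⟨θ, -, hθ⟩ := (SmoothBumpFunction.nhds_basis_tsupport (I := 𝓘(ℝ, E₂)) y₀).mem_iff.1
    (iInter_mem.2 fun i => (D i).nhd_mem)
  let ρ : Fin n → Z → ℝ := fun i z => χ i (p₁ z) * θ (p₂ z)
  have hρ : ∀ i, Continuous (ρ i) ∧ tsupport (ρ i) ⊆ (D i).chart.source := by
    intro i
    have h1 : Continuous fun z => χ i (p₁ z) := (χ i).contMDiff.continuous.comp hp₁.continuous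
    have h2 : Continuous fun z => θ (p₂ z) := θ.continuous.comp hp₂.continuous
    refine ⟨h1.mul h2, fun z hz => (D i).mem_source z (hχ i ?_) ?_⟩
    · exact tsupport_comp_subset_preimage (χ i) hp₁.continuous (tsupport_mul_subset_left hz)
    · exact Set.mem_iInter.1 (hθ (tsupport_comp_subset_preimage θ hp₂.continuous
        (tsupport_mul_subset_right hz))) i
  have hgood : ∀ᶠ y in 𝓝 y₀, (∀ z, p₂ z = y → ∑ i, ρ i z = 1) ∧ θ y = 1 ∧
      ∀ i, y ∈ (D i).nhd := by
    filter_upwards [hfib, θ.eventuallyEq_one, eventually_all.2 fun i => (D i).nhd_mem]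
      with y h1 h2 h3
    refine ⟨fun z hz => ?_, h2, h3⟩
    have h4 := χ.sum_eq_one (h1 z hz)
    rw [finsum_eq_sum_of_fintype] at h4
    simp only [ρ, hz, h2, Pi.one_apply, mul_one, h4]
  let I : Y₂ → ℂ := fun y => ∑ i, a.sliceIntegral g (D i).chart y fun z => (ρ i z : ℂ)
  have hI : ∀ᶠ y in 𝓝 y₀, a.IsFibreIntegral g y (I y) := by
    filter_upwards [hgood] with y hy
    exact ⟨n, fun i => (D i).chart, ρ, hρ, hy.1, rfl⟩
  refine ⟨hI.mono fun y hy => ⟨_, hy⟩, n,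
    fun i => a.localIntegral (D i).chart (D i).pt y₀ (u i), fun i => (D i).op,
    fun i => (D i).isGermAt, fun i => (D i).annihilates (u i) (hu i) (huA i), ?_⟩
  filter_upwards [hI, hgood, hV.mem_nhds hy₀] with y hIy hy hyV
  -- The transform at `y` is written in the frame chosen at `y`, whereas `P` is expanded in the one
  -- chosen at `y₀`. The change of frame contributes a factor and its conjugate, absorbed below by
  -- `contract_eq_smul`.
  have hcoeff : coeff y₀ (a.transform g) y
      = I y * fibreCoord L₂ y₀ y (frame L₂ y y) *
        starRingEnd ℂ (fibreCoord L₂ y₀ y (frame L₂ y y)) := by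
    rw [coeff, TwistIso.transform_eq hp₁.continuous hp₂ hproper hg hyV hIy]
    rfl
  rw [hcoeff, mul_assoc, Finset.sum_mul]
  refine Finset.sum_congr rfl fun i _ => ?_
  rw [TwistIso.sliceIntegral, TwistIso.localIntegral, ← integral_mul_const]
  refine setIntegral_congr_fun ((D i).chart.isOpen_slice y).measurableSet fun x hx => ?_
  have hz : p₂ ((D i).chart.invFun (x, y)) = y := (D i).chart.map_invFun hx
  generalize (D i).chart.invFun (x, y) = z at hz
  by_cases hχz : χ i (p₁ z) = 0
  · simp [ρ, TwistIso.density, u, hχz]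
  have hzA : p₁ z ∈ A i := hχ i (subset_tsupport _ hχz)
  have hzB : p₂ z ∈ (D i).nhd := by
    rw [hz]
    exact hy.2.2 i
  have h1 := a.apply_contract (D i).chart y₀ ((D i).mem_baseSet z hzA hzB) (D i).sec
  rw [a.contract_eq_smul (D i).chart y₀ hz, sesq_apply_smul] at h1
  simp only [TwistIso.density, u, ρ, hz, hy.2.1, mul_one, Complex.real_smul]
  rw [(D i).sec_eq z hzA hzB]
  linear_combination (χ i (p₁ z) : ℂ) * h1

omit [FiniteDimensional ℂ EZ] [IsManifold 𝓘(ℂ, EZ) ω Z] [FiniteDimensional ℂ E₁]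
  [IsManifold 𝓘(ℂ, E₁) ω Y₁] [FiniteDimensional ℂ E₂] [IsManifold 𝓘(ℂ, E₂) ω Y₂] in
/-- The conjugate of a pulled back section is a pulled back section. -/
theorem IsPullbackSection.conj {V : Set Y₂} {g : ∀ z, Sesq (L₁ (p₁ z)) (L₁ (p₁ z))}
    (hg : IsPullbackSection E₁ p₁ p₂ V g) :
    IsPullbackSection E₁ p₁ p₂ V fun z => (g z).conj := by
  intro z hz
  obtain ⟨s, hs, hgs⟩ := hg z hz
  refine ⟨fun y => (s y).conj, ?_, hgs.mono fun z' hz' => congrArg Sesq.conj hz'⟩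
  filter_upwards [hs] with y hy
  exact Complex.conjCLE.contDiff.contMDiff.contMDiffAt.comp y hy

omit [FiniteDimensional ℂ EZ] [IsManifold 𝓘(ℂ, EZ) ω Z] [FiniteDimensional ℂ E₂]
  [IsManifold 𝓘(ℂ, E₂) ω Y₂] in
-- The partition functions are real and both arguments of `g` are the same contraction, so
-- conjugation passes through the integrals with the same charts and partition.
theorem TwistIso.IsFibreIntegral.conj {a : TwistIso EZ E₂ L₁ L₂ p₁ p₂ d}
    {g : ∀ z, Sesq (L₁ (p₁ z)) (L₁ (p₁ z))} {y : Y₂} {I : ℂ} (h : a.IsFibreIntegral g y I) :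
    a.IsFibreIntegral (fun z => (g z).conj) y (starRingEnd ℂ I) := by
  obtain ⟨n, Φ, ρ, hρ, hρs, rfl⟩ := h
  refine ⟨n, Φ, ρ, hρ, hρs, ?_⟩
  rw [map_sum]
  refine Finset.sum_congr rfl fun i _ => ?_
  rw [← integral_conj]
  refine integral_congr_ae (Eventually.of_forall fun x => ?_)
  simp only [map_mul, Complex.conj_ofReal]
  rfl

/-- The transform of the conjugate section is the conjugate of the transform. -/
theorem TwistIso.eventually_transform_conj [T2Space Z] [T2Space Y₂] [T2Space Y₁]
    [SigmaCompactSpace Y₁] (a : TwistIso EZ E₂ L₁ L₂ p₁ p₂ d) (P : HolDiffOp E₂ L₂ L₂')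
    (hp₁ : MDifferentiable 𝓘(ℂ, EZ) 𝓘(ℂ, E₁) p₁) (hp₂ : MDifferentiable 𝓘(ℂ, EZ) 𝓘(ℂ, E₂) p₂)
    (hproper : IsProperMap p₂) (hemb : IsEmbedding fun z => (p₁ z, p₂ z)) {V : Set Y₂}
    (hV : IsOpen V) {g : ∀ z, Sesq (L₁ (p₁ z)) (L₁ (p₁ z))}
    (hg : IsPullbackSection E₁ p₁ p₂ V g) {y₀ : Y₂} (hy₀ : y₀ ∈ V) (h : a.KillsPsi E₁ P) :
    ∀ᶠ y in 𝓝 y₀, (a.transform g y).conj = a.transform (fun z => (g z).conj) y := by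
  filter_upwards [(a.exists_transform_eq_sum P hp₁ hp₂ hproper hemb hV hg hy₀ h).1,
    hV.mem_nhds hy₀] with y hI hy
  obtain ⟨I, hI⟩ := hI
  rw [TwistIso.transform_eq hp₁.continuous hp₂ hproper hg hy hI,
    TwistIso.transform_eq hp₁.continuous hp₂ hproper hg.conj hy hI.conj]
  refine LinearMap.ext fun l => LinearMap.ext fun m => ?_
  simp [Sesq.conj, Sesq.ofVec]
  ring

omit [FiniteDimensional ℂ EZ] [IsManifold 𝓘(ℂ, EZ) ω Z] [FiniteDimensional ℂ E₁]
  [IsManifold 𝓘(ℂ, E₁) ω Y₁] [FiniteDimensional ℂ E₂] [IsManifold 𝓘(ℂ, E₂) ω Y₂] in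
theorem SmoothNear.sum {ι : Type*} {t : Finset ι} {J : ι → Y₂ → ℂ} {y : Y₂}
    (h : ∀ i ∈ t, SmoothNear E₂ (J i) y) : SmoothNear E₂ (fun y => ∑ i ∈ t, J i y) y := by
  filter_upwards [(Finset.eventually_all t).2 h] with y' hy'
  exact ContMDiffAt.sum hy'

/-- The transform is smooth, and sections which agree with it near a point are killed there. -/
theorem TwistIso.smoothSection_transform_and_apply_eq_zero [T2Space Z] [T2Space Y₂] [T2Space Y₁]
    [SigmaCompactSpace Y₁] (a : TwistIso EZ E₂ L₁ L₂ p₁ p₂ d) (P : HolDiffOp E₂ L₂ L₂')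
    (hp₁ : MDifferentiable 𝓘(ℂ, EZ) 𝓘(ℂ, E₁) p₁) (hp₂ : MDifferentiable 𝓘(ℂ, EZ) 𝓘(ℂ, E₂) p₂)
    (hproper : IsProperMap p₂) (hemb : IsEmbedding fun z => (p₁ z, p₂ z)) {V : Set Y₂}
    (hV : IsOpen V) {g : ∀ z, Sesq (L₁ (p₁ z)) (L₁ (p₁ z))}
    (hg : IsPullbackSection E₁ p₁ p₂ V g) {y₀ : Y₂} (hy₀ : y₀ ∈ V) (h : a.KillsPsi E₁ P) :
    SmoothSection E₂ (a.transform g) y₀ ∧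
      ∀ s : (∀ y, Sesq (L₂ y) (L₂ y)), (∀ᶠ y in 𝓝 y₀, s y = a.transform g y) →
        P.toFun s y₀ = 0 := by
  obtain ⟨n, J, G, hG, hJ, hsum⟩ :=
    (a.exists_transform_eq_sum P hp₁ hp₂ hproper hemb hV hg hy₀ h).2
  refine ⟨SmoothNear.congr (SmoothNear.sum fun i _ => (hJ i).1) hsum.symm, fun s hs =>
    P.apply_eq_zero_of_sum hG hJ (EventuallyEq.trans ?_ hsum)⟩
  filter_upwards [hs] with y hy
  rw [coeff, coeff, hy]

end Globalisation

end IntegralTransform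

end

theorem corollary3p10
    {E₁ E₂ EZ : Type*}
    [NormedAddCommGroup E₁] [NormedSpace ℂ E₁] [FiniteDimensional ℂ E₁]
    [NormedAddCommGroup E₂] [NormedSpace ℂ E₂] [FiniteDimensional ℂ E₂]
    [NormedAddCommGroup EZ] [NormedSpace ℂ EZ] [FiniteDimensional ℂ EZ]
    {Y₁ Y₂ Z : Type*}
    [TopologicalSpace Y₁] [T2Space Y₁] [SecondCountableTopology Y₁]
    [ChartedSpace E₁ Y₁] [IsManifold 𝓘(ℂ, E₁) ω Y₁]
    [TopologicalSpace Y₂] [T2Space Y₂] [SecondCountableTopology Y₂]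
    [ChartedSpace E₂ Y₂] [IsManifold 𝓘(ℂ, E₂) ω Y₂]
    [TopologicalSpace Z] [T2Space Z] [SecondCountableTopology Z]
    [ChartedSpace EZ Z] [IsManifold 𝓘(ℂ, EZ) ω Z]
    -- the correspondence
    (p₁ : Z → Y₁) (p₂ : Z → Y₂)
    (hp₁ : Manifold.IsSubmersion 𝓘(ℂ, EZ) 𝓘(ℂ, E₁) ω p₁)
    (hp₂ : Manifold.IsSubmersion 𝓘(ℂ, EZ) 𝓘(ℂ, E₂) ω p₂)
    (hproper : IsProperMap p₂)
    (hemb : Manifold.IsSmoothEmbedding 𝓘(ℂ, EZ) (𝓘(ℂ, E₁).prod 𝓘(ℂ, E₂)) ω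
      (fun z => (p₁ z, p₂ z)))
    (hclosed : IsClosed (Set.range fun z => (p₁ z, p₂ z)))
    (d : ℕ) (hd : Module.finrank ℂ EZ = d + Module.finrank ℂ E₂)
    -- the line bundles
    (L₁ : Y₁ → Type*) [TopologicalSpace (Bundle.TotalSpace ℂ L₁)] [∀ y, AddCommGroup (L₁ y)]
    [∀ y, Module ℂ (L₁ y)] [∀ y, TopologicalSpace (L₁ y)] [FiberBundle ℂ L₁]
    [VectorBundle ℂ ℂ L₁] [ContMDiffVectorBundle ω ℂ L₁ 𝓘(ℂ, E₁)]
    (L₂ : Y₂ → Type*) [TopologicalSpace (Bundle.TotalSpace ℂ L₂)] [∀ y, AddCommGroup (L₂ y)]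
    [∀ y, Module ℂ (L₂ y)] [∀ y, TopologicalSpace (L₂ y)] [FiberBundle ℂ L₂]
    [VectorBundle ℂ ℂ L₂] [ContMDiffVectorBundle ω ℂ L₂ 𝓘(ℂ, E₂)]
    (L₂' : Y₂ → Type*) [TopologicalSpace (Bundle.TotalSpace ℂ L₂')] [∀ y, AddCommGroup (L₂' y)]
    [∀ y, Module ℂ (L₂' y)] [∀ y, TopologicalSpace (L₂' y)] [FiberBundle ℂ L₂']
    [VectorBundle ℂ ℂ L₂'] [ContMDiffVectorBundle ω ℂ L₂' 𝓘(ℂ, E₂)]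
    (a : IntegralTransform.TwistIso EZ E₂ L₁ L₂ p₁ p₂ d)
    -- the differential operator
    (P : IntegralTransform.HolDiffOp E₂ L₂ L₂')
    (hP : a.KillsPsi E₁ P) :
    ∀ (V : Set Y₂), IsOpen V →
      ∀ g : (∀ z, IntegralTransform.Sesq (L₁ (p₁ z)) (L₁ (p₁ z))),
        IntegralTransform.IsPullbackSection E₁ p₁ p₂ V g → ∀ y ∈ V,
          IntegralTransform.SmoothSection E₂ (a.transform g) y ∧
          P.toFun (a.transform g) y = 0 ∧
          P.barFun (a.transform g) y = 0 := by
  intro V hV g hg y hy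
  have hpE₁ : ProperSpace E₁ := FiniteDimensional.proper ℂ E₁
  have hlc : LocallyCompactSpace Y₁ := ChartedSpace.locallyCompactSpace E₁ Y₁
  have hd₁ := hp₁.contMDiff.mdifferentiable (by simp)
  have hd₂ := hp₂.contMDiff.mdifferentiable (by simp)
  obtain ⟨h1, h2⟩ := a.smoothSection_transform_and_apply_eq_zero P hd₁ hd₂ hproper
    hemb.isEmbedding hV hg hy hP
  -- The assertion on `P̄` is the assertion on `P` for the conjugate section.
  obtain ⟨-, h3⟩ := a.smoothSection_transform_and_apply_eq_zero P hd₁ hd₂ hproper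
    hemb.isEmbedding hV hg.conj hy hP
  refine ⟨h1, h2 _ (Eventually.of_forall fun _ => rfl), ?_⟩
  -- The conjugate of the transform is known to be the transform of the conjugate only near `y`:
  -- away from `V` both are arbitrary choices. Hence `h3` is used for a section which agrees with
  -- the transform near the point.
  have h4 := h3 (fun y => (a.transform g y).conj)
    (a.eventually_transform_conj P hd₁ hd₂ hproper hemb.isEmbedding hV hg hy hP)
  rw [IntegralTransform.HolDiffOp.barFun, h4]
  refine LinearMap.ext fun l => LinearMap.ext fun m => ?_
  exact map_zero (starRingEnd ℂ)
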